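/- Let $0<a<\pi$, $\alpha>0$, $\alpha\neq 1$, and put $\rho(x)=1$, $\mu(x)=x$ for $0\le x\le a$, and $\rho(x)=\alpha$, $\mu(x)=\alpha x-\alpha a+a$ for $a<x\le\pi$. For $\lambda\in\mathbb C$ write $$s(x,\lambda)=\begin{pmatrix}\sin\lambda x\\-\cos\lambda x\end{pmatrix},\qquad \varphi_0(t,\lambda)=s(\mu(t),\lambda),\qquad \lambda_n^0=\frac{n\pi}{\mu(\pi)}\quad(n\in\mathbb Z),$$ and let $\tilde{\ }$ denote transposition. Given a $2\times2$ matrix function $F_0(x,t)$ on $[0,\mu(\pi)]\times(0,\pi)$, put $F(x,t)=F_0(\mu(x),t)$ and consider, for fixed $x\in(0,\pi]$, the main equation $$A(x,\mu(t))+F(x,t)+\int_0^{\mu(x)}A(x,\xi)F_0(\xi,t)\,d\xi=0\quad\text{for almost all } t\in(0,x)\tag{28}$$ for an unknown $2\times 2$ matrix function $A(x,\cdot)$ with (complex) entries in $L_2(0,\mu(x))$. Below, the sum of a series for $F_0$ is understood as follows: $F_0$ is measurable in $(x,t)$ and, for every $x\in[0,\mu(\pi)]$, the indicated partial sums, as functions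 of $t$, converge to $F_0(x,\cdot)$ in $L_2(0,\pi)$ as $N\to\infty$. (i) Let $p,q\in L_2(0,\pi)$ be real valued, $h_1\in\mathbb R$, $h_2>0$, and consider the boundary value problem $$By'+\Omega(x)y=\lambda\rho(x)y\quad(0<x<\pi),\qquad y_1(0)=0,\qquad(\lambda+h_1)y_1(\pi)+h_2y_2(\pi)=0,$$ $$B=\begin{pmatrix}0&1\\-1&0\end{pmatrix},\qquad\Omega=\begin{pmatrix}p&q\\q&-p\end{pmatrix},$$ with solutions absolutely continuous on $[0,\pi]$. Let $\varphi(\cdot,\lambda)$ be the solution of the system with $\varphi(0,\lambda)=(0,-1)^T$, and for an eigenvalue $\lambda$ let $$\alpha(\lambda)=\int_0^\pi\left(|\varphi_1(x,\lambda)|^2+|\varphi_2(x,\lambda)|^2\right)\rho(x)\,dx+\frac1{h_2}|\varphi_1(\pi,\lambda)|^2$$ be its normalizing number. Then the series $$F_0(x,t)=\lim_{N\to\infty}\Big[\sum_{\lambda}\frac1{\alpha(\lambda)}s(x,\lambda)\tilde\varphi_0(t,\lambda)-\sum_{n=-N}^{N}\frac1{\mu(\pi)}s(x,\lambda_n^0)\tilde\varphi_0(t,\lambda_n^0)\Big],$$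 in which the first sum is over all eigenvalues $\lambda$ with $|\lambda|<\lambda_N^0+\frac{\pi}{2\mu(\pi)}$, converges, and for each fixed $x\in(0,\pi]$ equation (28) with its sum $F_0$ has a unique solution $A(x,\cdot)\in L_2(0,\mu(x))$. (ii) Let $\lambda_n$ $(n\in\mathbb Z)$ be pairwise distinct real numbers and $\alpha_n$ $(n\in\mathbb Z)$ positive numbers with $\sum_n(\lambda_n-\lambda_n^0)^2<\infty$ and $\sum_n(\alpha_n-\mu(\pi))^2<\infty$. Then the series $$F_0(x,t)=\lim_{N\to\infty}\sum_{n=-N}^{N}\Big[\frac1{\alpha_n}s(x,\lambda_n)\tilde\varphi_0(t,\lambda_n)-\frac1{\mu(\pi)}s(x,\lambda_n^0)\tilde\varphi_0(t,\lambda_n^0)\Big]$$ converges, and for each fixed $x\in(0,\pi]$ equation (28) with its sum $F_0$ has a unique solution $A(x,\cdot)\in L_2(0,\mu(x))$. -/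

import Mathlib

open MeasureTheory Filter Topology

namespace DiracInverse

noncomputable section

/-- The discontinuous weight: `1` on `[0, a]` and `α` on `(a, π]`. -/
def rho (a α x : ℝ) : ℝ := if x ≤ a then 1 else α

/-- `μ(x) = x` on `[0, a]` and `μ(x) = α x - α a + a` on `(a, π]`. -/
def mu (a α x : ℝ) : ℝ := if x ≤ a then x else α * x - α * a + a

/-- The matrix `B` of the Dirac system. -/
def matB : Matrix (Fin 2) (Fin 2) ℂ := !![0, 1; -1, 0]

/-- The potential matrix `Ω(x)`. -/
def matOmega (p q : ℝ → ℝ) (x : ℝ) : Matrix (Fin 2) (Fin 2) ℂ :=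
  !![(p x : ℂ), (q x : ℂ); (q x : ℂ), -(p x : ℂ)]

/-- `y` solves `B y' + Ω(x) y = l ρ(x) y` on `(0, π)`: it is absolutely continuous on `[0, π]`
and satisfies the system almost everywhere. -/
def IsSolution (a α : ℝ) (p q : ℝ → ℝ) (l : ℂ) (y : ℝ → Fin 2 → ℂ) : Prop :=
  AbsolutelyContinuousOnInterval y 0 Real.pi ∧
    ∀ᵐ x ∂(volume.restrict (Set.Ioo 0 Real.pi)), ∃ y' : Fin 2 → ℂ, HasDerivAt y y' x ∧
      matB.mulVec y' + (matOmega p q x).mulVec (y x) = (l * (rho a α x : ℂ)) • y x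

/-- `l` is an eigenvalue: the system has a nontrivial solution with
`y₁(0) = 0` and `(l + h₁) y₁(π) + h₂ y₂(π) = 0`. -/
def IsEigenvalue (a α : ℝ) (p q : ℝ → ℝ) (h₁ h₂ : ℝ) (l : ℂ) : Prop :=
  ∃ y : ℝ → Fin 2 → ℂ, IsSolution a α p q l y ∧ (∃ x ∈ Set.Icc 0 Real.pi, y x ≠ 0) ∧
    y 0 0 = 0 ∧ (l + h₁) * y Real.pi 0 + h₂ * y Real.pi 1 = 0

/-- `φ(·, l)`: the solution with initial value `φ(0, l) = (0, -1)ᵀ`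
(its values on `[0, π]` are determined by these conditions). -/
def phi (a α : ℝ) (p q : ℝ → ℝ) (l : ℂ) : ℝ → Fin 2 → ℂ :=
  Classical.epsilon fun y => IsSolution a α p q l y ∧ y 0 = ![0, -1]

/-- The normalizing number
`∫₀^π (|φ₁(x,l)|² + |φ₂(x,l)|²) ρ(x) dx + |φ₁(π,l)|² / h₂`. -/
def normalizingNumber (a α : ℝ) (p q : ℝ → ℝ) (h₂ : ℝ) (l : ℂ) : ℝ :=
  (∫ x in (0 : ℝ)..Real.pi,
      (‖phi a α p q l x 0‖ ^ 2 + ‖phi a α p q l x 1‖ ^ 2) * rho a α x) +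
    1 / h₂ * ‖phi a α p q l Real.pi 0‖ ^ 2

/-- The column `(sin l s, -cos l s)ᵀ`. -/
def trigVec (l : ℂ) (s : ℝ) : Fin 2 → ℂ := ![Complex.sin (l * s), -Complex.cos (l * s)]

/-- `φ₀(t, l) = (sin l μ(t), -cos l μ(t))ᵀ`. -/
def phiZero (a α : ℝ) (l : ℂ) (t : ℝ) : Fin 2 → ℂ := trigVec l (mu a α t)

/-- The unperturbed numbers `λₙ⁰ = n π / μ(π)`. -/
def lamZero (a α : ℝ) (n : ℤ) : ℝ := n * Real.pi / mu a α Real.pi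

/-- `(1/w) (sin l x, -cos l x)ᵀ φ₀(t, l)ᵀ`, the term of the kernel series at frequency `l` with
weight `w`. -/
def kernelTerm (a α : ℝ) (l : ℂ) (w : ℝ) (x t : ℝ) : Matrix (Fin 2) (Fin 2) ℂ :=
  ((1 / w : ℝ) : ℂ) • Matrix.vecMulVec (trigVec l x) (phiZero a α l t)

/-- The eigenvalues inside the circle of radius `λ_N⁰ + π / (2 μ(π))` about the origin. -/
def eigenvaluesInside (a α : ℝ) (p q : ℝ → ℝ) (h₁ h₂ : ℝ) (N : ℕ) : Set ℂ :=
  {l | IsEigenvalue a α p q h₁ h₂ l ∧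
    ‖l‖ < lamZero a α N + Real.pi / (2 * mu a α Real.pi)}

/-- The `N`-th partial sum of the series for `F₀` of a boundary value problem: the terms of all
eigenvalues inside the `N`-th circle minus the terms of the `λₙ⁰` with `|n| ≤ N`. -/
def spectralPartialSum (a α : ℝ) (p q : ℝ → ℝ) (h₁ h₂ : ℝ) (N : ℕ) (x t : ℝ) :
    Matrix (Fin 2) (Fin 2) ℂ :=
  (∑ᶠ l ∈ eigenvaluesInside a α p q h₁ h₂ N,
      kernelTerm a α l (normalizingNumber a α p q h₂ l) x t) -
    ∑ n ∈ Finset.Icc (-(N : ℤ)) N,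
      kernelTerm a α (lamZero a α n : ℂ) (mu a α Real.pi) x t

/-- The `N`-th symmetric partial sum of the series for `F₀` built from numbers `lam n`, `nrm n`,
`n ∈ ℤ`. -/
def dataPartialSum (a α : ℝ) (lam nrm : ℤ → ℝ) (N : ℕ) (x t : ℝ) :
    Matrix (Fin 2) (Fin 2) ℂ :=
  ∑ n ∈ Finset.Icc (-(N : ℤ)) N,
    (kernelTerm a α (lam n : ℂ) (nrm n) x t -
      kernelTerm a α (lamZero a α n : ℂ) (mu a α Real.pi) x t)

/-- `F₀` is the sum of the series with partial sums `S`: it is measurable in both variables and,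
for every `x ∈ [0, μ(π)]`, `S N x ·` converges to `F₀ x ·` in `L₂(0, π)`. -/
def IsKernel (a α : ℝ) (S : ℕ → ℝ → ℝ → Matrix (Fin 2) (Fin 2) ℂ)
    (F₀ : ℝ → ℝ → Matrix (Fin 2) (Fin 2) ℂ) : Prop :=
  (∀ i j, Measurable fun z : ℝ × ℝ => F₀ z.1 z.2 i j) ∧
    ∀ x ∈ Set.Icc 0 (mu a α Real.pi), ∀ i j,
      Tendsto (fun N => eLpNorm (fun t => S N x t i j - F₀ x t i j) 2
        (volume.restrict (Set.Ioo 0 Real.pi))) atTop (𝓝 0)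

/-- The main equation at a fixed `x`, for an unknown `A` with entries in `L₂(0, μ(x))`:
`A(μ(t)) + F(x,t) + ∫₀^{μ(x)} A(ξ) F₀(ξ,t) dξ = 0` for almost all `t ∈ (0, x)`, where
`F(x,t) = F₀(μ(x),t)`. -/
def MainEquation (a α : ℝ) (F₀ : ℝ → ℝ → Matrix (Fin 2) (Fin 2) ℂ) (x : ℝ)
    (A : Matrix (Fin 2) (Fin 2) (Lp ℂ 2 (volume.restrict (Set.Ioo 0 (mu a α x))))) : Prop :=
  ∀ᵐ t ∂(volume.restrict (Set.Ioo 0 x)), ∀ i j,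
    A i j (mu a α t) + F₀ (mu a α x) t i j +
      ∫ ξ in (0 : ℝ)..(mu a α x), ∑ k, A i k ξ * F₀ ξ t k j = 0

end

end DiracInverse

/-!
Both kinds of spectral data are treated in one way. The partial sums of the series for `F₀` are
brought to the form `extendedPartialSum`: a family `(λₙ, αₙ)`, `n ∈ ℤ`, square summably close to
the unperturbed data `(λₙ⁰, μ(π))`, plus one term `c s(x, l) φ̃₀(t, l)` with `c ≥ 0`. For
prescribed data `c = 0`. `exists_isKernel_and_existsUnique` then gives the kernel and the unique
solvability.

**Asymptotics of the eigenvalues.** For a potential in `L₂` the data of the boundary value problem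
are obtained from Prüfer variables. For real `λ` the solution is `φ = R (sin θ, -cos θ)`, where
`θ' = λ ρ + Re ((p - i q) e^{2iθ})` and `θ(0) = 0`. Since `h₂ > 0`, the eigenvalues are real by
Green's formula (`IsEigenvalue.im_eq_zero`), and they are the solutions of
`θ(π, λ) = k π + π/2 - arctan ((λ + h₁) / h₂)`, one for each `k ∈ ℤ`, because `θ(π, λ)` and the
arctangent are continuous and strictly increasing in `λ` (`exists_eigenvalue_enumeration`). As the
arctangent changes by `π` between `-∞` and `∞`, the `k`-th eigenvalue is close to `λ_k⁰` for large
`k` and to `λ_{k+1}⁰` for large `-k`, so there is one eigenvalue more than there are `λₙ⁰`: it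
provides the additional term. The deviation of the other eigenvalues from `λₙ⁰`, and of the
normalizing numbers from `μ(π)`, is controlled by the phase `∫₀ˣ (p - i q) e^{2iθ}`. Integration
by parts (`IsPruferAngle.norm_phase_le`) replaces `θ` by `λ μ`, and Bessel's inequality for
exponentials at bounded distance from an orthogonal system makes the result square summable in `n`
(`exists_sum_norm_sq_phase_le`, `exists_spectral_data`).

**The kernel.** Products of sines and cosines are combinations of `e^{± iλ(x + μ(t))}` and
`e^{± iλ(x - μ(t))}`, so `F₀` is obtained from the scalar series
`∑ (e^{iλₙy} / αₙ - e^{iλₙ⁰y} / b)` with `b = μ(π)`. That series converges in `L₂(-2b, 2b)`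
(`summable_toLp_expTerm`), which gives convergence of the series for `F₀` in `L₂(0, π)` uniformly
in `x`, with a sum of the form `R(x, μ(t))` (`exists_kernel`).

**The main equation.** The substitution `τ = μ(t)` turns it, at a fixed `x`, into one equation
`v + K v = -g` in `L₂(0, μ(x))²` for each row `v` of `A`, where `K` is the sum of the rank-one
operators given by the terms of the series (`ae_integral_sum_mul_eq`). The rows
`eₙ = s(·, λₙ⁰)~ / √b` form a Parseval frame (`hasSum_norm_sq_inner_trigRow`), so that
`1 + K = ∑ |fₙ⟩⟨fₙ| + |z⟩⟨z|` with `fₙ = s(·, λₙ)~ / √αₙ` and `z = √c s(·, l)~`, while `K` itself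
is compact because `∑ ‖fₙ - eₙ‖² < ∞`. A null vector of `1 + K` is orthogonal to all `fₙ`. It
vanishes because exponentials whose distinct frequencies are square summably close to `(π / b) ℤ`
are complete in `L₂(-b, b)`: finitely many frequencies can be moved without affecting
completeness, and what remains is a small perturbation of an orthogonal basis
(`integral_norm_sq_eq_zero_of_forall_windowTransform`). The Fredholm alternative concludes
(`exists_frame_perturbation`).
-/

namespace DiracInverse

/-! ### Absolutely continuous functions -/

section AbsolutelyContinuous

variable {E F : Type*} [NormedAddCommGroup E] [NormedAddCommGroup F]

theorem absolutelyContinuous_of_dist_le {f : ℝ → E} {g : ℝ → F} {a b K : ℝ}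
    (hg : AbsolutelyContinuousOnInterval g a b)
    (h : ∀ x ∈ Set.uIcc a b, ∀ y ∈ Set.uIcc a b, dist (f x) (f y) ≤ K * dist (g x) (g y)) :
    AbsolutelyContinuousOnInterval f a b := by
  have h0 := Tendsto.const_mul K hg
  rw [mul_zero] at h0
  refine squeeze_zero' (Eventually.of_forall fun _ => Finset.sum_nonneg fun _ _ => dist_nonneg)
    ?_ h0
  have hmem : ∀ᶠ I in AbsolutelyContinuousOnInterval.totalLengthFilter ⊓
      𝓟 (AbsolutelyContinuousOnInterval.disjWithin a b),
      I ∈ AbsolutelyContinuousOnInterval.disjWithin a b :=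
    mem_inf_of_right (mem_principal_self _)
  filter_upwards [hmem] with I hI
  rw [Finset.mul_sum]
  exact Finset.sum_le_sum fun i hi => h _ (hI.1 i hi).1 _ (hI.1 i hi).2

theorem absolutelyContinuous_integral [NormedSpace ℝ E] {f : ℝ → E} {a b c : ℝ}
    (hf : IntervalIntegrable f volume a b) (hc : c ∈ Set.uIcc a b) :
    AbsolutelyContinuousOnInterval (fun x => ∫ u in c..x, f u) a b := by
  refine absolutelyContinuous_of_dist_le (K := 1)
    (hf.norm.absolutelyContinuousOnInterval_intervalIntegral hc) fun x hx y hy => ?_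
  have hx' : IntervalIntegrable f volume c x := hf.mono_set (Set.uIcc_subset_uIcc hc hx)
  have hy' : IntervalIntegrable f volume c y := hf.mono_set (Set.uIcc_subset_uIcc hc hy)
  rw [dist_eq_norm, dist_eq_norm, intervalIntegral.integral_interval_sub_left hx' hy',
    intervalIntegral.integral_interval_sub_left hx'.norm hy'.norm, one_mul, Real.norm_eq_abs]
  exact intervalIntegral.norm_integral_le_abs_integral_norm

/-- A continuously differentiable function of an absolutely continuous function is absolutely
continuous. -/
theorem absolutelyContinuous_comp [NormedSpace ℝ E] [ProperSpace E] [NormedSpace ℝ F]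
    {f : ℝ → E} {g : E → F} {a b : ℝ} (hg : ContDiff ℝ 1 g)
    (hf : AbsolutelyContinuousOnInterval f a b) :
    AbsolutelyContinuousOnInterval (fun x => g (f x)) a b := by
  obtain ⟨C, hC⟩ := hf.exists_bound
  obtain ⟨K, hK⟩ := (hg.contDiffOn (s := Metric.closedBall 0 C)).exists_lipschitzOnWith
    (by decide) (convex_closedBall 0 C) (isCompact_closedBall 0 C)
  refine absolutelyContinuous_of_dist_le hf fun x hx y hy => hK.dist_le_mul _ ?_ _ ?_
  · simpa using hC x hx
  · simpa using hC y hy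

/-- The fundamental theorem of calculus for absolutely continuous vector-valued functions. -/
theorem eq_add_integral_of_absolutelyContinuous [NormedSpace ℝ E] [CompleteSpace E]
    {f f' : ℝ → E} {a b : ℝ} (hab : a ≤ b)
    (hf : AbsolutelyContinuousOnInterval f a b) (hi : IntervalIntegrable f' volume a b)
    (hd : ∀ᵐ x ∂(volume.restrict (Set.Ioo a b)), HasDerivAt f (f' x) x) {x : ℝ}
    (hx : x ∈ Set.Icc a b) : f x = f a + ∫ u in a..x, f' u := by
  have ha : a ∈ Set.uIcc a b := Set.left_mem_uIcc
  have h1 := hf.sub (absolutelyContinuous_integral hi ha)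
  obtain ⟨C, hC⟩ := h1.const_of_ae_hasDerivAt_zero (by
    rw [ae_restrict_iff' measurableSet_Ioo] at hd
    have hne : ∀ᵐ x : ℝ, x ≠ a ∧ x ≠ b := by
      have h1 : ∀ᵐ x : ℝ, x ≠ a := by simp [ae_iff, measure_singleton]
      have h2 : ∀ᵐ x : ℝ, x ≠ b := by simp [ae_iff, measure_singleton]
      filter_upwards [h1, h2] with x h1 h2 using ⟨h1, h2⟩
    filter_upwards [hd, hi.ae_hasDerivAt_integral, hne] with x h1 h2 h3 hx
    have hx' := hx
    rw [Set.uIcc_of_le hab] at hx'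
    have h4 := (h1 ⟨lt_of_le_of_ne hx'.1 (Ne.symm h3.1), lt_of_le_of_ne hx'.2 h3.2⟩).sub
      (h2 hx a ha)
    simpa using h4)
  rw [← Set.uIcc_of_le hab] at hx
  have e1 := hC x hx
  have e2 := hC a ha
  simp only [Pi.sub_apply, intervalIntegral.integral_same, sub_zero] at e1 e2
  rw [e2, ← e1]
  abel

theorem ae_hasDerivAt_primitive [NormedSpace ℝ E] [CompleteSpace E] {f : ℝ → E} {a b : ℝ}
    (hab : a ≤ b) (hf : IntervalIntegrable f volume a b) :
    ∀ᵐ x ∂(volume.restrict (Set.Ioo a b)), HasDerivAt (fun x => ∫ u in a..x, f u) (f x) x := by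
  rw [ae_restrict_iff' measurableSet_Ioo]
  filter_upwards [hf.ae_hasDerivAt_integral] with x hx hxm
  refine hx ?_ a Set.left_mem_uIcc
  rw [Set.uIcc_of_le hab]
  exact ⟨hxm.1.le, hxm.2.le⟩

/-- Grönwall's inequality with an integrable coefficient. -/
theorem gronwall_of_integrable {u k : ℝ → ℝ} {A b : ℝ}
    (hk : IntervalIntegrable k volume 0 b) (hk0 : ∀ x, 0 ≤ k x)
    (hu : ContinuousOn u (Set.Icc 0 b))
    (h : ∀ x ∈ Set.Icc 0 b, u x ≤ A + ∫ s in (0 : ℝ)..x, k s * u s) {x : ℝ}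
    (hx : x ∈ Set.Icc 0 b) : u x ≤ A * Real.exp (∫ s in (0 : ℝ)..x, k s) := by
  have hb : 0 ≤ b := hx.1.trans hx.2
  have hku : IntervalIntegrable (fun s => k s * u s) volume 0 b :=
    hk.mul_continuousOn (by rwa [Set.uIcc_of_le hb])
  have h0 : (0 : ℝ) ∈ Set.uIcc 0 b := Set.left_mem_uIcc
  set W : ℝ → ℝ := fun x => A + ∫ s in (0 : ℝ)..x, k s * u s with hW
  set N : ℝ → ℝ := fun x => ∫ s in (0 : ℝ)..x, k s with hN
  have hWac : AbsolutelyContinuousOnInterval W 0 b :=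
    ((LipschitzWith.const A).lipschitzOnWith.absolutelyContinuousOnInterval).add
      (absolutelyContinuous_integral hku h0)
  have hNac : AbsolutelyContinuousOnInterval N 0 b := absolutelyContinuous_integral hk h0
  have hEac : AbsolutelyContinuousOnInterval (fun x => Real.exp (-N x)) 0 b :=
    absolutelyContinuous_comp (g := fun y : ℝ => Real.exp (-y)) (by fun_prop) hNac
  have hPac := hEac.mul hWac
  set D : ℝ → ℝ := fun x => Real.exp (-N x) * (k x * u x) - Real.exp (-N x) * (k x * W x) with hD
  have hc1 : ContinuousOn (fun x => Real.exp (-N x)) (Set.uIcc 0 b) := hEac.continuousOn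
  have hDi : IntervalIntegrable D volume 0 b :=
    (hku.continuousOn_mul hc1).sub
      ((hk.mul_continuousOn hWac.continuousOn).continuousOn_mul hc1)
  have hder : ∀ᵐ x ∂(volume.restrict (Set.Ioo 0 b)),
      HasDerivAt ((fun x => Real.exp (-N x)) * W) (D x) x := by
    filter_upwards [ae_hasDerivAt_primitive hb hk, ae_hasDerivAt_primitive hb hku] with x h1 h2
    have h3 := (h1.neg.exp).mul (h2.const_add A)
    refine h3.congr_deriv ?_
    simp only [hD, hW, hN, Pi.neg_apply]
    ring
  have key := eq_add_integral_of_absolutelyContinuous hb hPac hDi hder hx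
  have hneg : ∫ s in (0 : ℝ)..x, D s ≤ 0 := by
    have : 0 ≤ ∫ s in (0 : ℝ)..x, -D s := by
      refine intervalIntegral.integral_nonneg hx.1 fun s hs => ?_
      have hs' : s ∈ Set.Icc 0 b := ⟨hs.1, hs.2.trans hx.2⟩
      have : 0 ≤ Real.exp (-N s) * k s * (W s - u s) :=
        mul_nonneg (mul_nonneg (Real.exp_pos _).le (hk0 s)) (sub_nonneg.2 (h s hs'))
      simp only [hD]
      linarith
    rw [intervalIntegral.integral_neg] at this
    linarith
  have hle : Real.exp (-N x) * W x ≤ A := by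
    have e : Real.exp (-N x) * W x = Real.exp (-N 0) * W 0 + ∫ s in (0 : ℝ)..x, D s := key
    simp only [hN, hW, intervalIntegral.integral_same, neg_zero, Real.exp_zero, add_zero,
      one_mul] at e
    simp only [hN, hW]
    linarith
  calc u x ≤ W x := h x hx
    _ = (Real.exp (-N x) * W x) * Real.exp (N x) := by
        rw [mul_right_comm, ← Real.exp_add]; simp
    _ ≤ A * Real.exp (N x) := mul_le_mul_of_nonneg_right hle (Real.exp_pos _).le

end AbsolutelyContinuous

/-! ### The Prüfer angle -/

/-- The point `e^{ix}` of the unit circle. -/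
noncomputable def cis (x : ℝ) : ℂ := Complex.exp (x * Complex.I)

theorem cis_zero : cis 0 = 1 := by simp [cis]

theorem cis_add (x y : ℝ) : cis (x + y) = cis x * cis y := by
  simp [cis, add_mul, Complex.exp_add]

theorem norm_cis (x : ℝ) : ‖cis x‖ = 1 := Complex.norm_exp_ofReal_mul_I x

theorem cis_re (x : ℝ) : (cis x).re = Real.cos x := Complex.exp_ofReal_mul_I_re x

theorem cis_im (x : ℝ) : (cis x).im = Real.sin x := Complex.exp_ofReal_mul_I_im x

theorem conj_cis (x : ℝ) : (starRingEnd ℂ) (cis x) = cis (-x) := by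
  simp [cis, ← Complex.exp_conj]

theorem contDiff_cis {n : WithTop ℕ∞} : ContDiff ℝ n cis := by
  unfold cis
  exact (Complex.ofRealCLM.contDiff.mul contDiff_const).cexp

@[fun_prop]
theorem continuous_cis : Continuous cis := (contDiff_cis (n := 0)).continuous

theorem hasDerivAt_cis (x : ℝ) : HasDerivAt cis (Complex.I * cis x) x := by
  have h : HasDerivAt (fun x : ℝ => (x : ℂ) * Complex.I) (1 * Complex.I) x :=
    (Complex.ofRealCLM.hasDerivAt (x := x)).mul_const _
  refine h.cexp.congr_deriv ?_
  rw [one_mul, mul_comm]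
  rfl

theorem norm_cis_sub_cis_le (x y : ℝ) : ‖cis x - cis y‖ ≤ |x - y| := by
  have h : cis x - cis y = cis y * (cis (x - y) - 1) := by
    rw [mul_sub, ← cis_add, mul_one, add_sub_cancel]
  rw [h, norm_mul, norm_cis, one_mul, cis, mul_comm]
  exact Real.norm_exp_I_mul_ofReal_sub_one_le

section Prufer

variable {b : ℝ} {v : ℝ → ℂ}

/-- The right-hand side of the Prüfer equation is integrable. -/
theorem intervalIntegrable_mul_cis (hv : IntervalIntegrable v volume 0 b) {θ : ℝ → ℝ}
    (hθ : Continuous θ) :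
    IntervalIntegrable (fun u => v u * cis (2 * θ u)) volume 0 b :=
  hv.mul_continuousOn (by fun_prop)

theorem intervalIntegrable_re {f : ℝ → ℂ} {c d : ℝ} (hf : IntervalIntegrable f volume c d) :
    IntervalIntegrable (fun u => (f u).re) volume c d :=
  ⟨Complex.reCLM.integrable_comp hf.1, Complex.reCLM.integrable_comp hf.2⟩

theorem intervalIntegral_re {f : ℝ → ℂ} {c d : ℝ} (hf : IntervalIntegrable f volume c d) :
    ∫ u in c..d, (f u).re = (∫ u in c..d, f u).re :=
  Complex.reCLM.intervalIntegral_comp_comm hf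

theorem intervalIntegrable_of_mem {E : Type*} [NormedAddCommGroup E] {f : ℝ → E} {x : ℝ}
    (hf : IntervalIntegrable f volume 0 b) (hx : x ∈ Set.Icc 0 b) :
    IntervalIntegrable f volume 0 x := by
  refine hf.mono_set (Set.uIcc_subset_uIcc Set.left_mem_uIcc ?_)
  rwa [Set.uIcc_of_le (hx.1.trans hx.2)]

/-- The Prüfer equation `θ(x) = β(x) + ∫₀ˣ Re (v e^{2iθ})` has a solution: in the norm weighted by
`exp (-4 ∫₀ˣ |v|)` the right-hand side is a contraction with constant `1/2`. -/
theorem exists_prufer (hb : 0 ≤ b) (hv : IntervalIntegrable v volume 0 b) {β : ℝ → ℝ}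
    (hβ : Continuous β) :
    ∃ θ : ℝ → ℝ, Continuous θ ∧
      ∀ x ∈ Set.Icc 0 b, θ x = β x + ∫ u in (0 : ℝ)..x, (v u * cis (2 * θ u)).re := by
  have h0 : (0 : ℝ) ∈ Set.uIcc 0 b := Set.left_mem_uIcc
  set N : ℝ → ℝ := fun x => ∫ u in (0 : ℝ)..x, ‖v u‖ with hN
  have hNac : AbsolutelyContinuousOnInterval N 0 b := absolutelyContinuous_integral hv.norm h0
  have hNc : ContinuousOn N (Set.Icc 0 b) := by
    have := hNac.continuousOn
    rwa [Set.uIcc_of_le hb] at this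
  set W : ℝ → ℝ := fun x => Real.exp (4 * N (Set.projIcc 0 b hb x)) with hW
  have hWx : ∀ x ∈ Set.Icc 0 b, W x = Real.exp (4 * N x) := fun x hx => by
    simp only [hW, Set.projIcc_of_mem hb hx]
  have hWc : Continuous W := by
    have : Continuous fun x => N (Set.projIcc 0 b hb x) :=
      hNc.domRestrict.comp continuous_projIcc
    exact Real.continuous_exp.comp (continuous_const.mul this)
  have hWpos : ∀ x, 0 < W x := fun x => Real.exp_pos _
  -- The integral of the weight against the coefficient.
  have hint : ∀ x ∈ Set.Icc 0 b, ∫ u in (0 : ℝ)..x, 4 * ‖v u‖ * W u = W x - 1 := by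
    intro x hx
    have hac : AbsolutelyContinuousOnInterval (fun x => Real.exp (4 * N x)) 0 b :=
      absolutelyContinuous_comp (g := fun y : ℝ => Real.exp (4 * y)) (by fun_prop) hNac
    have h1 := eq_add_integral_of_absolutelyContinuous (f' := fun u => 4 * ‖v u‖ * W u) hb hac
      ((hv.norm.const_mul 4).mul_continuousOn hWc.continuousOn) (by
        filter_upwards [ae_hasDerivAt_primitive hb hv.norm,
          ae_restrict_mem measurableSet_Ioo] with x hx hxm
        refine ((hx.const_mul 4).exp).congr_deriv ?_
        rw [hWx x ⟨hxm.1.le, hxm.2.le⟩]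
        ring) hx
    rw [hWx x hx, h1]
    simp [hN]
  set Θ : C(Set.Icc 0 b, ℝ) → ℝ → ℝ := fun ζ u => W u * ζ (Set.projIcc 0 b hb u) with hΘ
  have hΘc : ∀ ζ, Continuous (Θ ζ) := fun ζ => by
    have : Continuous fun u => ζ (Set.projIcc 0 b hb u) := ζ.continuous.comp continuous_projIcc
    fun_prop
  have hΘi : ∀ ζ, IntervalIntegrable (fun u => (v u * cis (2 * Θ ζ u)).re) volume 0 b := fun ζ =>
    intervalIntegrable_re (intervalIntegrable_mul_cis hv (hΘc ζ))
  have hTc : ∀ ζ, ContinuousOn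
      (fun x => (W x)⁻¹ * (β x + ∫ u in (0 : ℝ)..x, (v u * cis (2 * Θ ζ u)).re))
      (Set.Icc 0 b) := fun ζ => by
    have h1 := (absolutelyContinuous_integral (hΘi ζ) h0).continuousOn
    rw [Set.uIcc_of_le hb] at h1
    exact (hWc.inv₀ fun x => (hWpos x).ne').continuousOn.mul (hβ.continuousOn.add h1)
  set T : C(Set.Icc 0 b, ℝ) → C(Set.Icc 0 b, ℝ) := fun ζ => ⟨_, (hTc ζ).domRestrict⟩ with hT
  have hTx : ∀ ζ (x : Set.Icc 0 b), T ζ x =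
      (W x)⁻¹ * (β x + ∫ u in (0 : ℝ)..x, (v u * cis (2 * Θ ζ u)).re) := fun ζ x => rfl
  have hcontr : ContractingWith (1 / 2) T := by
    refine ⟨by rw [← NNReal.coe_lt_coe]; norm_num, LipschitzWith.of_dist_le_mul fun ζ ξ => ?_⟩
    rw [ContinuousMap.dist_le (by positivity)]
    intro x
    have hx := x.2
    rw [hTx, hTx, Real.dist_eq, ← mul_sub, add_sub_add_left_eq_sub, ← intervalIntegral.integral_sub
      (intervalIntegrable_of_mem (hΘi ζ) hx) (intervalIntegrable_of_mem (hΘi ξ) hx), abs_mul,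
      abs_of_pos (inv_pos.2 (hWpos x))]
    have hbound : ‖∫ u in (0 : ℝ)..x, ((v u * cis (2 * Θ ζ u)).re - (v u * cis (2 * Θ ξ u)).re)‖ ≤
        ∫ u in (0 : ℝ)..x, (dist ζ ξ / 2) * (4 * ‖v u‖ * W u) := by
      refine intervalIntegral.norm_integral_le_of_norm_le hx.1 (Eventually.of_forall fun u _ => ?_)
        (((intervalIntegrable_of_mem hv hx).norm.const_mul 4).mul_continuousOn
          hWc.continuousOn |>.const_mul _)
      rw [← Complex.sub_re, ← mul_sub]
      refine (Complex.abs_re_le_norm _).trans ?_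
      rw [norm_mul]
      have h1 := norm_cis_sub_cis_le (2 * Θ ζ u) (2 * Θ ξ u)
      have h2 : |2 * Θ ζ u - 2 * Θ ξ u| ≤ 2 * W u * dist ζ ξ := by
        have e : 2 * Θ ζ u - 2 * Θ ξ u =
            2 * W u * (ζ (Set.projIcc 0 b hb u) - ξ (Set.projIcc 0 b hb u)) := by
          simp only [hΘ]; ring
        rw [e, abs_mul, abs_of_pos (mul_pos two_pos (hWpos u)), ← Real.dist_eq]
        exact mul_le_mul_of_nonneg_left (ContinuousMap.dist_apply_le_dist _)
          (mul_pos two_pos (hWpos u)).le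
      calc ‖v u‖ * ‖cis (2 * Θ ζ u) - cis (2 * Θ ξ u)‖ ≤ ‖v u‖ * (2 * W u * dist ζ ξ) :=
            mul_le_mul_of_nonneg_left (h1.trans h2) (norm_nonneg _)
        _ = _ := by ring
    rw [intervalIntegral.integral_const_mul, hint x hx, Real.norm_eq_abs] at hbound
    calc (W x)⁻¹ * _ ≤ (W x)⁻¹ * (dist ζ ξ / 2 * (W x - 1)) :=
          mul_le_mul_of_nonneg_left hbound (inv_pos.2 (hWpos x)).le
      _ ≤ (W x)⁻¹ * (dist ζ ξ / 2 * W x) := by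
          refine mul_le_mul_of_nonneg_left (mul_le_mul_of_nonneg_left ?_ (by positivity))
            (inv_pos.2 (hWpos x)).le
          linarith
      _ = _ := by
          have := (hWpos x).ne'
          push_cast
          field_simp
  have : Nonempty C(Set.Icc 0 b, ℝ) := ⟨0⟩
  set ζ := hcontr.fixedPoint
  have hζ : T ζ = ζ := hcontr.fixedPoint_isFixedPt
  refine ⟨Θ ζ, hΘc ζ, fun x hx => ?_⟩
  have h1 := hTx ζ ⟨x, hx⟩
  rw [hζ] at h1
  have h2 : Θ ζ x = W x * ζ ⟨x, hx⟩ := by simp only [hΘ, Set.projIcc_of_mem hb hx]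
  rw [h2, h1, mul_inv_cancel_left₀ (hWpos x).ne']

/-- Two solutions of Prüfer equations with nearby inhomogeneities are close. -/
theorem abs_prufer_sub_le (hv : IntervalIntegrable v volume 0 b)
    {β β' θ θ' : ℝ → ℝ} (hθc : Continuous θ) (hθc' : Continuous θ')
    (hθ : ∀ x ∈ Set.Icc 0 b, θ x = β x + ∫ u in (0 : ℝ)..x, (v u * cis (2 * θ u)).re)
    (hθ' : ∀ x ∈ Set.Icc 0 b, θ' x = β' x + ∫ u in (0 : ℝ)..x, (v u * cis (2 * θ' u)).re)
    {A : ℝ} (hA : ∀ x ∈ Set.Icc 0 b, |β x - β' x| ≤ A) {x : ℝ} (hx : x ∈ Set.Icc 0 b) :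
    |θ x - θ' x| ≤ A * Real.exp (∫ u in (0 : ℝ)..x, 2 * ‖v u‖) := by
  refine gronwall_of_integrable (u := fun x => |θ x - θ' x|) (hv.norm.const_mul 2)
    (fun _ => by positivity) (by fun_prop) (fun x hx => ?_) hx
  have hi := intervalIntegrable_of_mem
    (intervalIntegrable_re (intervalIntegrable_mul_cis hv hθc)) hx
  have hi' :=
    intervalIntegrable_of_mem (intervalIntegrable_re (intervalIntegrable_mul_cis hv hθc')) hx
  have e : θ x - θ' x = (β x - β' x) +
      ∫ u in (0 : ℝ)..x, ((v u * cis (2 * θ u)).re - (v u * cis (2 * θ' u)).re) := by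
    rw [intervalIntegral.integral_sub hi hi', hθ x hx, hθ' x hx]
    ring
  rw [e]
  refine (abs_add_le _ _).trans (add_le_add (hA x hx) ?_)
  change ‖∫ u in (0 : ℝ)..x, ((v u * cis (2 * θ u)).re - (v u * cis (2 * θ' u)).re)‖ ≤ _
  refine intervalIntegral.norm_integral_le_of_norm_le hx.1 (Eventually.of_forall fun u _ => ?_)
    (((intervalIntegrable_of_mem hv hx).norm.const_mul 2).mul_continuousOn
      (by fun_prop : Continuous fun u => |θ u - θ' u|).continuousOn)
  rw [← Complex.sub_re, ← mul_sub]
  refine (Complex.abs_re_le_norm _).trans ?_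
  rw [norm_mul]
  have h1 := norm_cis_sub_cis_le (2 * θ u) (2 * θ' u)
  rw [← mul_sub, abs_mul, abs_of_pos (two_pos : (0 : ℝ) < 2)] at h1
  calc _ ≤ ‖v u‖ * (2 * |θ u - θ' u|) := mul_le_mul_of_nonneg_left h1 (norm_nonneg _)
    _ = _ := by ring

/-- The Prüfer angle at the right end is strictly monotone in the inhomogeneity. -/
theorem prufer_lt (hb : 0 < b) (hv : IntervalIntegrable v volume 0 b)
    {β β' r θ θ' : ℝ → ℝ} (hθc : Continuous θ) (hθc' : Continuous θ')
    (hr : IntervalIntegrable r volume 0 b) (hr0 : ∀ x, 0 < r x)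
    (hβ : ∀ x ∈ Set.Icc 0 b, β' x - β x = ∫ u in (0 : ℝ)..x, r u)
    (hθ : ∀ x ∈ Set.Icc 0 b, θ x = β x + ∫ u in (0 : ℝ)..x, (v u * cis (2 * θ u)).re)
    (hθ' : ∀ x ∈ Set.Icc 0 b, θ' x = β' x + ∫ u in (0 : ℝ)..x, (v u * cis (2 * θ' u)).re) :
    θ b < θ' b := by
  have hbm : b ∈ Set.Icc 0 b := ⟨hb.le, le_rfl⟩
  have h0 : (0 : ℝ) ∈ Set.uIcc 0 b := Set.left_mem_uIcc
  -- The difference `d` satisfies the linear equation `d' = r + c d`.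
  set d : ℝ → ℝ := fun u => θ' u - θ u with hd
  set g : ℝ → ℝ := fun u => (v u * cis (2 * θ' u)).re - (v u * cis (2 * θ u)).re with hg
  set c : ℝ → ℝ := fun u => g u / d u with hc
  have hgi : IntervalIntegrable g volume 0 b :=
    (intervalIntegrable_re (intervalIntegrable_mul_cis hv hθc')).sub
      (intervalIntegrable_re (intervalIntegrable_mul_cis hv hθc))
  have hdc : Continuous d := hθc'.sub hθc
  have hgle : ∀ u, |g u| ≤ 2 * ‖v u‖ * |d u| := fun u => by
    simp only [hg]
    rw [← Complex.sub_re, ← mul_sub]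
    refine (Complex.abs_re_le_norm _).trans ?_
    rw [norm_mul]
    have h1 := norm_cis_sub_cis_le (2 * θ' u) (2 * θ u)
    rw [← mul_sub, abs_mul, abs_of_pos (two_pos : (0 : ℝ) < 2)] at h1
    calc _ ≤ ‖v u‖ * (2 * |θ' u - θ u|) := mul_le_mul_of_nonneg_left h1 (norm_nonneg _)
      _ = _ := by simp only [hd]; ring
  have hcd : ∀ u, c u * d u = g u := fun u => by
    by_cases h : d u = 0
    · have := hgle u
      rw [h, abs_zero, mul_zero] at this
      rw [h, mul_zero, abs_eq_zero.1 (le_antisymm this (abs_nonneg _))]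
    · exact div_mul_cancel₀ _ h
  have hcle : ∀ u, ‖c u‖ ≤ ‖2 * ‖v u‖‖ := fun u => by
    rw [Real.norm_eq_abs, Real.norm_eq_abs, abs_of_nonneg (by positivity : 0 ≤ 2 * ‖v u‖)]
    simp only [hc]
    rw [abs_div]
    exact div_le_of_le_mul₀ (abs_nonneg _) (by positivity) (hgle u)
  have hci : IntervalIntegrable c volume 0 b := by
    refine (hv.norm.const_mul 2).mono_fun ?_ (Eventually.of_forall hcle)
    have h1 : AEMeasurable g (volume.restrict (Set.uIoc 0 b)) :=
      hgi.def'.aestronglyMeasurable.aemeasurable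
    exact (h1.div hdc.measurable.aemeasurable).aestronglyMeasurable
  set N : ℝ → ℝ := fun x => ∫ u in (0 : ℝ)..x, c u with hN
  have hNac : AbsolutelyContinuousOnInterval N 0 b := absolutelyContinuous_integral hci h0
  have hE : AbsolutelyContinuousOnInterval (fun x => Real.exp (-N x)) 0 b :=
    absolutelyContinuous_comp (g := fun y : ℝ => Real.exp (-y)) (by fun_prop) hNac
  set D : ℝ → ℝ := fun x => ∫ u in (0 : ℝ)..x, (r u + g u) with hD
  have hDac : AbsolutelyContinuousOnInterval D 0 b :=
    absolutelyContinuous_integral (hr.add hgi) h0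
  have hDd : ∀ x ∈ Set.Icc 0 b, D x = d x := fun x hx => by
    simp only [hD, hd, hg]
    rw [intervalIntegral.integral_add (intervalIntegrable_of_mem hr hx)
      (intervalIntegrable_of_mem hgi hx), intervalIntegral.integral_sub
      (intervalIntegrable_of_mem (intervalIntegrable_re (intervalIntegrable_mul_cis hv hθc')) hx)
      (intervalIntegrable_of_mem (intervalIntegrable_re (intervalIntegrable_mul_cis hv hθc)) hx),
      ← hβ x hx, hθ x hx, hθ' x hx]
    ring
  have hEr : IntervalIntegrable (fun x => Real.exp (-N x) * r x) volume 0 b :=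
    hr.continuousOn_mul hE.continuousOn
  have key := eq_add_integral_of_absolutelyContinuous hb.le (hE.mul hDac) hEr (by
    filter_upwards [ae_hasDerivAt_primitive hb.le hci, ae_hasDerivAt_primitive hb.le (hr.add hgi),
      ae_restrict_mem measurableSet_Ioo] with x h1 h2 hxm
    refine ((h1.neg.exp).mul h2).congr_deriv ?_
    have h3 := hcd x
    have h4 : ∫ u in (0 : ℝ)..x, (r u + g u) = d x := hDd x ⟨hxm.1.le, hxm.2.le⟩
    simp only [Pi.neg_apply]
    rw [h4, ← h3]
    simp only [hN]
    ring) hbm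
  have hpos : 0 < ∫ u in (0 : ℝ)..b, Real.exp (-N u) * r u :=
    intervalIntegral.intervalIntegral_pos_of_pos hEr (fun x => mul_pos (Real.exp_pos _) (hr0 x)) hb
  have e : Real.exp (-N b) * D b =
      Real.exp (-N 0) * D 0 + ∫ u in (0 : ℝ)..b, Real.exp (-N u) * r u :=
    key
  rw [hDd b hbm] at e
  have hD0 : D 0 = 0 := by simp [hD]
  rw [hD0, mul_zero, zero_add] at e
  rw [← e] at hpos
  have := pos_of_mul_pos_right hpos (Real.exp_pos _).le
  simp only [hd] at this
  linarith

end Prufer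

/-! ### The weight and its primitive -/

section Weight

variable {a α : ℝ}

theorem rho_pos (hα : 0 < α) (x : ℝ) : 0 < rho a α x := by
  unfold rho
  split_ifs <;> linarith

theorem rho_le (x : ℝ) : rho a α x ≤ max 1 α := by
  unfold rho
  split_ifs <;> simp

theorem min_le_rho (x : ℝ) : min 1 α ≤ rho a α x := by
  unfold rho
  split_ifs <;> simp

theorem measurable_rho : Measurable (rho a α) :=
  Measurable.ite measurableSet_Iic measurable_const measurable_const

theorem intervalIntegrable_rho (hα : 0 < α) (c d : ℝ) :
    IntervalIntegrable (rho a α) volume c d := by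
  refine (intervalIntegrable_const (c := max 1 α)).mono_fun measurable_rho.aestronglyMeasurable
    (Eventually.of_forall fun x => ?_)
  dsimp only
  rw [Real.norm_of_nonneg (rho_pos hα x).le, Real.norm_of_nonneg (by positivity)]
  exact rho_le x

theorem continuous_mu : Continuous (mu a α) := by
  unfold mu
  refine Continuous.if_le continuous_id (by fun_prop) continuous_id continuous_const ?_
  rintro x rfl
  simp

theorem mu_zero (ha : 0 < a) : mu a α 0 = 0 := by simp [mu, ha.le]

theorem strictMono_mu (hα : 0 < α) : StrictMono (mu a α) := by
  intro x y h
  unfold mu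
  have := mul_lt_mul_of_pos_left h hα
  split_ifs with h1 h2 h2
  · exact h
  · have := mul_pos hα (sub_pos.2 (not_le.1 h2))
    linarith
  · linarith
  · linarith

theorem mu_pi_pos (ha : 0 < a) (hα : 0 < α) : 0 < mu a α Real.pi := by
  rw [← mu_zero (α := α) ha]
  exact strictMono_mu hα Real.pi_pos

theorem mu_mem_Icc (ha : 0 < a) (hα : 0 < α) {x : ℝ} (hx : x ∈ Set.Icc 0 Real.pi) :
    mu a α x ∈ Set.Icc 0 (mu a α Real.pi) :=
  ⟨by rw [← mu_zero (α := α) ha]; exact (strictMono_mu hα).monotone hx.1,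
    (strictMono_mu hα).monotone hx.2⟩

theorem hasDerivAt_mu {x : ℝ} (hx : x ≠ a) : HasDerivAt (mu a α) (rho a α x) x := by
  rcases lt_or_gt_of_ne hx with h | h
  · have h1 : mu a α =ᶠ[𝓝 x] id := by
      filter_upwards [Iio_mem_nhds h] with y hy
      simp [mu, (Set.mem_Iio.1 hy).le]
    rw [rho, if_pos h.le]
    exact (hasDerivAt_id x).congr_of_eventuallyEq h1
  · have h1 : mu a α =ᶠ[𝓝 x] fun y => α * y - α * a + a := by
      filter_upwards [Ioi_mem_nhds h] with y hy
      simp [mu, (not_le.2 (Set.mem_Ioi.1 hy))]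
    rw [rho, if_neg (not_le.2 h)]
    have h2 : HasDerivAt (fun y => α * y - α * a + a) (α * 1) x :=
      (((hasDerivAt_id x).const_mul α).sub_const _).add_const _
    rw [mul_one] at h2
    exact h2.congr_of_eventuallyEq h1

theorem integral_rho_eq (hα : 0 < α) (c d : ℝ) :
    ∫ u in c..d, rho a α u = mu a α d - mu a α c :=
  integral_eq_of_hasDerivAt_off_countable _ _ (Set.countable_singleton a)
    continuous_mu.continuousOn (fun _ hx => hasDerivAt_mu hx.2) (intervalIntegrable_rho hα _ _)

theorem integral_rho (ha : 0 < a) (hα : 0 < α) (x : ℝ) :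
    ∫ u in (0 : ℝ)..x, rho a α u = mu a α x := by
  rw [integral_rho_eq hα, mu_zero ha, sub_zero]

theorem ae_ne (a : ℝ) (s : Set ℝ) : ∀ᵐ x ∂(volume.restrict s), x ≠ a :=
  ae_restrict_of_ae (by simp [ae_iff, measure_singleton])

theorem absolutelyContinuous_mu (ha : 0 < a) (hα : 0 < α) (b : ℝ) :
    AbsolutelyContinuousOnInterval (mu a α) 0 b := by
  have h := absolutelyContinuous_integral (intervalIntegrable_rho (a := a) hα 0 b)
    Set.left_mem_uIcc
  simpa only [integral_rho ha hα] using h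

end Weight

/-! ### Solutions of the Dirac system -/

section Solutions

variable {a α : ℝ} {p q : ℝ → ℝ} {l : ℂ} {y z : ℝ → Fin 2 → ℂ}

theorem intervalIntegrable_of_memLp {f : ℝ → ℝ}
    (hf : MemLp f 2 (volume.restrict (Set.Ioo 0 Real.pi))) :
    IntervalIntegrable f volume 0 Real.pi := by
  rw [intervalIntegrable_iff_integrableOn_Ioo_of_le Real.pi_pos.le]
  exact hf.integrable one_le_two

theorem IsSolution.absolutelyContinuous_apply (hy : IsSolution a α p q l y) (i : Fin 2) :
    AbsolutelyContinuousOnInterval (fun x => y x i) 0 Real.pi :=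
  absolutelyContinuous_of_dist_le (K := 1) hy.1 fun x _ x' _ => by
    rw [one_mul]; exact dist_le_pi_dist _ _ _

theorem IsSolution.continuousOn_apply (hy : IsSolution a α p q l y) (i : Fin 2) :
    ContinuousOn (fun x => y x i) (Set.Icc 0 Real.pi) := by
  have := (hy.absolutelyContinuous_apply i).continuousOn
  rwa [Set.uIcc_of_le Real.pi_pos.le] at this

/-- The system in normal form. -/
theorem IsSolution.ae_hasDerivAt (hy : IsSolution a α p q l y) :
    ∀ᵐ x ∂(volume.restrict (Set.Ioo 0 Real.pi)),
      HasDerivAt (fun x => y x 0) (q x * y x 0 - p x * y x 1 - l * rho a α x * y x 1) x ∧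
      HasDerivAt (fun x => y x 1) (l * rho a α x * y x 0 - p x * y x 0 - q x * y x 1) x := by
  filter_upwards [hy.2] with x hx
  obtain ⟨y', hd, he⟩ := hx
  have h0 := congrFun he 0
  have h1 := congrFun he 1
  simp only [matB, matOmega, Pi.add_apply, Pi.smul_apply, smul_eq_mul, Matrix.mulVec,
    dotProduct, Fin.sum_univ_two, Matrix.of_apply, Matrix.cons_val_zero, Matrix.cons_val_one,
    Matrix.cons_val', Matrix.cons_val_fin_one] at h0 h1
  refine ⟨(hasDerivAt_pi.1 hd 0).congr_deriv ?_, (hasDerivAt_pi.1 hd 1).congr_deriv ?_⟩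
  · linear_combination -h1
  · linear_combination h0

theorem IsSolution.sub_smul (hy : IsSolution a α p q l y) (hz : IsSolution a α p q l z) (c : ℂ) :
    IsSolution a α p q l (fun x => y x - c • z x) := by
  refine ⟨hy.1.sub (hz.1.const_smul c), ?_⟩
  filter_upwards [hy.2, hz.2] with x hx hx'
  obtain ⟨y', hd, he⟩ := hx
  obtain ⟨z', hd', he'⟩ := hx'
  refine ⟨y' - c • z', hd.sub (hd'.const_smul c), ?_⟩
  rw [Matrix.mulVec_sub, Matrix.mulVec_sub, Matrix.mulVec_smul, Matrix.mulVec_smul, smul_sub,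
    ← he, smul_comm, ← he', smul_add]
  abel

theorem intervalIntegrable_ofReal {f : ℝ → ℝ} {c d : ℝ} (hf : IntervalIntegrable f volume c d) :
    IntervalIntegrable (fun x => (f x : ℂ)) volume c d :=
  ⟨hf.1.ofReal, hf.2.ofReal⟩

/-- A solution of the system that vanishes at `0` vanishes identically. -/
theorem IsSolution.eq_zero (hα : 0 < α) (hp : IntervalIntegrable p volume 0 Real.pi)
    (hq : IntervalIntegrable q volume 0 Real.pi) (hy : IsSolution a α p q l y) (h0 : y 0 = 0)
    {x : ℝ} (hx : x ∈ Set.Icc 0 Real.pi) : y x = 0 := by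
  have hc : ∀ i, ContinuousOn (fun x => y x i) (Set.uIcc 0 Real.pi) := fun i =>
    (hy.absolutelyContinuous_apply i).continuousOn
  have hr : IntervalIntegrable (fun x => l * (rho a α x : ℂ)) volume 0 Real.pi :=
    (intervalIntegrable_ofReal (intervalIntegrable_rho hα _ _)).const_mul l
  have hp' := intervalIntegrable_ofReal hp
  have hq' := intervalIntegrable_ofReal hq
  have i0 := ((hq'.mul_continuousOn (hc 0)).sub (hp'.mul_continuousOn (hc 1))).sub
    (hr.mul_continuousOn (hc 1))
  have i1 := ((hr.mul_continuousOn (hc 0)).sub (hp'.mul_continuousOn (hc 0))).sub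
    (hq'.mul_continuousOn (hc 1))
  set k : ℝ → ℝ := fun x => |p x| + |q x| + ‖l‖ * rho a α x with hk
  have hki : IntervalIntegrable k volume 0 Real.pi :=
    (hp.abs.add hq.abs).add ((intervalIntegrable_rho hα _ _).const_mul _)
  have hk0 : ∀ x, 0 ≤ k x := fun x => by
    have := (rho_pos (a := a) hα x).le
    positivity
  have hgr := gronwall_of_integrable (A := 0) (u := fun x => ‖y x 0‖ + ‖y x 1‖) hki hk0
    ((hy.continuousOn_apply 0).norm.add (hy.continuousOn_apply 1).norm) (fun x hx => by
      have e0 := eq_add_integral_of_absolutelyContinuous Real.pi_pos.le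
        (hy.absolutelyContinuous_apply 0) i0 (hy.ae_hasDerivAt.mono fun x h => h.1) hx
      have e1 := eq_add_integral_of_absolutelyContinuous Real.pi_pos.le
        (hy.absolutelyContinuous_apply 1) i1 (hy.ae_hasDerivAt.mono fun x h => h.2) hx
      simp only [h0, Pi.zero_apply, zero_add] at e0 e1
      rw [zero_add, e0, e1]
      refine (add_le_add (intervalIntegral.norm_integral_le_integral_norm hx.1)
        (intervalIntegral.norm_integral_le_integral_norm hx.1)).trans ?_
      have j0 := (intervalIntegrable_of_mem i0 hx).norm
      have j1 := (intervalIntegrable_of_mem i1 hx).norm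
      rw [← intervalIntegral.integral_add j0 j1]
      refine intervalIntegral.integral_mono_on hx.1 (j0.add j1)
        (intervalIntegrable_of_mem (hki.mul_continuousOn ((hc 0).norm.add (hc 1).norm)) hx)
        fun s _ => ?_
      have hρ := abs_of_pos (rho_pos (a := a) hα s)
      have b0 : ‖(q s : ℂ) * y s 0 - p s * y s 1 - l * rho a α s * y s 1‖ ≤
          |q s| * ‖y s 0‖ + |p s| * ‖y s 1‖ + ‖l‖ * rho a α s * ‖y s 1‖ := by
        refine (norm_sub_le _ _).trans (add_le_add ((norm_sub_le _ _).trans (le_of_eq ?_))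
          (le_of_eq ?_)) <;> simp [hρ]
      have b1 : ‖l * rho a α s * y s 0 - p s * y s 0 - (q s : ℂ) * y s 1‖ ≤
          ‖l‖ * rho a α s * ‖y s 0‖ + |p s| * ‖y s 0‖ + |q s| * ‖y s 1‖ := by
        refine (norm_sub_le _ _).trans (add_le_add ((norm_sub_le _ _).trans (le_of_eq ?_))
          (le_of_eq ?_)) <;> simp [hρ]
      refine (add_le_add b0 b1).trans (le_of_eq ?_)
      simp only [hk]
      ring) hx
  rw [zero_mul] at hgr
  have h1 : ‖y x 0‖ = 0 := by
    have := norm_nonneg (y x 0); have := norm_nonneg (y x 1); linarith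
  have h2 : ‖y x 1‖ = 0 := by
    have := norm_nonneg (y x 0); have := norm_nonneg (y x 1); linarith
  funext i
  fin_cases i
  · exact norm_eq_zero.1 h1
  · exact norm_eq_zero.1 h2

theorem IsSolution.eq_smul (hα : 0 < α) (hp : IntervalIntegrable p volume 0 Real.pi)
    (hq : IntervalIntegrable q volume 0 Real.pi) (hy : IsSolution a α p q l y)
    (hz : IsSolution a α p q l z) {c : ℂ} (h0 : y 0 = c • z 0) {x : ℝ}
    (hx : x ∈ Set.Icc 0 Real.pi) : y x = c • z x :=
  sub_eq_zero.1 ((hy.sub_smul hz c).eq_zero hα hp hq (sub_eq_zero.2 h0) hx)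

/-- The eigenvalues of the boundary value problem are real: by Green's formula for `y` and its
conjugate, the imaginary part of the eigenvalue times the squared norm of `(y, y₁(π))` vanishes. -/
theorem IsEigenvalue.im_eq_zero {h₁ h₂ : ℝ} (hα : 0 < α)
    (hh : 0 < h₂) (h : IsEigenvalue a α p q h₁ h₂ l) : l.im = 0 := by
  obtain ⟨y, hy, ⟨x₀, hx₀, hne⟩, hy0, hbc⟩ := h
  by_contra him
  have hπ := Real.pi_pos.le
  set n : ℝ → ℝ := fun x => Complex.normSq (y x 0) + Complex.normSq (y x 1) with hn
  have hnc : ContinuousOn n (Set.Icc 0 Real.pi) :=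
    (Complex.continuous_normSq.comp_continuousOn (hy.continuousOn_apply 0)).add
      (Complex.continuous_normSq.comp_continuousOn (hy.continuousOn_apply 1))
  have hn0 : ∀ x, 0 ≤ n x := fun x => add_nonneg (Complex.normSq_nonneg _) (Complex.normSq_nonneg _)
  have hacc : ∀ i, AbsolutelyContinuousOnInterval (fun x => (starRingEnd ℂ) (y x i)) 0 Real.pi :=
    fun i => absolutelyContinuous_of_dist_le (K := 1) (hy.absolutelyContinuous_apply i)
      fun x _ x' _ => by rw [one_mul, Complex.dist_conj_conj]
  have hF := ((hy.absolutelyContinuous_apply 0).smul (hacc 1)).sub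
    ((hy.absolutelyContinuous_apply 1).smul (hacc 0))
  have hrn : IntervalIntegrable (fun x => rho a α x * n x) volume 0 Real.pi :=
    (intervalIntegrable_rho hα _ _).mul_continuousOn (by rwa [Set.uIcc_of_le hπ])
  have key := eq_add_integral_of_absolutelyContinuous
    (f' := fun x => (-(2 * l.im * Complex.I)) * ((rho a α x * n x : ℝ) : ℂ)) hπ hF
    ((intervalIntegrable_ofReal hrn).const_mul _) (by
      filter_upwards [hy.ae_hasDerivAt] with x hx
      have c0 : HasDerivAt (fun x => (starRingEnd ℂ) (y x 0)) _ x := hx.1.star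
      have c1 : HasDerivAt (fun x => (starRingEnd ℂ) (y x 1)) _ x := hx.2.star
      have := (hx.1.mul c1).sub (hx.2.mul c0)
      refine this.congr_deriv ?_
      have e0 := Complex.mul_conj (y x 0)
      have e1 := Complex.mul_conj (y x 1)
      have e2 : l - (starRingEnd ℂ) l = 2 * l.im * Complex.I := by
        rw [Complex.sub_conj]; push_cast; ring
      simp only [hn, star_sub, star_mul', Complex.star_def, Complex.conj_ofReal]
      push_cast
      rw [← e0, ← e1, ← e2]
      ring) (Set.right_mem_Icc.2 hπ)
  rw [intervalIntegral.integral_const_mul, intervalIntegral.integral_ofReal] at key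
  simp only [Pi.sub_apply, Pi.mul_apply, smul_eq_mul, hy0, map_zero, zero_mul, mul_zero,
    sub_zero, zero_add] at key
  set I := ∫ x in (0 : ℝ)..Real.pi, rho a α x * n x with hI
  have hIpos : 0 < I := by
    have h1 : 0 < ∫ x in (0 : ℝ)..Real.pi, n x := by
      refine intervalIntegral.integral_pos Real.pi_pos hnc (fun x _ => hn0 x) ⟨x₀, hx₀, ?_⟩
      refine lt_of_le_of_ne (hn0 x₀) fun h => hne ?_
      have e0 : Complex.normSq (y x₀ 0) = 0 := by
        have := Complex.normSq_nonneg (y x₀ 0); have := Complex.normSq_nonneg (y x₀ 1)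
        simp only [hn] at h; linarith
      have e1 : Complex.normSq (y x₀ 1) = 0 := by
        have := Complex.normSq_nonneg (y x₀ 0); have := Complex.normSq_nonneg (y x₀ 1)
        simp only [hn] at h; linarith
      funext i
      fin_cases i
      · exact Complex.normSq_eq_zero.1 e0
      · exact Complex.normSq_eq_zero.1 e1
    have hmin : 0 < min 1 α := lt_min one_pos hα
    have h2 : min 1 α * ∫ x in (0 : ℝ)..Real.pi, n x ≤ I := by
      rw [← intervalIntegral.integral_const_mul]
      refine intervalIntegral.integral_mono_on hπ ?_ hrn fun x _ =>
        mul_le_mul_of_nonneg_right (min_le_rho x) (hn0 x)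
      exact ContinuousOn.intervalIntegrable (by
        rw [Set.uIcc_of_le hπ]; exact continuousOn_const.mul hnc)
    exact (mul_pos hmin h1).trans_le h2
  have hh' : (h₂ : ℂ) ≠ 0 := by exact_mod_cast hh.ne'
  have hbc1 : y Real.pi 1 = -((l + h₁) / h₂) * y Real.pi 0 := by
    field_simp
    linear_combination hbc
  have e2 : l - (starRingEnd ℂ) l = 2 * l.im * Complex.I := by
    rw [Complex.sub_conj]; push_cast; ring
  have e3 := Complex.mul_conj (y Real.pi 0)
  have hC : (2 * l.im * Complex.I) * ((I : ℂ) + Complex.normSq (y Real.pi 0) / h₂) = 0 := by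
    rw [← e3, ← e2]
    rw [hbc1, ← e2] at key
    simp only [map_mul, map_neg, map_div₀, map_add, Complex.conj_ofReal] at key
    field_simp at key ⊢
    linear_combination key
  rcases mul_eq_zero.1 hC with h | h
  · simp [him] at h
  · have h' : I + Complex.normSq (y Real.pi 0) / h₂ = 0 := by exact_mod_cast h
    have := div_nonneg (Complex.normSq_nonneg (y Real.pi 0)) hh.le
    linarith

end Solutions

/-! ### Prüfer variables for the Dirac system -/

section PruferSolution

variable {a α : ℝ} {p q : ℝ → ℝ} {l : ℝ} {θ : ℝ → ℝ}

/-- The complex potential `p - i q`. -/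
noncomputable def potential (p q : ℝ → ℝ) (x : ℝ) : ℂ := p x - q x * Complex.I

/-- `θ` is a Prüfer angle at the real spectral parameter `l`: the solution of
`θ' = l ρ + Re ((p - i q) e^{2iθ})` with `θ(0) = 0`. -/
def IsPruferAngle (a α : ℝ) (p q : ℝ → ℝ) (l : ℝ) (θ : ℝ → ℝ) : Prop :=
  Continuous θ ∧ ∀ x ∈ Set.Icc 0 Real.pi,
    θ x = l * mu a α x + ∫ u in (0 : ℝ)..x, (potential p q u * cis (2 * θ u)).re

/-- The complex phase `∫₀ˣ (p - i q) e^{2iθ}`: its real part is the deviation of the Prüfer angle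
from `l μ(x)`, its imaginary part the logarithm of the amplitude. -/
noncomputable def pruferPhase (p q : ℝ → ℝ) (θ : ℝ → ℝ) (x : ℝ) : ℂ :=
  ∫ u in (0 : ℝ)..x, potential p q u * cis (2 * θ u)

theorem intervalIntegrable_potential (hp : IntervalIntegrable p volume 0 Real.pi)
    (hq : IntervalIntegrable q volume 0 Real.pi) :
    IntervalIntegrable (potential p q) volume 0 Real.pi :=
  (intervalIntegrable_ofReal hp).sub ((intervalIntegrable_ofReal hq).mul_const _)

theorem IsPruferAngle.apply_zero (ha : 0 < a) (hθ : IsPruferAngle a α p q l θ) : θ 0 = 0 := by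
  rw [hθ.2 0 ⟨le_rfl, Real.pi_pos.le⟩, mu_zero ha]
  simp

variable (hp : IntervalIntegrable p volume 0 Real.pi)
  (hq : IntervalIntegrable q volume 0 Real.pi)

include hp hq

theorem exists_isPruferAngle (a α l : ℝ) : ∃ θ, IsPruferAngle a α p q l θ :=
  exists_prufer Real.pi_pos.le (intervalIntegrable_potential hp hq)
    (β := fun x => l * mu a α x) (continuous_mu.const_mul l)

theorem IsPruferAngle.eq_add_re (hθ : IsPruferAngle a α p q l θ) {x : ℝ}
    (hx : x ∈ Set.Icc 0 Real.pi) : θ x = l * mu a α x + (pruferPhase p q θ x).re := by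
  rw [hθ.2 x hx, pruferPhase, intervalIntegral_re (intervalIntegrable_of_mem
    (intervalIntegrable_mul_cis (intervalIntegrable_potential hp hq) hθ.1) hx)]

/-- The solution `(R sin θ, -R cos θ)` attached to a Prüfer angle, where
`R e^{iθ} = exp (i (l μ + conj w))` with the complex phase `w`. -/
theorem IsPruferAngle.exists_isSolution (ha : 0 < a) (hα : 0 < α)
    (hθ : IsPruferAngle a α p q l θ) :
    ∃ y, IsSolution a α p q l y ∧ ∀ x ∈ Set.Icc 0 Real.pi, y x =
      ![((Real.exp (pruferPhase p q θ x).im * Real.sin (θ x) : ℝ) : ℂ),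
        ((-(Real.exp (pruferPhase p q θ x).im * Real.cos (θ x)) : ℝ) : ℂ)] := by
  have hπ := Real.pi_pos.le
  have hvi := intervalIntegrable_mul_cis (intervalIntegrable_potential hp hq) hθ.1
  set w : ℝ → ℂ := pruferPhase p q θ with hw
  set Z : ℝ → ℂ := fun x =>
    Complex.exp (Complex.I * ((l * mu a α x : ℝ) + (starRingEnd ℂ) (w x))) with hZ
  have hZx : ∀ x ∈ Set.Icc 0 Real.pi, Z x = (Real.exp (w x).im : ℂ) * cis (θ x) := by
    intro x hx
    simp only [hZ, cis, Complex.ofReal_exp]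
    rw [← Complex.exp_add, hθ.eq_add_re hp hq hx]
    congr 1
    apply Complex.ext <;> simp [hw]
  have hwac : AbsolutelyContinuousOnInterval w 0 Real.pi :=
    absolutelyContinuous_integral hvi Set.left_mem_uIcc
  have hmac : AbsolutelyContinuousOnInterval (fun x => ((l * mu a α x : ℝ) : ℂ)) 0 Real.pi :=
    absolutelyContinuous_comp (g := fun y : ℝ => ((l * y : ℝ) : ℂ))
      (Complex.ofRealCLM.contDiff.comp (contDiff_const.mul contDiff_id))
      (absolutelyContinuous_mu ha hα _)
  have hcac : AbsolutelyContinuousOnInterval (fun x => (starRingEnd ℂ) (w x)) 0 Real.pi :=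
    absolutelyContinuous_of_dist_le (K := 1) hwac
      fun x _ x' _ => by rw [one_mul, Complex.dist_conj_conj]
  have hZac : AbsolutelyContinuousOnInterval Z 0 Real.pi :=
    absolutelyContinuous_comp (g := fun z : ℂ => Complex.exp (Complex.I * z))
      (contDiff_const.mul contDiff_id).cexp (hmac.add hcac)
  refine ⟨fun x => ![((Z x).im : ℂ), ((-(Z x).re : ℝ) : ℂ)], ⟨?_, ?_⟩, fun x hx => ?_⟩
  · refine absolutelyContinuous_of_dist_le (K := 1) hZac fun x _ x' _ => ?_
    rw [one_mul, dist_pi_le_iff dist_nonneg, Fin.forall_fin_two]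
    constructor
    · simp only [Matrix.cons_val_zero, Complex.dist_eq, ← Complex.ofReal_sub, Complex.norm_real,
        ← Complex.sub_im]
      exact Complex.abs_im_le_norm _
    · simp only [Matrix.cons_val_one, Matrix.cons_val_zero, Complex.dist_eq, ← Complex.ofReal_sub,
        Complex.norm_real]
      rw [neg_sub_neg, norm_sub_rev, ← Complex.sub_re]
      exact Complex.abs_re_le_norm _
  · filter_upwards [ae_hasDerivAt_primitive hπ hvi, ae_ne a (Set.Ioo 0 Real.pi),
      ae_restrict_mem measurableSet_Ioo] with x hx hxa hxm
    have hxm' : x ∈ Set.Icc 0 Real.pi := ⟨hxm.1.le, hxm.2.le⟩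
    have h1 : HasDerivAt (fun x => ((l * mu a α x : ℝ) : ℂ)) ((l * rho a α x : ℝ) : ℂ) x :=
      ((hasDerivAt_mu hxa).const_mul l).ofReal_comp
    have h2 : HasDerivAt (fun x => (starRingEnd ℂ) (w x)) _ x := hx.star
    have h3 : HasDerivAt Z _ x := ((h1.add h2).const_mul Complex.I).cexp
    -- The derivative is `i l ρ Z + i conj(p - i q) conj Z`.
    have h4 : HasDerivAt Z (Complex.I * (l * rho a α x) * Z x +
        Complex.I * (p x + q x * Complex.I) * (starRingEnd ℂ) (Z x)) x := by
      refine h3.congr_deriv ?_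
      have e1 : (starRingEnd ℂ) (cis (2 * θ x)) * Z x = (starRingEnd ℂ) (Z x) := by
        rw [hZx x hxm', map_mul, conj_cis, conj_cis, mul_left_comm, ← cis_add,
          Complex.conj_ofReal]
        congr 2
        ring
      rw [← e1]
      have e2 : (starRingEnd ℂ) (potential p q x) = p x + q x * Complex.I := by
        simp [potential, sub_eq_add_neg]
      rw [Complex.star_def, map_mul, e2]
      change Z x * _ = _
      push_cast
      ring
    set Z' := Complex.I * (l * rho a α x) * Z x +
        Complex.I * (p x + q x * Complex.I) * (starRingEnd ℂ) (Z x) with hZ'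
    have h5 : HasDerivAt (fun x => (Z x).im) Z'.im x :=
      (Complex.imCLM.hasFDerivAt.comp_hasDerivAt x h4)
    have h6 : HasDerivAt (fun x => (Z x).re) Z'.re x :=
      (Complex.reCLM.hasFDerivAt.comp_hasDerivAt x h4)
    refine ⟨![(Z'.im : ℂ), ((-Z'.re : ℝ) : ℂ)], ?_, ?_⟩
    · rw [hasDerivAt_pi, Fin.forall_fin_two]
      exact ⟨h5.ofReal_comp, h6.neg.ofReal_comp⟩
    · have e1 : Z'.im = l * rho a α x * (Z x).re + p x * (Z x).re + q x * (Z x).im := by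
        simp [hZ']; ring
      have e2 : Z'.re = -(l * rho a α x * (Z x).im) - q x * (Z x).re + p x * (Z x).im := by
        simp [hZ']; ring
      funext i
      fin_cases i
      · simp [matB, matOmega, e2]
        ring
      · simp [matB, matOmega, e1]
        ring
  · have hre : (Z x).re = Real.exp (w x).im * Real.cos (θ x) := by
      rw [hZx x hx, Complex.re_ofReal_mul, cis_re]
    have him : (Z x).im = Real.exp (w x).im * Real.sin (θ x) := by
      rw [hZx x hx, Complex.im_ofReal_mul, cis_im]
    simp only [hre, him]

theorem IsPruferAngle.phi_eq (ha : 0 < a) (hα : 0 < α) (hθ : IsPruferAngle a α p q l θ) {x : ℝ}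
    (hx : x ∈ Set.Icc 0 Real.pi) : phi a α p q l x =
      ![((Real.exp (pruferPhase p q θ x).im * Real.sin (θ x) : ℝ) : ℂ),
        ((-(Real.exp (pruferPhase p q θ x).im * Real.cos (θ x)) : ℝ) : ℂ)] := by
  obtain ⟨y, hy, hyx⟩ := hθ.exists_isSolution hp hq ha hα
  have hy0 : y 0 = ![0, -1] := by
    rw [hyx 0 ⟨le_rfl, Real.pi_pos.le⟩, hθ.apply_zero ha]
    simp [pruferPhase]
  have hφ := Classical.epsilon_spec
    (p := fun y => IsSolution a α p q (l : ℂ) y ∧ y 0 = ![0, -1]) ⟨y, hy, hy0⟩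
  have h1 := hφ.1.eq_smul hα hp hq hy (c := 1) (by rw [one_smul, hφ.2, hy0]) hx
  rw [one_smul, hyx x hx] at h1
  exact h1

theorem IsPruferAngle.normalizingNumber_eq (ha : 0 < a) (hα : 0 < α)
    (hθ : IsPruferAngle a α p q l θ) (h₂ : ℝ) :
    normalizingNumber a α p q h₂ l =
      (∫ x in (0 : ℝ)..Real.pi, Real.exp (2 * (pruferPhase p q θ x).im) * rho a α x) +
      1 / h₂ * (Real.exp (2 * (pruferPhase p q θ Real.pi).im) * Real.sin (θ Real.pi) ^ 2) := by
  have hπ := Real.pi_pos.le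
  unfold normalizingNumber
  congr 1
  · refine intervalIntegral.integral_congr fun x hx => ?_
    rw [Set.uIcc_of_le hπ] at hx
    simp only [hθ.phi_eq hp hq ha hα hx, Matrix.cons_val_zero, Matrix.cons_val_one,
      Complex.norm_real, Real.norm_eq_abs, sq_abs]
    rw [two_mul, Real.exp_add]
    have := Real.sin_sq_add_cos_sq (θ x)
    linear_combination (Real.exp (pruferPhase p q θ x).im ^ 2 * rho a α x) * this
  · rw [hθ.phi_eq hp hq ha hα ⟨hπ, le_rfl⟩]
    simp only [Matrix.cons_val_zero, Complex.norm_real, Real.norm_eq_abs, sq_abs]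
    rw [two_mul, Real.exp_add]
    ring

theorem IsPruferAngle.isEigenvalue_iff (ha : 0 < a) (hα : 0 < α)
    (hθ : IsPruferAngle a α p q l θ) {h₁ h₂ : ℝ} :
    IsEigenvalue a α p q h₁ h₂ l ↔
      (l + h₁) * Real.sin (θ Real.pi) = h₂ * Real.cos (θ Real.pi) := by
  have hπ := Real.pi_pos.le
  have hπm : Real.pi ∈ Set.Icc 0 Real.pi := ⟨hπ, le_rfl⟩
  have h0m : (0 : ℝ) ∈ Set.Icc 0 Real.pi := ⟨le_rfl, hπ⟩
  obtain ⟨z, hz, hzx⟩ := hθ.exists_isSolution hp hq ha hα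
  have hz0 : z 0 = ![0, -1] := by
    rw [hzx 0 h0m, hθ.apply_zero ha]
    simp [pruferPhase]
  constructor
  · rintro ⟨y, hy, ⟨x₀, hx₀, hne⟩, hy0, hbc⟩
    have hyz : ∀ x ∈ Set.Icc 0 Real.pi, y x = (-y 0 1) • z x := fun x hx =>
      hy.eq_smul hα hp hq hz (by
        rw [hz0]
        funext i
        fin_cases i <;> simp [hy0]) hx
    have hc : -y 0 1 ≠ 0 := fun h => hne (by rw [hyz x₀ hx₀, h, zero_smul])
    rw [hyz _ hπm, hzx _ hπm] at hbc
    simp only [Pi.smul_apply, smul_eq_mul, Matrix.cons_val_zero, Matrix.cons_val_one] at hbc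
    have hE : (Real.exp (pruferPhase p q θ Real.pi).im : ℂ) ≠ 0 := by
      exact_mod_cast (Real.exp_pos _).ne'
    have h3 : (-y 0 1 * (Real.exp (pruferPhase p q θ Real.pi).im : ℂ)) *
        (((l + h₁) * Real.sin (θ Real.pi) - h₂ * Real.cos (θ Real.pi) : ℝ) : ℂ) = 0 := by
      rw [← hbc]
      push_cast
      ring
    have h4 := (mul_eq_zero.1 h3).resolve_left (mul_ne_zero hc hE)
    exact sub_eq_zero.1 (by exact_mod_cast h4)
  · intro h
    refine ⟨z, hz, ⟨0, h0m, fun h0 => ?_⟩, by rw [hz0]; rfl, ?_⟩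
    · have := congrFun h0 1
      rw [hz0] at this
      simp at this
    · rw [hzx _ hπm]
      simp only [Matrix.cons_val_zero, Matrix.cons_val_one]
      have h' : ((l : ℂ) + h₁) * (Real.sin (θ Real.pi) : ℂ) = h₂ * (Real.cos (θ Real.pi) : ℂ) := by
        exact_mod_cast h
      push_cast at h' ⊢
      linear_combination (Complex.exp ((pruferPhase p q θ Real.pi).im : ℂ)) * h'

end PruferSolution

/-! ### Square summability of oscillatory integrals -/

section Bessel

variable {a α : ℝ}

theorem norm_toLp_sq {X : Type*} [MeasurableSpace X] {ν : Measure X} {f : X → ℂ}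
    (hf : MemLp f 2 ν) : ‖hf.toLp f‖ ^ 2 = ∫ x, ‖f x‖ ^ 2 ∂ν := by
  have h1 := inner_self_eq_norm_sq_to_K (𝕜 := ℂ) (hf.toLp f)
  have h2 : ∀ᵐ x ∂ν, inner ℂ (hf.toLp f x) (hf.toLp f x) = ((‖f x‖ ^ 2 : ℝ) : ℂ) := by
    filter_upwards [hf.coeFn_toLp] with x hx
    rw [hx, inner_self_eq_norm_sq_to_K]
    simp
  rw [MeasureTheory.L2.inner_def, integral_congr_ae h2, integral_complex_ofReal] at h1
  exact Complex.ofReal_injective (by push_cast; exact h1.symm)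

theorem integrable_norm_sq {X : Type*} [MeasurableSpace X] {ν : Measure X} {f : X → ℂ}
    (hf : MemLp f 2 ν) : Integrable (fun x => ‖f x‖ ^ 2) ν :=
  (memLp_two_iff_integrable_sq_norm hf.1).1 hf

theorem lamZero_mul_mu_pi (ha : 0 < a) (hα : 0 < α) (n : ℤ) :
    lamZero a α n * mu a α Real.pi = n * Real.pi :=
  div_mul_cancel₀ _ (mu_pi_pos ha hα).ne'

theorem cis_two_mul_int_mul_pi (n : ℤ) : cis (2 * (n * Real.pi)) = 1 := by
  rw [cis]
  have : ((2 * (n * Real.pi) : ℝ) : ℂ) * Complex.I = n * (2 * Real.pi * Complex.I) := by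
    push_cast; ring
  rw [this, Complex.exp_int_mul_two_pi_mul_I]

/-- Orthogonality of the functions `e^{2 i λₙ⁰ μ}` with respect to the weight. -/
theorem integral_rho_mul_cis (ha : 0 < a) (hα : 0 < α) (n : ℤ) :
    ∫ x in (0 : ℝ)..Real.pi, (rho a α x : ℂ) * cis (2 * (lamZero a α n * mu a α x)) =
      if n = 0 then (mu a α Real.pi : ℂ) else 0 := by
  split_ifs with hn
  · subst hn
    simp only [lamZero, Int.cast_zero, zero_mul, zero_div, mul_zero, cis_zero, mul_one]
    rw [intervalIntegral.integral_ofReal, integral_rho ha hα]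
  · have hc : (2 * lamZero a α n : ℂ) * Complex.I ≠ 0 := by
      have h1 : lamZero a α n ≠ 0 :=
        div_ne_zero (mul_ne_zero (by exact_mod_cast hn) Real.pi_ne_zero) (mu_pi_pos ha hα).ne'
      have h2 : (lamZero a α n : ℂ) ≠ 0 := by exact_mod_cast h1
      exact mul_ne_zero (mul_ne_zero two_ne_zero h2) Complex.I_ne_zero
    have hi : IntervalIntegrable
        (fun x => (rho a α x : ℂ) * cis (2 * (lamZero a α n * mu a α x))) volume 0 Real.pi := by
      have := continuous_mu (a := a) (α := α)
      exact (intervalIntegrable_ofReal (intervalIntegrable_rho hα _ _)).mul_continuousOn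
        (by fun_prop)
    rw [integral_eq_of_hasDerivAt_off_countable
      (fun x => ((2 * lamZero a α n : ℂ) * Complex.I)⁻¹ * cis (2 * (lamZero a α n * mu a α x)))
      (fun x => (rho a α x : ℂ) * cis (2 * (lamZero a α n * mu a α x)))
      (Set.countable_singleton a) ?_ (fun x hx => ?_) hi]
    · rw [lamZero_mul_mu_pi ha hα, cis_two_mul_int_mul_pi, mu_zero ha, mul_zero, mul_zero, cis_zero,
        sub_self]
    · have := continuous_mu (a := a) (α := α)
      exact (by fun_prop : Continuous _).continuousOn
    · have h1 := ((hasDerivAt_cis (2 * (lamZero a α n * mu a α x))).scomp x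
        (((hasDerivAt_mu (α := α) (x := x) hx.2).const_mul (lamZero a α n)).const_mul 2)).const_mul
          ((2 * lamZero a α n : ℂ) * Complex.I)⁻¹
      refine h1.congr_deriv ?_
      rw [Complex.real_smul, inv_mul_eq_iff_eq_mul₀ hc]
      push_cast
      ring

/-- Bessel's inequality for the system `e^{2 i λₙ⁰ μ}`. -/
theorem sum_norm_sq_integral_le (ha : 0 < a) (hα : 0 < α) {f : ℝ → ℂ}
    (hf : MemLp f 2 (volume.restrict (Set.Ioc 0 Real.pi))) (s : Finset ℤ) :
    ∑ n ∈ s, ‖∫ x in (0 : ℝ)..Real.pi, f x * cis (2 * (lamZero a α n * mu a α x))‖ ^ 2 ≤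
      mu a α Real.pi / min 1 α * ∫ x in (0 : ℝ)..Real.pi, ‖f x‖ ^ 2 := by
  have hπ := Real.pi_pos.le
  have hM := mu_pi_pos (α := α) ha hα
  have hμc := continuous_mu (a := a) (α := α)
  set M := mu a α Real.pi with hMdef
  set ν := volume.restrict (Set.Ioc 0 Real.pi)
  have hmin : 0 < min 1 α := lt_min one_pos hα
  set r : ℝ → ℝ := fun x => Real.sqrt (rho a α x) with hr
  have hrm : Measurable r := measurable_rho.sqrt
  have hr2 : ∀ x, r x * r x = rho a α x := fun x => Real.mul_self_sqrt (rho_pos hα x).le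
  have hrpos : ∀ x, 0 < r x := fun x => Real.sqrt_pos.2 (rho_pos hα x)
  set e : ℤ → ℝ → ℂ := fun n x =>
    ((Real.sqrt M)⁻¹ : ℂ) * ((r x : ℂ) * cis (-(2 * (lamZero a α n * mu a α x)))) with he
  have heL : ∀ n, MemLp (e n) 2 ν := fun n => by
    refine MemLp.of_bound (C := (Real.sqrt M)⁻¹ * Real.sqrt (max 1 α)) ?_
      (Eventually.of_forall fun x => ?_)
    · refine (Measurable.const_mul (Measurable.mul (Complex.measurable_ofReal.comp hrm)
        (by fun_prop : Continuous _).measurable) _).aestronglyMeasurable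
    · simp only [he, norm_mul, norm_cis, mul_one, norm_inv, Complex.norm_real]
      rw [Real.norm_of_nonneg (Real.sqrt_nonneg _), Real.norm_of_nonneg (hrpos x).le]
      exact mul_le_mul_of_nonneg_left (Real.sqrt_le_sqrt (rho_le x)) (by positivity)
  set F : ℝ → ℂ := fun x => ((r x)⁻¹ : ℂ) * f x with hF
  have hFle : ∀ x, ‖F x‖ ^ 2 ≤ (min 1 α)⁻¹ * ‖f x‖ ^ 2 := fun x => by
    simp only [hF, norm_mul, norm_inv, Complex.norm_real, mul_pow, Real.norm_eq_abs, inv_pow,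
      sq_abs]
    rw [sq (r x), hr2]
    exact mul_le_mul_of_nonneg_right (inv_anti₀ hmin (min_le_rho x)) (by positivity)
  have hFm : AEStronglyMeasurable F ν :=
    ((Complex.measurable_ofReal.comp hrm).inv.aestronglyMeasurable).mul hf.1
  have hFL : MemLp F 2 ν := by
    refine hf.of_le_mul (c := Real.sqrt (min 1 α)⁻¹) hFm (Eventually.of_forall fun x => ?_)
    rw [← Real.sqrt_sq (norm_nonneg (f x)), ← Real.sqrt_mul (by positivity)]
    exact Real.le_sqrt_of_sq_le (hFle x)
  have hinner : ∀ n m, inner ℂ ((heL n).toLp (e n)) ((heL m).toLp (e m)) =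
      if n = m then (1 : ℂ) else 0 := by
    intro n m
    rw [MeasureTheory.L2.inner_def]
    have h1 : ∀ᵐ x ∂ν, inner ℂ ((heL n).toLp (e n) x) ((heL m).toLp (e m) x) =
        (M⁻¹ : ℂ) * ((rho a α x : ℂ) * cis (2 * (lamZero a α (n - m) * mu a α x))) := by
      filter_upwards [(heL n).coeFn_toLp, (heL m).coeFn_toLp] with x h1 h2
      rw [h1, h2, RCLike.inner_apply]
      simp only [he, map_mul, map_inv₀, Complex.conj_ofReal, conj_cis, neg_neg]
      have e1 : cis (2 * (lamZero a α (n - m) * mu a α x)) =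
          cis (-(2 * (lamZero a α m * mu a α x))) * cis (2 * (lamZero a α n * mu a α x)) := by
        rw [← cis_add]
        congr 1
        simp only [lamZero]
        push_cast
        ring
      have e2 : (M : ℂ)⁻¹ = (Real.sqrt M : ℂ)⁻¹ * (Real.sqrt M : ℂ)⁻¹ := by
        rw [← mul_inv, ← Complex.ofReal_mul, Real.mul_self_sqrt hM.le]
      rw [e1, e2, ← hr2 x]
      push_cast
      ring
    rw [integral_congr_ae h1, ← intervalIntegral.integral_of_le hπ,
      intervalIntegral.integral_const_mul, integral_rho_mul_cis ha hα]
    by_cases h : n = m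
    · have : (M : ℂ) ≠ 0 := by exact_mod_cast hM.ne'
      rw [if_pos h, if_pos (by omega)]
      exact inv_mul_cancel₀ this
    · rw [if_neg h, if_neg (by omega), mul_zero]
  have hon : Orthonormal ℂ fun n => (heL n).toLp (e n) := by
    rw [orthonormal_iff_ite]
    exact hinner
  have hbes := hon.sum_inner_products_le (hFL.toLp F) (s := s)
  have hcoef : ∀ n, ‖∫ x in (0 : ℝ)..Real.pi, f x * cis (2 * (lamZero a α n * mu a α x))‖ ^ 2 =
      M * ‖inner ℂ ((heL n).toLp (e n)) (hFL.toLp F)‖ ^ 2 := by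
    intro n
    have h1 : ∀ᵐ x ∂ν, inner ℂ ((heL n).toLp (e n) x) (hFL.toLp F x) =
        ((Real.sqrt M)⁻¹ : ℂ) * (f x * cis (2 * (lamZero a α n * mu a α x))) := by
      filter_upwards [(heL n).coeFn_toLp, hFL.coeFn_toLp] with x h1 h2
      rw [h1, h2, RCLike.inner_apply]
      have : (r x : ℂ) ≠ 0 := by exact_mod_cast (hrpos x).ne'
      simp only [he, hF, map_mul, map_inv₀, Complex.conj_ofReal, conj_cis, neg_neg]
      field_simp
    rw [MeasureTheory.L2.inner_def, integral_congr_ae h1, ← intervalIntegral.integral_of_le hπ,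
      intervalIntegral.integral_const_mul, norm_mul, mul_pow, norm_inv, Complex.norm_real,
      Real.norm_of_nonneg (Real.sqrt_nonneg _), inv_pow, Real.sq_sqrt hM.le,
      mul_inv_cancel_left₀ hM.ne']
  have hnorm : ‖hFL.toLp F‖ ^ 2 ≤ (min 1 α)⁻¹ * ∫ x in (0 : ℝ)..Real.pi, ‖f x‖ ^ 2 := by
    rw [norm_toLp_sq, ← intervalIntegral.integral_const_mul, intervalIntegral.integral_of_le hπ]
    refine integral_mono (integrable_norm_sq hFL) ((integrable_norm_sq hf).const_mul _) hFle
  rw [Finset.sum_congr rfl fun n _ => hcoef n, ← Finset.mul_sum, div_eq_mul_inv, mul_assoc]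
  exact mul_le_mul_of_nonneg_left (hbes.trans hnorm) hM.le

/-- Bessel's inequality persists for frequencies at bounded distance from the `λₙ⁰`, by expansion
of the exponential in powers of the distance. -/
theorem sum_norm_sq_integral_le_of_bounded (ha : 0 < a) (hα : 0 < α) {f : ℝ → ℂ}
    (hf : MemLp f 2 (volume.restrict (Set.Ioc 0 Real.pi))) {D : ℝ} {lam : ℤ → ℝ}
    (hD : ∀ n, |lam n - lamZero a α n| ≤ D) (s : Finset ℤ) :
    ∑ n ∈ s, ‖∫ x in (0 : ℝ)..Real.pi, f x * cis (2 * (lam n * mu a α x))‖ ^ 2 ≤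
      Real.exp D * (Real.exp (D * (2 * mu a α Real.pi) ^ 2) *
        (mu a α Real.pi / min 1 α * ∫ x in (0 : ℝ)..Real.pi, ‖f x‖ ^ 2)) := by
  have hπ := Real.pi_pos.le
  have hM := mu_pi_pos (α := α) ha hα
  have hμc := continuous_mu (a := a) (α := α)
  have hmin : 0 < min 1 α := lt_min one_pos hα
  have hD0 : 0 ≤ D := (abs_nonneg _).trans (hD 0)
  set M := mu a α Real.pi with hMdef
  set C := M / min 1 α with hC
  have hC0 : 0 ≤ C := by positivity
  set Q := ∫ x in (0 : ℝ)..Real.pi, ‖f x‖ ^ 2 with hQ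
  have hQ0 : 0 ≤ Q := intervalIntegral.integral_nonneg hπ fun _ _ => by positivity
  have hμ : ∀ x ∈ Set.Ioc 0 Real.pi, 0 ≤ mu a α x ∧ mu a α x ≤ M := fun x hx =>
    mu_mem_Icc ha hα ⟨hx.1.le, hx.2⟩
  have hfi : IntegrableOn f (Set.Ioc 0 Real.pi) := hf.integrable one_le_two
  -- The moments of `f`.
  have hgL : ∀ k : ℕ, MemLp (fun x => (2 * mu a α x : ℂ) ^ k * f x) 2
      (volume.restrict (Set.Ioc 0 Real.pi)) := fun k => by
    refine hf.of_le_mul (c := (2 * M) ^ k) ?_ ?_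
    · exact (by fun_prop : Continuous fun x => (2 * mu a α x : ℂ) ^ k).aestronglyMeasurable.mul hf.1
    · filter_upwards [ae_restrict_mem measurableSet_Ioc] with x hx
      rw [norm_mul, norm_pow, norm_mul, Complex.norm_real, Real.norm_of_nonneg (hμ x hx).1]
      refine mul_le_mul_of_nonneg_right (pow_le_pow_left₀ ?_ ?_ k) (norm_nonneg _)
      · have := (hμ x hx).1
        positivity
      · simpa using (hμ x hx).2
  set b : ℤ → ℕ → ℂ := fun n k => ∫ x in (0 : ℝ)..Real.pi,
    (2 * mu a α x : ℂ) ^ k * f x * cis (2 * (lamZero a α n * mu a α x)) with hb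
  have hbs : ∀ k, ∑ n ∈ s, ‖b n k‖ ^ 2 ≤ ((2 * M) ^ 2) ^ k * (C * Q) := fun k => by
    refine (sum_norm_sq_integral_le ha hα (hgL k) s).trans ?_
    have h1 : ∫ x in (0 : ℝ)..Real.pi, ‖(2 * mu a α x : ℂ) ^ k * f x‖ ^ 2 ≤
        ((2 * M) ^ 2) ^ k * Q := by
      rw [hQ, ← intervalIntegral.integral_const_mul, intervalIntegral.integral_of_le hπ,
        intervalIntegral.integral_of_le hπ]
      refine integral_mono_ae (integrable_norm_sq (hgL k)) ((integrable_norm_sq hf).const_mul _) ?_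
      filter_upwards [ae_restrict_mem measurableSet_Ioc] with x hx
      rw [norm_mul, norm_pow, norm_mul, Complex.norm_real, Real.norm_of_nonneg (hμ x hx).1,
        mul_pow, ← pow_mul, mul_comm k 2, pow_mul]
      refine mul_le_mul_of_nonneg_right (pow_le_pow_left₀ (by positivity) (pow_le_pow_left₀ ?_ ?_ 2)
        k) (by positivity)
      · have := (hμ x hx).1
        positivity
      · simpa using (hμ x hx).2
    calc _ ≤ C * (((2 * M) ^ 2) ^ k * Q) := mul_le_mul_of_nonneg_left h1 hC0
      _ = _ := by ring
  have hsum : ∀ n, HasSum (fun k : ℕ => (((lam n - lamZero a α n : ℝ) : ℂ) * Complex.I) ^ k /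
      (k.factorial : ℂ) * b n k)
      (∫ x in (0 : ℝ)..Real.pi, f x * cis (2 * (lam n * mu a α x))) := by
    intro n
    set δ := lam n - lamZero a α n with hδ
    have h1 := intervalIntegral.hasSum_integral_of_dominated_convergence (μ := volume)
      (a := 0) (b := Real.pi)
      (F := fun (k : ℕ) x => ((δ : ℂ) * Complex.I) ^ k / (k.factorial : ℂ) *
        ((2 * mu a α x : ℂ) ^ k * f x * cis (2 * (lamZero a α n * mu a α x))))
      (f := fun x => f x * cis (2 * (lam n * mu a α x)))
      (fun k x => (D * (2 * M)) ^ k / k.factorial * ‖f x‖) (fun k => ?_) (fun k => ?_) ?_ ?_ ?_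
    · simpa only [intervalIntegral.integral_const_mul] using h1
    · rw [Set.uIoc_of_le hπ]
      exact ((hgL k).1.mul (by fun_prop : Continuous fun x =>
        cis (2 * (lamZero a α n * mu a α x))).aestronglyMeasurable).const_mul _
    · refine Eventually.of_forall fun x hx => ?_
      rw [Set.uIoc_of_le hπ] at hx
      have hx' := hμ x hx
      rw [norm_mul, norm_mul, norm_mul, norm_cis, mul_one, norm_div, norm_pow, norm_pow, norm_mul,
        norm_mul, Complex.norm_real, Complex.norm_real, Complex.norm_I, mul_one,
        Complex.norm_natCast, Real.norm_of_nonneg hx'.1, Complex.norm_ofNat, ← mul_assoc,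
        div_mul_eq_mul_div, ← mul_pow]
      refine mul_le_mul_of_nonneg_right (div_le_div_of_nonneg_right (pow_le_pow_left₀ ?_ ?_ k)
        (by positivity)) (norm_nonneg _)
      · have := hx'.1
        positivity
      · exact mul_le_mul (hD n) (mul_le_mul_of_nonneg_left hx'.2 two_pos.le)
          (mul_nonneg two_pos.le hx'.1) hD0
    · exact Eventually.of_forall fun x _ => (Real.summable_pow_div_factorial _).mul_right _
    · have : (fun x => ∑' k : ℕ, (D * (2 * M)) ^ k / k.factorial * ‖f x‖) =
          fun x => (∑' k : ℕ, (D * (2 * M)) ^ k / k.factorial) * ‖f x‖ := by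
        funext x
        rw [tsum_mul_right]
      rw [this]
      refine IntervalIntegrable.const_mul ?_ _
      rw [intervalIntegrable_iff_integrableOn_Ioc_of_le hπ]
      exact hfi.norm
    · refine Eventually.of_forall fun x _ => ?_
      have h2 := (NormedSpace.expSeries_div_hasSum_exp (𝔸 := ℂ)
        (((δ : ℂ) * Complex.I) * (2 * mu a α x))).mul_right
          (f x * cis (2 * (lamZero a α n * mu a α x)))
      rw [← Complex.exp_eq_exp_ℂ] at h2
      have e1 : cis (2 * (lam n * mu a α x)) =
          cis (2 * (δ * mu a α x)) * cis (2 * (lamZero a α n * mu a α x)) := by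
        rw [← cis_add, hδ]
        congr 1
        ring
      have e2 : Complex.exp (((δ : ℂ) * Complex.I) * (2 * mu a α x)) =
          cis (2 * (δ * mu a α x)) := by
        rw [cis]
        congr 1
        push_cast
        ring
      have e3 : f x * cis (2 * (lam n * mu a α x)) =
          Complex.exp (((δ : ℂ) * Complex.I) * (2 * mu a α x)) *
            (f x * cis (2 * (lamZero a α n * mu a α x))) := by
        rw [e1, e2]
        ring
      rw [e3]
      refine h2.congr_fun fun k => ?_
      rw [mul_pow]
      ring
  have hpart : ∀ K : ℕ, ∑ n ∈ s, ‖∑ k ∈ Finset.range K,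
      (((lam n - lamZero a α n : ℝ) : ℂ) * Complex.I) ^ k / (k.factorial : ℂ) * b n k‖ ^ 2 ≤
      Real.exp D * (Real.exp (D * (2 * M) ^ 2) * (C * Q)) := by
    intro K
    have hterm : ∀ n, ‖∑ k ∈ Finset.range K,
        (((lam n - lamZero a α n : ℝ) : ℂ) * Complex.I) ^ k / (k.factorial : ℂ) * b n k‖ ^ 2 ≤
        Real.exp D * ∑ k ∈ Finset.range K, D ^ k / k.factorial * ‖b n k‖ ^ 2 := by
      intro n
      have h1 : ‖∑ k ∈ Finset.range K,
          (((lam n - lamZero a α n : ℝ) : ℂ) * Complex.I) ^ k / (k.factorial : ℂ) * b n k‖ ≤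
          ∑ k ∈ Finset.range K, D ^ k / k.factorial * ‖b n k‖ := by
        refine norm_sum_le_of_le _ fun k _ => ?_
        rw [norm_mul, norm_div, norm_pow, norm_mul, Complex.norm_I, mul_one, Complex.norm_real,
          Complex.norm_natCast, Real.norm_eq_abs]
        refine mul_le_mul_of_nonneg_right (div_le_div_of_nonneg_right
          (pow_le_pow_left₀ (abs_nonneg _) (hD n) k) (by positivity)) (norm_nonneg _)
      have h2 : (∑ k ∈ Finset.range K, D ^ k / k.factorial * ‖b n k‖) ^ 2 ≤
          (∑ k ∈ Finset.range K, D ^ k / k.factorial) *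
            ∑ k ∈ Finset.range K, D ^ k / k.factorial * ‖b n k‖ ^ 2 := by
        refine Finset.sum_sq_le_sum_mul_sum_of_sq_le_mul _ (fun k _ => by positivity)
          (fun k _ => by positivity) fun k _ => le_of_eq ?_
        ring
      refine (pow_le_pow_left₀ (norm_nonneg _) h1 2).trans (h2.trans ?_)
      exact mul_le_mul_of_nonneg_right (Real.sum_le_exp_of_nonneg hD0 K)
        (Finset.sum_nonneg fun k _ => by positivity)
    refine (Finset.sum_le_sum fun n _ => hterm n).trans ?_
    rw [← Finset.mul_sum, Finset.sum_comm]
    refine mul_le_mul_of_nonneg_left ?_ (Real.exp_pos _).le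
    calc ∑ k ∈ Finset.range K, ∑ n ∈ s, D ^ k / k.factorial * ‖b n k‖ ^ 2
        ≤ ∑ k ∈ Finset.range K, (D * (2 * M) ^ 2) ^ k / k.factorial * (C * Q) := by
          refine Finset.sum_le_sum fun k _ => ?_
          rw [← Finset.mul_sum]
          refine (mul_le_mul_of_nonneg_left (hbs k) (by positivity)).trans (le_of_eq ?_)
          rw [mul_pow]
          ring
      _ ≤ _ := by
          rw [← Finset.sum_mul]
          exact mul_le_mul_of_nonneg_right (Real.sum_le_exp_of_nonneg (by positivity) K)
            (by positivity)
  refine le_of_tendsto' (tendsto_finsetSum s fun n _ => ((hsum n).tendsto_sum_nat.norm.pow 2)) hpart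

/-- The bound of `sum_norm_sq_integral_le_of_bounded` is uniform in the upper limit of
integration. -/
theorem exists_sum_norm_sq_integral_le (ha : 0 < a) (hα : 0 < α) {f : ℝ → ℂ}
    (hf : MemLp f 2 (volume.restrict (Set.Ioc 0 Real.pi))) {D : ℝ} {lam : ℤ → ℝ}
    (hD : ∀ n, |lam n - lamZero a α n| ≤ D) :
    ∃ C, ∀ x ∈ Set.Icc 0 Real.pi, ∀ s : Finset ℤ,
      ∑ n ∈ s, ‖∫ u in (0 : ℝ)..x, f u * cis (2 * (lam n * mu a α u))‖ ^ 2 ≤ C := by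
  refine ⟨Real.exp D * (Real.exp (D * (2 * mu a α Real.pi) ^ 2) *
    (mu a α Real.pi / min 1 α * ∫ x in (0 : ℝ)..Real.pi, ‖f x‖ ^ 2)), fun x hx s => ?_⟩
  have hg : MemLp ({u | u ≤ x}.indicator f) 2 (volume.restrict (Set.Ioc 0 Real.pi)) :=
    hf.indicator measurableSet_Iic
  have h1 := sum_norm_sq_integral_le_of_bounded ha hα hg hD s
  have h2 : ∀ n, ∫ u in (0 : ℝ)..Real.pi,
      {u | u ≤ x}.indicator f u * cis (2 * (lam n * mu a α u)) =
      ∫ u in (0 : ℝ)..x, f u * cis (2 * (lam n * mu a α u)) := fun n => by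
    rw [← intervalIntegral.integral_indicator hx]
    refine intervalIntegral.integral_congr fun u _ => ?_
    simp only [Set.indicator_apply]
    split_ifs <;> simp
  simp only [h2] at h1
  refine h1.trans (mul_le_mul_of_nonneg_left (mul_le_mul_of_nonneg_left
    (mul_le_mul_of_nonneg_left ?_ ?_)
    (Real.exp_pos _).le) (Real.exp_pos _).le)
  · rw [intervalIntegral.integral_of_le Real.pi_pos.le, intervalIntegral.integral_of_le
      Real.pi_pos.le]
    refine integral_mono (integrable_norm_sq hg) (integrable_norm_sq hf) fun u => ?_
    exact pow_le_pow_left₀ (norm_nonneg _) (norm_indicator_le_norm_self _ _) 2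
  · exact div_nonneg (mu_pi_pos ha hα).le (lt_min one_pos hα).le

end Bessel

/-! ### Square summability of the Prüfer phases -/

section Phase

variable {a α : ℝ} {p q : ℝ → ℝ} {l : ℝ} {θ : ℝ → ℝ}

/-- The Cauchy–Schwarz inequality with a weight. -/
theorem sq_integral_mul_le {f k : ℝ → ℝ} {b : ℝ} (hb : 0 ≤ b)
    (hf : ContinuousOn f (Set.Icc 0 b)) (hk : IntervalIntegrable k volume 0 b)
    (hk0 : ∀ x, 0 ≤ k x) :
    (∫ x in (0 : ℝ)..b, f x * k x) ^ 2 ≤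
      (∫ x in (0 : ℝ)..b, k x) * ∫ x in (0 : ℝ)..b, f x ^ 2 * k x := by
  rw [← Set.uIcc_of_le hb] at hf
  have h1 : IntervalIntegrable (fun x => f x * k x) volume 0 b := hk.continuousOn_mul hf
  have h2 : IntervalIntegrable (fun x => f x ^ 2 * k x) volume 0 b :=
    hk.continuousOn_mul (hf.pow 2)
  set A := ∫ x in (0 : ℝ)..b, k x
  set B := ∫ x in (0 : ℝ)..b, f x * k x
  set C := ∫ x in (0 : ℝ)..b, f x ^ 2 * k x
  have h3 : ∀ t : ℝ, 0 ≤ A * (t * t) + (-2 * B) * t + C := fun t => by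
    have h4 : 0 ≤ ∫ x in (0 : ℝ)..b, (t * t * k x - 2 * t * (f x * k x) + f x ^ 2 * k x) := by
      refine intervalIntegral.integral_nonneg hb fun x _ => ?_
      have := mul_nonneg (sq_nonneg (t - f x)) (hk0 x)
      linarith
    rw [intervalIntegral.integral_add ((hk.const_mul _).sub (h1.const_mul _)) h2,
      intervalIntegral.integral_sub (hk.const_mul _) (h1.const_mul _),
      intervalIntegral.integral_const_mul, intervalIntegral.integral_const_mul] at h4
    linarith
  have h5 := discrim_le_zero h3
  rw [discrim] at h5
  linarith

variable (hp : IntervalIntegrable p volume 0 Real.pi)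
  (hq : IntervalIntegrable q volume 0 Real.pi)

include hp hq

theorem norm_pruferPhase_le_integral (θ : ℝ → ℝ) {x : ℝ}
    (hx : x ∈ Set.Icc 0 Real.pi) :
    ‖pruferPhase p q θ x‖ ≤ ∫ u in (0 : ℝ)..Real.pi, ‖potential p q u‖ := by
  have hv := intervalIntegrable_potential hp hq
  refine (intervalIntegral.norm_integral_le_integral_norm hx.1).trans ?_
  simp only [norm_mul, norm_cis, mul_one]
  exact intervalIntegral.integral_mono_interval le_rfl hx.1 hx.2
    (Eventually.of_forall fun _ => norm_nonneg _) hv.norm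

theorem continuousOn_integral_potential {c : ℝ → ℝ} (hc : Continuous c) :
    ContinuousOn (fun x => ∫ u in (0 : ℝ)..x, potential p q u * cis (2 * c u))
      (Set.Icc 0 Real.pi) := by
  have h := (absolutelyContinuous_integral (intervalIntegrable_mul_cis
    (intervalIntegrable_potential hp hq) hc) Set.left_mem_uIcc).continuousOn
  rwa [Set.uIcc_of_le Real.pi_pos.le] at h

/-- An integration by parts reduces the Prüfer phase to the oscillatory integrals
`∫₀ˣ (p - i q) e^{2 i l μ}`. -/
theorem IsPruferAngle.norm_phase_le (hθ : IsPruferAngle a α p q l θ) {x : ℝ}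
    (hx : x ∈ Set.Icc 0 Real.pi) :
    ‖pruferPhase p q θ x‖ ≤ ‖∫ u in (0 : ℝ)..x, potential p q u * cis (2 * (l * mu a α u))‖ +
      2 * ∫ u in (0 : ℝ)..Real.pi,
        ‖∫ s in (0 : ℝ)..u, potential p q s * cis (2 * (l * mu a α s))‖ * ‖potential p q u‖ := by
  have hπ := Real.pi_pos.le
  have hμc := continuous_mu (a := a) (α := α)
  have hlμ : Continuous fun u => l * mu a α u := by fun_prop
  have hv := intervalIntegrable_potential hp hq
  have hvi := intervalIntegrable_mul_cis hv hθ.1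
  have hVi := intervalIntegrable_mul_cis hv hlμ
  set v := potential p q with hvdef
  set V : ℝ → ℂ := fun x => ∫ u in (0 : ℝ)..x, v u * cis (2 * (l * mu a α u)) with hV
  have hVac : AbsolutelyContinuousOnInterval V 0 Real.pi :=
    absolutelyContinuous_integral hVi Set.left_mem_uIcc
  have hVc := hVac.continuousOn
  set η : ℝ → ℝ := fun x => (pruferPhase p q θ x).re with hη
  have hwac : AbsolutelyContinuousOnInterval (pruferPhase p q θ) 0 Real.pi :=
    absolutelyContinuous_integral hvi Set.left_mem_uIcc
  have hηac : AbsolutelyContinuousOnInterval η 0 Real.pi :=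
    absolutelyContinuous_comp (g := Complex.re) Complex.reCLM.contDiff hwac
  have hcac : AbsolutelyContinuousOnInterval (fun x => cis (2 * η x)) 0 Real.pi :=
    absolutelyContinuous_comp (g := fun y : ℝ => cis (2 * y))
      (contDiff_cis.comp (contDiff_const.mul contDiff_id)) hηac
  have hri : IntervalIntegrable (fun u => ((v u * cis (2 * θ u)).re : ℂ)) volume 0 Real.pi :=
    intervalIntegrable_ofReal (intervalIntegrable_re hvi)
  have hji : IntervalIntegrable (fun u => V u * cis (2 * η u) * (2 * Complex.I *
      ((v u * cis (2 * θ u)).re : ℂ))) volume 0 Real.pi :=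
    (hri.const_mul _).continuousOn_mul (hVc.mul hcac.continuousOn)
  have key := eq_add_integral_of_absolutelyContinuous
    (f' := fun u => v u * cis (2 * θ u) + V u * cis (2 * η u) * (2 * Complex.I *
      ((v u * cis (2 * θ u)).re : ℂ))) hπ (hVac.smul hcac) (hvi.add hji) (by
      filter_upwards [ae_hasDerivAt_primitive hπ hVi, ae_hasDerivAt_primitive hπ hvi,
        ae_restrict_mem measurableSet_Ioo] with u h1 h2 hu
      have h3 : HasDerivAt η (v u * cis (2 * θ u)).re u :=
        (Complex.reCLM.hasFDerivAt.comp_hasDerivAt u h2)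
      have h4 := (hasDerivAt_cis (2 * η u)).scomp u (h3.const_mul 2)
      refine (h1.mul h4).congr_deriv ?_
      have e : cis (2 * θ u) = cis (2 * (l * mu a α u)) * cis (2 * η u) := by
        rw [← cis_add, hθ.eq_add_re hp hq ⟨hu.1.le, hu.2.le⟩]
        congr 1
        ring
      simp only [Complex.real_smul, Function.comp_apply]
      rw [show v u * cis (2 * θ u) + _ = v u * (cis (2 * (l * mu a α u)) * cis (2 * η u)) +
        V u * cis (2 * η u) * (2 * Complex.I * ((v u * cis (2 * θ u)).re : ℂ)) by rw [← e]]
      push_cast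
      ring) hx
  rw [intervalIntegral.integral_add (intervalIntegrable_of_mem hvi hx)
    (intervalIntegrable_of_mem hji hx)] at key
  have key' : V x * cis (2 * η x) = V 0 * cis (2 * η 0) + (pruferPhase p q θ x +
    ∫ u in (0 : ℝ)..x, V u * cis (2 * η u) * (2 * Complex.I *
      ((v u * cis (2 * θ u)).re : ℂ))) := key
  have hV0 : V 0 = 0 := intervalIntegral.integral_same
  rw [hV0, zero_mul, zero_add] at key'
  rw [eq_sub_of_add_eq key'.symm]
  refine (norm_sub_le _ _).trans (add_le_add (by rw [norm_mul, norm_cis, mul_one]) ?_)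
  have hVv : IntervalIntegrable (fun u => ‖V u‖ * ‖v u‖) volume 0 Real.pi :=
    hv.norm.continuousOn_mul hVc.norm
  have hle : ‖∫ u in (0 : ℝ)..x, V u * cis (2 * η u) * (2 * Complex.I *
      ((v u * cis (2 * θ u)).re : ℂ))‖ ≤ ∫ u in (0 : ℝ)..x, 2 * (‖V u‖ * ‖v u‖) := by
    refine intervalIntegral.norm_integral_le_of_norm_le hx.1 (Eventually.of_forall fun u _ => ?_)
      ((intervalIntegrable_of_mem hVv hx).const_mul 2)
    have h1 : |(v u * cis (2 * θ u)).re| ≤ ‖v u‖ := by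
      refine (Complex.abs_re_le_norm _).trans (le_of_eq ?_)
      rw [norm_mul, norm_cis, mul_one]
    rw [norm_mul, norm_mul, norm_mul, norm_mul, norm_cis, Complex.norm_I, Complex.norm_real,
      Complex.norm_ofNat, mul_one, mul_one, Real.norm_eq_abs]
    calc ‖V u‖ * (2 * |(v u * cis (2 * θ u)).re|) ≤ ‖V u‖ * (2 * ‖v u‖) := by gcongr
      _ = _ := by ring
  rw [intervalIntegral.integral_const_mul] at hle
  refine hle.trans (mul_le_mul_of_nonneg_left ?_ two_pos.le)
  exact intervalIntegral.integral_mono_interval le_rfl hx.1 hx.2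
    (Eventually.of_forall fun _ => by positivity) hVv

omit hp hq in
/-- The Prüfer phases at spectral parameters at bounded distance from the `λₙ⁰` are square
summable, uniformly in `x`. -/
theorem exists_sum_norm_sq_phase_le (ha : 0 < a) (hα : 0 < α)
    (hp : MemLp p 2 (volume.restrict (Set.Ioo 0 Real.pi)))
    (hq : MemLp q 2 (volume.restrict (Set.Ioo 0 Real.pi)))
    {D : ℝ} {lam : ℤ → ℝ} (hD : ∀ n, |lam n - lamZero a α n| ≤ D) {θ : ℤ → ℝ → ℝ}
    (hθ : ∀ n, IsPruferAngle a α p q (lam n) (θ n)) :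
    ∃ C, 0 ≤ C ∧ ∀ x ∈ Set.Icc 0 Real.pi, ∀ s : Finset ℤ,
      ∑ n ∈ s, ‖pruferPhase p q (θ n) x‖ ^ 2 ≤ C := by
  have hπ := Real.pi_pos.le
  have hp' := intervalIntegrable_of_memLp hp
  have hq' := intervalIntegrable_of_memLp hq
  have hv := intervalIntegrable_potential hp' hq'
  have hμc := continuous_mu (a := a) (α := α)
  have hvL : MemLp (potential p q) 2 (volume.restrict (Set.Ioc 0 Real.pi)) := by
    rw [← restrict_Ioo_eq_restrict_Ioc]
    have := (hq.ofReal (K := ℂ)).mul_const Complex.I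
    exact (hp.ofReal (K := ℂ)).sub this
  obtain ⟨C, hC⟩ := exists_sum_norm_sq_integral_le ha hα hvL hD
  set v := potential p q with hvdef
  set V : ℤ → ℝ → ℂ := fun n x => ∫ u in (0 : ℝ)..x, v u * cis (2 * (lam n * mu a α u)) with hV
  have hVc : ∀ n, ContinuousOn (V n) (Set.Icc 0 Real.pi) := fun n =>
    continuousOn_integral_potential hp' hq' (by fun_prop)
  set A := ∫ u in (0 : ℝ)..Real.pi, ‖v u‖ with hA
  have hA0 : 0 ≤ A := intervalIntegral.integral_nonneg hπ fun _ _ => norm_nonneg _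
  have hC0 : 0 ≤ C := by simpa using hC 0 ⟨le_rfl, hπ⟩ ∅
  refine ⟨2 * C + 8 * (A * (C * A)), by positivity, fun x hx s => ?_⟩
  have hterm : ∀ n, ‖pruferPhase p q (θ n) x‖ ^ 2 ≤
      2 * ‖V n x‖ ^ 2 + 8 * (A * ∫ u in (0 : ℝ)..Real.pi, ‖V n u‖ ^ 2 * ‖v u‖) := fun n => by
    have h1 := (hθ n).norm_phase_le hp' hq' hx
    have h2 := sq_integral_mul_le hπ (hVc n).norm hv.norm fun _ => norm_nonneg _
    set J := ∫ u in (0 : ℝ)..Real.pi, ‖V n u‖ * ‖v u‖ with hJ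
    have h3 : ‖pruferPhase p q (θ n) x‖ ≤ ‖V n x‖ + 2 * J := h1
    calc ‖pruferPhase p q (θ n) x‖ ^ 2 ≤ (‖V n x‖ + 2 * J) ^ 2 :=
          pow_le_pow_left₀ (norm_nonneg _) h3 2
      _ ≤ 2 * ‖V n x‖ ^ 2 + 8 * J ^ 2 := by nlinarith [sq_nonneg (‖V n x‖ - 2 * J)]
      _ ≤ _ := by linarith
  refine (Finset.sum_le_sum fun n _ => hterm n).trans ?_
  rw [Finset.sum_add_distrib, ← Finset.mul_sum, ← Finset.mul_sum, ← Finset.mul_sum]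
  have hint : ∀ n, IntervalIntegrable (fun u => ‖V n u‖ ^ 2 * ‖v u‖) volume 0 Real.pi := fun n =>
    hv.norm.continuousOn_mul (by rw [Set.uIcc_of_le hπ]; exact (hVc n).norm.pow 2)
  have hsum : ∑ n ∈ s, ∫ u in (0 : ℝ)..Real.pi, ‖V n u‖ ^ 2 * ‖v u‖ ≤ C * A := by
    rw [← intervalIntegral.integral_finsetSum fun n _ => hint n, hA,
      ← intervalIntegral.integral_const_mul]
    refine intervalIntegral.integral_mono_on hπ ?_ (hv.norm.const_mul C) fun u hu => ?_
    · have h := IntervalIntegrable.sum s fun n _ => hint n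
      rwa [Finset.sum_fn] at h
    · rw [← Finset.sum_mul]
      exact mul_le_mul_of_nonneg_right (hC u hu s) (norm_nonneg _)
  have h4 := hC x hx s
  have h5 : A * ∑ n ∈ s, ∫ u in (0 : ℝ)..Real.pi, ‖V n u‖ ^ 2 * ‖v u‖ ≤ A * (C * A) :=
    mul_le_mul_of_nonneg_left hsum hA0
  exact add_le_add (mul_le_mul_of_nonneg_left h4 two_pos.le)
    (mul_le_mul_of_nonneg_left h5 (by norm_num))

end Phase

/-! ### Enumeration of the eigenvalues -/

section Eigenvalues

variable {a α : ℝ} {p q : ℝ → ℝ} {h₁ h₂ : ℝ}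

/-- The boundary condition at `π` in terms of the Prüfer angle. -/
theorem boundary_condition_iff (hh : 0 < h₂) (l t : ℝ) :
    (l + h₁) * Real.sin t = h₂ * Real.cos t ↔
      ∃ k : ℤ, k * Real.pi = t - Real.pi / 2 + Real.arctan ((l + h₁) / h₂) := by
  rw [← Real.sin_eq_zero_iff]
  set u := (l + h₁) / h₂ with hu
  have e1 : t - Real.pi / 2 + Real.arctan u = (t + Real.arctan u) - Real.pi / 2 := by ring
  have hc : Real.cos (Real.arctan u) ≠ 0 := (Real.cos_arctan_pos u).ne'
  have e2 : Real.sin (Real.arctan u) = u * Real.cos (Real.arctan u) := by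
    rw [Real.sin_arctan, Real.cos_arctan]; ring
  have e3 : l + h₁ = u * h₂ := by rw [hu, div_mul_cancel₀ _ hh.ne']
  rw [e1, Real.sin_sub_pi_div_two, Real.cos_add, e2, e3]
  constructor
  · intro h
    have h' : u * Real.sin t = Real.cos t := mul_left_cancel₀ hh.ne' (by linarith)
    rw [← h']
    ring
  · intro h
    have h' : Real.cos (Real.arctan u) * (Real.cos t - u * Real.sin t) = 0 := by linarith
    have h'' := (mul_eq_zero.1 h').resolve_left hc
    linear_combination (-h₂) * h''

/-- The eigenvalues form a sequence indexed by the value of the Prüfer angle at `π`, which is a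
continuous and strictly increasing function of the spectral parameter. -/
theorem exists_eigenvalue_enumeration (ha : a ∈ Set.Ioo 0 Real.pi) (hα : 0 < α)
    (hp : IntervalIntegrable p volume 0 Real.pi) (hq : IntervalIntegrable q volume 0 Real.pi)
    (h₁ : ℝ) (hh : 0 < h₂) :
    ∃ (κ : ℤ → ℝ) (θ : ℤ → ℝ → ℝ), Function.Injective κ ∧
      (∀ l : ℂ, IsEigenvalue a α p q h₁ h₂ l ↔ ∃ k, l = κ k) ∧
      ∀ k, IsPruferAngle a α p q (κ k) (θ k) ∧
        θ k Real.pi = k * Real.pi + Real.pi / 2 - Real.arctan ((κ k + h₁) / h₂) := by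
  have hπ := Real.pi_pos
  have hπm : Real.pi ∈ Set.Icc 0 Real.pi := ⟨hπ.le, le_rfl⟩
  have hv := intervalIntegrable_potential hp hq
  have hM := mu_pi_pos (α := α) ha.1 hα
  choose ang hang using fun l => exists_isPruferAngle hp hq a α l
  set M := mu a α Real.pi with hMdef
  set A := ∫ u in (0 : ℝ)..Real.pi, ‖potential p q u‖ with hA
  -- Eigenvalues are the points where `T` is a multiple of `π`.
  set T : ℝ → ℝ := fun l => ang l Real.pi - Real.pi / 2 + Real.arctan ((l + h₁) / h₂) with hT
  have hatan : StrictMono fun l => Real.arctan ((l + h₁) / h₂) := fun l l' h =>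
    Real.arctan_strictMono (div_lt_div_of_pos_right (by linarith) hh)
  have hmono : StrictMono T := fun l l' h => by
    have h1 := prufer_lt hπ hv (r := fun u => (l' - l) * rho a α u) (hang l).1 (hang l').1
      ((intervalIntegrable_rho hα _ _).const_mul _)
      (fun u => mul_pos (sub_pos.2 h) (rho_pos hα u)) (fun x _ => by
        rw [intervalIntegral.integral_const_mul, integral_rho ha.1 hα]; ring)
      (hang l).2 (hang l').2
    have h2 := hatan h
    simp only [hT]
    simp only at h2
    linarith
  have hcont : Continuous fun l => ang l Real.pi := by
    set E := Real.exp (∫ u in (0 : ℝ)..Real.pi, 2 * ‖potential p q u‖) with hE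
    refine LipschitzWith.continuous (K := (M * E).toNNReal) (LipschitzWith.of_dist_le_mul
      fun l l' => ?_)
    have h1 := abs_prufer_sub_le hv (hang l).1 (hang l').1 (hang l).2 (hang l').2
      (A := |l - l'| * M) (fun x hx => by
        rw [← sub_mul, abs_mul, abs_of_nonneg (mu_mem_Icc ha.1 hα hx).1]
        exact mul_le_mul_of_nonneg_left (mu_mem_Icc ha.1 hα hx).2 (abs_nonneg _)) hπm
    rw [Real.coe_toNNReal _ (mul_nonneg hM.le (Real.exp_pos _).le), Real.dist_eq, Real.dist_eq]
    refine h1.trans (le_of_eq ?_)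
    ring
  have hTc : Continuous T := by
    simp only [hT]
    exact (hcont.sub continuous_const).add (Real.continuous_arctan.comp (by fun_prop))
  have hangb : ∀ l, |ang l Real.pi - l * M| ≤ A := fun l => by
    rw [(hang l).eq_add_re hp hq hπm, add_sub_cancel_left]
    exact (Complex.abs_re_le_norm _).trans (norm_pruferPhase_le_integral hp hq _ hπm)
  have hTb : ∀ l, |T l - l * M| ≤ A + Real.pi := fun l => by
    have h1 := abs_le.1 (hangb l)
    have h2 := Real.arctan_lt_pi_div_two ((l + h₁) / h₂)
    have h3 := Real.neg_pi_div_two_lt_arctan ((l + h₁) / h₂)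
    simp only [hT]
    rw [abs_le]
    constructor <;> linarith
  have hsurj : Function.Surjective T := by
    refine hTc.surjective ?_ ?_
    · refine tendsto_atTop_mono (f := fun l => l * M - (A + Real.pi)) (fun l => ?_)
        (tendsto_atTop_add_const_right _ _ (tendsto_id.atTop_mul_const hM))
      have := (abs_le.1 (hTb l)).1
      linarith
    · refine tendsto_atBot_mono (f := fun l => l * M + (A + Real.pi)) (fun l => ?_)
        (tendsto_atBot_add_const_right _ _ (tendsto_id.atBot_mul_const hM))
      have := (abs_le.1 (hTb l)).2
      linarith
  choose κ hκ using fun k : ℤ => hsurj (k * Real.pi)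
  refine ⟨κ, fun k => ang (κ k), fun k k' h => ?_, fun l => ?_, fun k => ⟨hang _, ?_⟩⟩
  · have h1 := hκ k
    rw [h, hκ k'] at h1
    exact_mod_cast (mul_right_cancel₀ hπ.ne' h1).symm
  · constructor
    · intro h
      have hre : l = (l.re : ℂ) := Complex.ext rfl (by simp [h.im_eq_zero hα hh])
      rw [hre, (hang l.re).isEigenvalue_iff hp hq ha.1 hα, boundary_condition_iff hh] at h
      obtain ⟨k, hk⟩ := h
      refine ⟨k, ?_⟩
      rw [hre]
      exact congrArg _ (hmono.injective ((hκ k).trans hk).symm)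
    · rintro ⟨k, rfl⟩
      rw [(hang (κ k)).isEigenvalue_iff hp hq ha.1 hα, boundary_condition_iff hh]
      exact ⟨k, (hκ k).symm⟩
  · have := hκ k
    simp only [hT] at this
    linarith

end Eigenvalues

/-! ### Asymptotics of the spectral data -/

section Asymptotics

variable {a α : ℝ} {p q : ℝ → ℝ} {h₁ h₂ : ℝ}

theorem summable_one_div_natAbs_add_one_sq : Summable fun n : ℤ => 1 / (|(n : ℝ)| + 1) ^ 2 := by
  have h : Summable fun n : ℕ => 1 / ((n : ℝ) + 1) ^ 2 := by
    have := (summable_nat_add_iff 1).2 (Real.summable_one_div_nat_pow.2 one_lt_two)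
    simpa using this
  refine Summable.of_nat_of_neg ?_ ?_ <;> simpa using h

/-- `π/2 - arctan u = O(1/u)` at `+∞`. -/
theorem abs_pi_div_two_sub_arctan_le {u U : ℝ} (hU : 0 ≤ U) (hu : -U ≤ u) :
    |Real.pi / 2 - Real.arctan u| ≤ 2 * Real.pi * (1 + U) / (1 + |u|) := by
  have hπ := Real.pi_gt_three
  have h1 := Real.arctan_lt_pi_div_two u
  have h2 := Real.neg_pi_div_two_lt_arctan u
  rw [abs_of_pos (by linarith), le_div_iff₀ (by positivity)]
  rcases le_or_gt u 1 with h | h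
  · have h3 : |u| ≤ 1 + U := abs_le.2 ⟨by linarith, by linarith⟩
    calc (Real.pi / 2 - Real.arctan u) * (1 + |u|) ≤ Real.pi * (2 + U) :=
          mul_le_mul (by linarith) (by linarith) (by positivity) (by linarith)
      _ ≤ _ := by nlinarith
  · have h3 : Real.pi / 2 - Real.arctan u ≤ u⁻¹ := by
      rw [← Real.arctan_inv_of_pos (by linarith)]
      have h4 : 0 ≤ Real.arctan u⁻¹ := Real.arctan_nonneg.2 (by positivity)
      have h5 := Real.le_tan h4 (Real.arctan_lt_pi_div_two _)
      rwa [Real.tan_arctan] at h5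
    have h4 : u⁻¹ * (1 + u) ≤ 2 := by
      rw [inv_mul_le_iff₀ (by linarith)]
      linarith
    rw [abs_of_pos (by linarith : 0 < u)]
    calc (Real.pi / 2 - Real.arctan u) * (1 + u) ≤ u⁻¹ * (1 + u) :=
          mul_le_mul_of_nonneg_right h3 (by linarith)
      _ ≤ 2 := h4
      _ ≤ _ := by nlinarith

theorem abs_exp_sub_one_le_mul_exp (y : ℝ) : |Real.exp y - 1| ≤ |y| * Real.exp |y| := by
  rcases le_total 0 y with h | h
  · have h1 := Real.add_one_le_exp (-y)
    have h2 : Real.exp (-y) * Real.exp y = 1 := by rw [← Real.exp_add]; simp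
    have h3 := Real.one_le_exp h
    rw [abs_of_nonneg h, abs_of_nonneg (by linarith)]
    nlinarith [mul_le_mul_of_nonneg_right h1 (Real.exp_pos y).le]
  · have h1 := Real.add_one_le_exp y
    have h2 := Real.exp_le_one_iff.2 h
    have h3 : 1 ≤ Real.exp |y| := Real.one_le_exp (abs_nonneg y)
    have h4 := mul_le_mul_of_nonneg_left h3 (abs_nonneg y)
    rw [abs_of_nonpos (by linarith)]
    rw [abs_of_nonpos h] at h4 ⊢
    linarith

/-- The increasing enumeration of the integers other than `-1`. The boundary condition places the
eigenvalue with index `skipNegOne n` near `λₙ⁰`, for both signs of `n`, and leaves the one with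
index `-1` without a partner. -/
def skipNegOne (n : ℤ) : ℤ := if 0 ≤ n then n else n - 1

theorem skipNegOne_injective : Function.Injective skipNegOne := fun m n h => by
  unfold skipNegOne at h
  split_ifs at h <;> omega

theorem skipNegOne_ne (n : ℤ) : skipNegOne n ≠ -1 := by
  unfold skipNegOne
  split_ifs <;> omega

theorem exists_skipNegOne_eq {k : ℤ} (hk : k ≠ -1) : ∃ n, skipNegOne n = k := by
  by_cases h : 0 ≤ k
  · exact ⟨k, by simp [skipNegOne, h]⟩
  · exact ⟨k + 1, by unfold skipNegOne; split_ifs <;> omega⟩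

/-- If `lam n - λₙ⁰` tends to zero, then from some `N` on the numbers `lam n` inside the circle of
radius `λ_N⁰ + π / (2 μ(π))` are those with `|n| ≤ N`. -/
theorem eventually_abs_lt_iff (ha : 0 < a) (hα : 0 < α) {lam : ℤ → ℝ}
    (h : Tendsto (fun n => lam n - lamZero a α n) cofinite (𝓝 0)) :
    ∀ᶠ N : ℕ in atTop, ∀ n : ℤ,
      |lam n| < lamZero a α N + Real.pi / (2 * mu a α Real.pi) ↔ n ∈ Finset.Icc (-(N : ℤ)) N := by
  have hM := mu_pi_pos (α := α) ha hα
  set r := Real.pi / (2 * mu a α Real.pi) with hr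
  have hr0 : 0 < r := by positivity
  have hl : ∀ n : ℤ, lamZero a α n = 2 * r * n := fun n => by
    rw [lamZero, hr]; field_simp
  have hfin : {n : ℤ | ¬ |lam n - lamZero a α n| < r}.Finite := by
    have h1 : ∀ᶠ n in cofinite, |lam n - lamZero a α n| < r := by
      have := h.abs
      rw [abs_zero] at this
      exact this.eventually_lt_const hr0
    exact h1
  have hR : Tendsto (fun N : ℕ => lamZero a α N + r) atTop atTop := by
    refine tendsto_atTop_add_const_right _ _ ?_
    have : Tendsto (fun N : ℕ => 2 * r * (N : ℝ)) atTop atTop :=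
      tendsto_natCast_atTop_atTop.const_mul_atTop (by positivity)
    refine this.congr fun N => ?_
    rw [hl]
    simp
  have hE : ∀ᶠ N : ℕ in atTop, ∀ n ∈ {n : ℤ | ¬ |lam n - lamZero a α n| < r},
      |lam n| < lamZero a α N + r ∧ n ∈ Finset.Icc (-(N : ℤ)) N := by
    rw [eventually_all_finite hfin]
    intro n _
    refine (hR.eventually_gt_atTop _).and ?_
    filter_upwards [eventually_ge_atTop n.natAbs] with N hN
    rw [Finset.mem_Icc]
    omega
  filter_upwards [hE] with N hN n
  by_cases hn : |lam n - lamZero a α n| < r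
  · rw [Finset.mem_Icc, ← abs_le]
    rw [hl] at hn
    rw [hl]
    have habs : |2 * r * (n : ℝ)| = 2 * r * |(n : ℝ)| := by
      rw [abs_mul, abs_of_pos (by positivity : 0 < 2 * r)]
    have t1 := abs_sub_abs_le_abs_sub (lam n) (2 * r * n)
    have t2 := abs_sub_abs_le_abs_sub (2 * r * n) (lam n)
    rw [abs_sub_comm] at t2
    rw [habs] at t1 t2
    push_cast
    constructor
    · intro h3
      by_contra h4
      have h5 : (N : ℤ) + 1 ≤ |n| := by omega
      have h6 : (N : ℝ) + 1 ≤ |(n : ℝ)| := by exact_mod_cast h5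
      nlinarith [mul_le_mul_of_nonneg_left h6 hr0.le]
    · intro h4
      have h6 : |(n : ℝ)| ≤ N := by exact_mod_cast h4
      nlinarith [mul_le_mul_of_nonneg_left h6 hr0.le]
  · exact ⟨fun _ => (hN n hn).2, fun _ => (hN n hn).1⟩

section Normalizing

variable {l : ℝ} {θ : ℝ → ℝ} (hp : IntervalIntegrable p volume 0 Real.pi)
  (hq : IntervalIntegrable q volume 0 Real.pi)

include hp hq

theorem IsPruferAngle.continuousOn_phase (hθ : IsPruferAngle a α p q l θ) :
    ContinuousOn (pruferPhase p q θ) (Set.Icc 0 Real.pi) :=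
  continuousOn_integral_potential hp hq hθ.1

theorem IsPruferAngle.intervalIntegrable_amplitude (hα : 0 < α)
    (hθ : IsPruferAngle a α p q l θ) :
    IntervalIntegrable (fun x => Real.exp (2 * (pruferPhase p q θ x).im) * rho a α x) volume 0
      Real.pi := by
  have h := hθ.continuousOn_phase hp hq
  rw [← Set.uIcc_of_le Real.pi_pos.le] at h
  exact (intervalIntegrable_rho hα _ _).continuousOn_mul (Real.continuous_exp.comp_continuousOn
    ((Complex.continuous_im.comp_continuousOn h).const_smul (2 : ℝ)))

theorem IsPruferAngle.normalizingNumber_pos (ha : 0 < a) (hα : 0 < α) (hh : 0 < h₂)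
    (hθ : IsPruferAngle a α p q l θ) : 0 < normalizingNumber a α p q h₂ l := by
  rw [hθ.normalizingNumber_eq hp hq ha hα]
  refine add_pos_of_pos_of_nonneg ?_ (by positivity)
  exact intervalIntegral.intervalIntegral_pos_of_pos (hθ.intervalIntegrable_amplitude hp hq hα)
    (fun x => mul_pos (Real.exp_pos _) (rho_pos hα x)) Real.pi_pos

/-- The normalizing number differs from `μ(π)` by the mean of the Prüfer phase and a boundary
term. -/
theorem IsPruferAngle.abs_normalizingNumber_sub_le (ha : 0 < a) (hα : 0 < α) (hh : 0 < h₂)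
    (hθ : IsPruferAngle a α p q l θ) {A : ℝ}
    (hA : ∀ x ∈ Set.Icc 0 Real.pi, ‖pruferPhase p q θ x‖ ≤ A) :
    |normalizingNumber a α p q h₂ l - mu a α Real.pi| ≤
      2 * Real.exp (2 * A) * (∫ x in (0 : ℝ)..Real.pi, ‖pruferPhase p q θ x‖ * rho a α x) +
        1 / h₂ * (Real.exp (2 * A) * Real.sin (θ Real.pi) ^ 2) := by
  have hπ := Real.pi_pos.le
  have hc := hθ.continuousOn_phase hp hq
  rw [← Set.uIcc_of_le hπ] at hc
  set w := pruferPhase p q θ with hw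
  have hwn : IntervalIntegrable (fun x => ‖w x‖ * rho a α x) volume 0 Real.pi :=
    (intervalIntegrable_rho hα _ _).continuousOn_mul hc.norm
  have hexp : ∀ x ∈ Set.Icc 0 Real.pi,
      |Real.exp (2 * (w x).im) - 1| ≤ 2 * Real.exp (2 * A) * ‖w x‖ := fun x hx => by
    have h1 : |2 * (w x).im| ≤ 2 * ‖w x‖ := by
      rw [abs_mul, abs_two]
      exact mul_le_mul_of_nonneg_left (Complex.abs_im_le_norm _) two_pos.le
    have h2 : |2 * (w x).im| ≤ 2 * A :=
      h1.trans (mul_le_mul_of_nonneg_left (hA x hx) two_pos.le)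
    calc _ ≤ |2 * (w x).im| * Real.exp |2 * (w x).im| := abs_exp_sub_one_le_mul_exp _
      _ ≤ (2 * ‖w x‖) * Real.exp (2 * A) :=
          mul_le_mul h1 (Real.exp_le_exp.2 h2) (Real.exp_pos _).le (by positivity)
      _ = _ := by ring
  have h2 : normalizingNumber a α p q h₂ l - mu a α Real.pi = (∫ x in (0 : ℝ)..Real.pi,
      (Real.exp (2 * (w x).im) - 1) * rho a α x) +
      1 / h₂ * (Real.exp (2 * (w Real.pi).im) * Real.sin (θ Real.pi) ^ 2) := by
    have h3 : ∫ x in (0 : ℝ)..Real.pi, (Real.exp (2 * (w x).im) - 1) * rho a α x =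
        (∫ x in (0 : ℝ)..Real.pi, Real.exp (2 * (w x).im) * rho a α x) - mu a α Real.pi := by
      rw [← integral_rho ha hα, ← intervalIntegral.integral_sub
        (hθ.intervalIntegrable_amplitude hp hq hα) (intervalIntegrable_rho hα _ _)]
      refine intervalIntegral.integral_congr fun x _ => ?_
      ring
    rw [hθ.normalizingNumber_eq hp hq ha hα, h3, add_sub_right_comm]
  have h3 : ‖∫ x in (0 : ℝ)..Real.pi, (Real.exp (2 * (w x).im) - 1) * rho a α x‖ ≤
      ∫ x in (0 : ℝ)..Real.pi, 2 * Real.exp (2 * A) * (‖w x‖ * rho a α x) := by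
    refine intervalIntegral.norm_integral_le_of_norm_le hπ (Eventually.of_forall
      fun x hx => ?_) (hwn.const_mul _)
    rw [Real.norm_eq_abs, abs_mul, abs_of_pos (rho_pos hα x), ← mul_assoc]
    exact mul_le_mul_of_nonneg_right (hexp x ⟨hx.1.le, hx.2⟩) (rho_pos hα x).le
  rw [intervalIntegral.integral_const_mul] at h3
  rw [h2]
  refine (abs_add_le _ _).trans (add_le_add h3 ?_)
  rw [abs_of_nonneg (by positivity)]
  refine mul_le_mul_of_nonneg_left (mul_le_mul_of_nonneg_right (Real.exp_le_exp.2 ?_)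
    (sq_nonneg _)) (by positivity)
  exact mul_le_mul_of_nonneg_left ((le_abs_self _).trans
    ((Complex.abs_im_le_norm _).trans (hA _ ⟨hπ, le_rfl⟩))) two_pos.le

end Normalizing

/-- The partial sums of the spectral series in terms of an enumeration of the eigenvalues. -/
theorem eventually_spectralPartialSum_eq (ha : 0 < a) (hα : 0 < α) {κ : ℤ → ℝ}
    (hκi : Function.Injective κ) (hκe : ∀ l : ℂ, IsEigenvalue a α p q h₁ h₂ l ↔ ∃ k, l = κ k)
    (hto : Tendsto (fun n => κ (skipNegOne n) - lamZero a α n) cofinite (𝓝 0)) :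
    ∀ᶠ N : ℕ in atTop, ∀ x t, spectralPartialSum a α p q h₁ h₂ N x t =
        kernelTerm a α (κ (-1)) (normalizingNumber a α p q h₂ (κ (-1))) x t +
          dataPartialSum a α (fun n => κ (skipNegOne n))
            (fun n => normalizingNumber a α p q h₂ (κ (skipNegOne n))) N x t := by
  have hπ := Real.pi_pos
  have hM := mu_pi_pos (α := α) ha hα
  have hl_lt : ∀ᶠ N : ℕ in atTop,
      |κ (-1)| < lamZero a α N + Real.pi / (2 * mu a α Real.pi) := by
    have h1 : Tendsto (fun N : ℕ => lamZero a α N + Real.pi / (2 * mu a α Real.pi)) atTop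
        atTop := by
      refine tendsto_atTop_add_const_right _ _ ?_
      have : Tendsto (fun N : ℕ => (N : ℝ) * (Real.pi / mu a α Real.pi)) atTop atTop :=
        tendsto_natCast_atTop_atTop.atTop_mul_const (by positivity)
      refine this.congr fun N => ?_
      rw [lamZero, mul_div_assoc]
      simp
    exact h1.eventually_gt_atTop _
  have hlami : Function.Injective fun n => κ (skipNegOne n) := hκi.comp skipNegOne_injective
  filter_upwards [eventually_abs_lt_iff ha hα hto, hl_lt] with N hN hlN x t
  have hset : eigenvaluesInside a α p q h₁ h₂ N =
      ((insert (κ (-1) : ℂ) ((Finset.Icc (-(N : ℤ)) N).image fun n => (κ (skipNegOne n) : ℂ)) :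
        Finset ℂ) : Set ℂ) := by
    ext z
    simp only [eigenvaluesInside, Set.mem_ofPred_eq, Finset.coe_insert, Finset.coe_image,
      Set.mem_insert_iff, Set.mem_image, Finset.mem_coe]
    rw [hκe]
    constructor
    · rintro ⟨⟨k, rfl⟩, hk⟩
      by_cases hk1 : k = -1
      · left
        rw [hk1]
      · right
        obtain ⟨n, rfl⟩ := exists_skipNegOne_eq hk1
        refine ⟨n, (hN n).1 ?_, rfl⟩
        simpa using hk
    · rintro (rfl | ⟨n, hn, rfl⟩)
      · exact ⟨⟨_, rfl⟩, by simpa using hlN⟩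
      · exact ⟨⟨_, rfl⟩, by simpa using (hN n).2 hn⟩
  have hnot : (κ (-1) : ℂ) ∉ (Finset.Icc (-(N : ℤ)) N).image fun n => (κ (skipNegOne n) : ℂ) := by
    rw [Finset.mem_image]
    rintro ⟨n, _, hn⟩
    exact skipNegOne_ne n (hκi (Complex.ofReal_injective hn))
  rw [spectralPartialSum, hset, finsum_mem_coe_finset, Finset.sum_insert hnot,
    Finset.sum_image fun m _ n _ h => hlami (Complex.ofReal_injective h), dataPartialSum,
    Finset.sum_sub_distrib, add_sub_assoc]

/-- The spectral data of the boundary value problem: a family indexed by `ℤ` that is square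
summably close to the unperturbed data, and one additional eigenvalue `l`. -/
theorem exists_spectral_data (ha : a ∈ Set.Ioo 0 Real.pi) (hα : 0 < α)
    (hp : MemLp p 2 (volume.restrict (Set.Ioo 0 Real.pi)))
    (hq : MemLp q 2 (volume.restrict (Set.Ioo 0 Real.pi))) (h₁ : ℝ) (hh : 0 < h₂) :
    ∃ (lam nrm : ℤ → ℝ) (l c : ℝ), Function.Injective lam ∧ (∀ n, 0 < nrm n) ∧
      Summable (fun n => (lam n - lamZero a α n) ^ 2) ∧
      Summable (fun n => (nrm n - mu a α Real.pi) ^ 2) ∧ 0 ≤ c ∧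
      ∀ᶠ N : ℕ in atTop, ∀ x t, spectralPartialSum a α p q h₁ h₂ N x t =
        (c : ℂ) • Matrix.vecMulVec (trigVec l x) (phiZero a α l t) +
          dataPartialSum a α lam nrm N x t := by
  have hπ := Real.pi_pos
  have hπm : Real.pi ∈ Set.Icc 0 Real.pi := ⟨hπ.le, le_rfl⟩
  have hp' := intervalIntegrable_of_memLp hp
  have hq' := intervalIntegrable_of_memLp hq
  have hM := mu_pi_pos (α := α) ha.1 hα
  obtain ⟨κ, ϑ, hκi, hκe, hκθ⟩ := exists_eigenvalue_enumeration ha hα hp' hq' h₁ hh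
  set M := mu a α Real.pi with hMdef
  set A := ∫ u in (0 : ℝ)..Real.pi, ‖potential p q u‖ with hA
  have hA0 : 0 ≤ A := intervalIntegral.integral_nonneg hπ.le fun _ _ => norm_nonneg _
  set lam : ℤ → ℝ := fun n => κ (skipNegOne n) with hlam
  set θ : ℤ → ℝ → ℝ := fun n => ϑ (skipNegOne n) with hθdef
  have hθ : ∀ n, IsPruferAngle a α p q (lam n) (θ n) := fun n => (hκθ _).1
  set w : ℤ → ℝ → ℂ := fun n => pruferPhase p q (θ n) with hw
  have hwA : ∀ n, ∀ x ∈ Set.Icc 0 Real.pi, ‖w n x‖ ≤ A := fun n x hx =>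
    norm_pruferPhase_le_integral hp' hq' (θ n) hx
  set u : ℤ → ℝ := fun n => (lam n + h₁) / h₂ with hu
  have hl0 : ∀ n : ℤ, lamZero a α n * M = n * Real.pi := lamZero_mul_mu_pi ha.1 hα
  -- The deviation splits into a boundary term and the Prüfer phase.
  set ε : ℤ → ℝ := fun n => (if 0 ≤ n then Real.pi / 2 else -(Real.pi / 2)) - Real.arctan (u n)
    with hε
  have hdev : ∀ n, (lam n - lamZero a α n) * M = ε n - (w n Real.pi).re := fun n => by
    have h1 := (hθ n).eq_add_re hp' hq' hπm
    have h2 : θ n Real.pi = (skipNegOne n : ℤ) * Real.pi + Real.pi / 2 - Real.arctan (u n) :=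
      (hκθ (skipNegOne n)).2
    have h3 : (skipNegOne n : ℝ) * Real.pi + Real.pi / 2 =
        n * Real.pi + (if 0 ≤ n then Real.pi / 2 else -(Real.pi / 2)) := by
      unfold skipNegOne
      split_ifs
      · rfl
      · push_cast; ring
    rw [sub_mul, hl0]
    simp only [hε, hw]
    linarith
  have hεb : ∀ n, |ε n| ≤ Real.pi := fun n => by
    have h1 := Real.arctan_lt_pi_div_two (u n)
    have h2 := Real.neg_pi_div_two_lt_arctan (u n)
    simp only [hε]
    rw [abs_le]
    split_ifs <;> constructor <;> linarith
  have hwre : ∀ n, |(w n Real.pi).re| ≤ ‖w n Real.pi‖ := fun n => Complex.abs_re_le_norm _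
  set D := (Real.pi + A) / M with hDdef
  have hD0 : 0 ≤ D := by positivity
  have hD : ∀ n, |lam n - lamZero a α n| ≤ D := fun n => by
    have h1 : |lam n - lamZero a α n| * M = |(lam n - lamZero a α n) * M| := by
      rw [abs_mul, abs_of_pos hM]
    rw [hDdef, le_div_iff₀ hM, h1, hdev]
    exact (abs_sub _ _).trans (add_le_add (hεb n) ((hwre n).trans (hwA n _ hπm)))
  obtain ⟨C, hC0, hC⟩ := exists_sum_norm_sq_phase_le ha.1 hα hp hq hD hθ
  -- Growth of the boundary parameter.
  set B := M / Real.pi * (h₂ + |h₁| + D) + 1 with hB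
  have hB0 : 0 < B := by positivity
  have hgrow : ∀ n : ℤ, |(n : ℝ)| + 1 ≤ B * (1 + |u n|) := fun n => by
    have h1 : (n : ℝ) = M / Real.pi * lamZero a α n := by
      have := hl0 n
      field_simp
      linarith
    have h2 : lam n = u n * h₂ - h₁ := by simp only [hu]; field_simp; ring
    have h3 : |lamZero a α n| ≤ |u n| * h₂ + |h₁| + D := by
      have h4 : lamZero a α n = u n * h₂ - h₁ - (lam n - lamZero a α n) := by rw [← h2]; ring
      rw [h4]
      refine (abs_sub _ _).trans (add_le_add ((abs_sub _ _).trans (le_of_eq ?_)) (hD n))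
      rw [abs_mul, abs_of_pos hh]
    have h5 : |(n : ℝ)| ≤ M / Real.pi * (|u n| * h₂ + |h₁| + D) := by
      rw [h1, abs_mul, abs_of_pos (by positivity : 0 < M / Real.pi)]
      exact mul_le_mul_of_nonneg_left h3 (by positivity)
    have h6 : |u n| * h₂ + |h₁| + D ≤ (h₂ + |h₁| + D) * (1 + |u n|) := by
      have := abs_nonneg (u n)
      have := abs_nonneg h₁
      nlinarith [mul_nonneg (abs_nonneg (u n)) (abs_nonneg h₁), mul_nonneg (abs_nonneg (u n)) hD0]
    have h7 := mul_le_mul_of_nonneg_left h6 (by positivity : 0 ≤ M / Real.pi)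
    have := abs_nonneg (u n)
    rw [hB]
    linarith
  set g : ℤ → ℝ := fun n => 1 / (|(n : ℝ)| + 1) ^ 2 with hg
  have hgs : Summable g := summable_one_div_natAbs_add_one_sq
  have hg1 : ∀ n, 1 / (1 + |u n|) ^ 2 ≤ B ^ 2 * g n := fun n => by
    simp only [hg]
    rw [← mul_div_assoc, mul_one, div_le_div_iff₀ (by positivity) (by positivity), one_mul,
      ← mul_pow]
    exact pow_le_pow_left₀ (by positivity) (hgrow n) 2
  set U := (D + |h₁|) / h₂ with hU
  have hU0 : 0 ≤ U := by positivity
  have hεu : ∀ n, |ε n| ≤ 2 * Real.pi * (1 + U) / (1 + |u n|) := fun n => by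
    have h1 := abs_le.1 (hD n)
    have h2 := abs_le.1 (le_refl |h₁|)
    simp only [hε]
    split_ifs with hn
    · refine abs_pi_div_two_sub_arctan_le hU0 ?_
      have h3 : 0 ≤ lamZero a α n := by
        have h4 : (0 : ℝ) ≤ n := by exact_mod_cast hn
        exact div_nonneg (mul_nonneg h4 hπ.le) hM.le
      simp only [hu, hU]
      rw [← neg_div]
      exact div_le_div_of_nonneg_right (by linarith) hh.le
    · have h3 : lamZero a α n ≤ 0 := by
        have h4 : (n : ℝ) ≤ 0 := by exact_mod_cast (not_le.1 hn).le
        exact div_nonpos_of_nonpos_of_nonneg (mul_nonpos_of_nonpos_of_nonneg h4 hπ.le) hM.le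
      have h5 := abs_pi_div_two_sub_arctan_le (u := -u n) hU0 (by
        simp only [hu, hU]
        exact neg_le_neg (div_le_div_of_nonneg_right (by linarith) hh.le))
      rw [Real.arctan_neg, abs_neg] at h5
      rw [← abs_neg]
      convert h5 using 2
      ring
  have hεs : ∀ n, ε n ^ 2 ≤ (2 * Real.pi * (1 + U)) ^ 2 * (B ^ 2 * g n) := fun n => by
    rw [← sq_abs]
    refine (pow_le_pow_left₀ (abs_nonneg _) (hεu n) 2).trans ?_
    rw [div_pow, div_eq_mul_one_div]
    exact mul_le_mul_of_nonneg_left (hg1 n) (by positivity)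
  have hws : ∀ x ∈ Set.Icc 0 Real.pi, Summable fun n => ‖w n x‖ ^ 2 := fun x hx =>
    summable_of_sum_le (fun n => by positivity) (hC x hx)
  have hlams : Summable fun n => (lam n - lamZero a α n) ^ 2 := by
    have h1 : Summable fun n => (2 * ((2 * Real.pi * (1 + U)) ^ 2 * (B ^ 2 * g n)) +
        2 * ‖w n Real.pi‖ ^ 2) / M ^ 2 :=
      ((((hgs.mul_left _).mul_left _).mul_left _).add ((hws _ hπm).mul_left _)).div_const _
    refine Summable.of_nonneg_of_le (fun n => sq_nonneg _) (fun n => ?_) h1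
    rw [le_div_iff₀ (by positivity), ← mul_pow, hdev]
    have h2 : (w n Real.pi).re ^ 2 ≤ ‖w n Real.pi‖ ^ 2 := by
      rw [← sq_abs]
      exact pow_le_pow_left₀ (abs_nonneg _) (hwre n) 2
    nlinarith [sq_nonneg (ε n + (w n Real.pi).re), hεs n]
  -- The normalizing numbers.
  set nrm : ℤ → ℝ := fun n => normalizingNumber a α p q h₂ (lam n) with hnrm
  have hwc : ∀ n, ContinuousOn (w n) (Set.uIcc 0 Real.pi) := fun n => by
    rw [Set.uIcc_of_le hπ.le]
    exact (hθ n).continuousOn_phase hp' hq'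
  have hsin : ∀ n, Real.sin (θ n Real.pi) ^ 2 ≤ 2 * (B ^ 2 * g n) := fun n => by
    have h1 : (lam n + h₁) * Real.sin (θ n Real.pi) = h₂ * Real.cos (θ n Real.pi) := by
      rw [boundary_condition_iff hh]
      refine ⟨skipNegOne n, ?_⟩
      have h2 : θ n Real.pi = (skipNegOne n : ℤ) * Real.pi + Real.pi / 2 - Real.arctan (u n) :=
        (hκθ (skipNegOne n)).2
      rw [h2]
      simp only [hu]
      ring
    have h2 : u n * Real.sin (θ n Real.pi) = Real.cos (θ n Real.pi) := by
      simp only [hu]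
      field_simp
      linarith
    have h3 := Real.sin_sq_add_cos_sq (θ n Real.pi)
    rw [← h2] at h3
    have h4 : Real.sin (θ n Real.pi) ^ 2 * (1 + |u n|) ^ 2 ≤ 2 := by
      have h5 : (1 + |u n|) ^ 2 ≤ 2 * (1 + u n ^ 2) := by
        nlinarith [sq_nonneg (1 - |u n|), sq_abs (u n)]
      nlinarith [mul_le_mul_of_nonneg_left h5 (sq_nonneg (Real.sin (θ n Real.pi)))]
    refine le_trans ?_ (mul_le_mul_of_nonneg_left (hg1 n) two_pos.le)
    rw [← mul_div_assoc, mul_one, le_div_iff₀ (by positivity)]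
    exact h4
  have hwn2 : ∀ n, IntervalIntegrable (fun x => ‖w n x‖ ^ 2 * rho a α x) volume 0 Real.pi :=
    fun n => (intervalIntegrable_rho hα _ _).continuousOn_mul ((hwc n).norm.pow 2)
  have hJs : Summable fun n => ∫ x in (0 : ℝ)..Real.pi, ‖w n x‖ ^ 2 * rho a α x := by
    refine summable_of_sum_le (c := C * M) (fun n => intervalIntegral.integral_nonneg hπ.le
      fun x _ => mul_nonneg (by positivity) (rho_pos hα x).le) fun s => ?_
    rw [← intervalIntegral.integral_finsetSum fun n _ => hwn2 n, hMdef,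
      ← integral_rho ha.1 hα, ← intervalIntegral.integral_const_mul]
    have h := IntervalIntegrable.sum s fun n _ => hwn2 n
    rw [Finset.sum_fn] at h
    refine intervalIntegral.integral_mono_on hπ.le h
      ((intervalIntegrable_rho hα _ _).const_mul C) fun x hx => ?_
    rw [← Finset.sum_mul]
    exact mul_le_mul_of_nonneg_right (hC x hx s) (rho_pos hα x).le
  have hnrms : Summable fun n => (nrm n - M) ^ 2 := by
    set K := 2 * Real.exp (2 * A) with hK
    set K' := 1 / h₂ * (Real.exp (2 * A) * (2 * B ^ 2)) with hK'
    have h1 : Summable fun n => 2 * (K ^ 2 * (M * ∫ x in (0 : ℝ)..Real.pi,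
        ‖w n x‖ ^ 2 * rho a α x)) + 2 * (K' ^ 2 * g n) :=
      (((hJs.mul_left _).mul_left _).mul_left _).add ((hgs.mul_left _).mul_left _)
    refine Summable.of_nonneg_of_le (fun n => sq_nonneg _) (fun n => ?_) h1
    have hCS := sq_integral_mul_le hπ.le (f := fun x => ‖w n x‖) (k := rho a α) (by
      rw [← Set.uIcc_of_le hπ.le]; exact (hwc n).norm) (intervalIntegrable_rho hα _ _)
      (fun x => (rho_pos hα x).le)
    rw [integral_rho ha.1 hα] at hCS
    have h3 := (hθ n).abs_normalizingNumber_sub_le hp' hq' ha.1 hα hh (hwA n)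
    have hgn : 0 ≤ g n := by positivity
    have hgn1 : g n ≤ 1 := by
      simp only [hg]
      rw [div_le_one (by positivity)]
      nlinarith [abs_nonneg (n : ℝ)]
    have h4 : 1 / h₂ * (Real.exp (2 * A) * Real.sin (θ n Real.pi) ^ 2) ≤ K' * g n := by
      rw [hK', mul_assoc, mul_assoc, mul_assoc]
      exact mul_le_mul_of_nonneg_left (mul_le_mul_of_nonneg_left (hsin n) (Real.exp_pos _).le)
        (by positivity)
    have h6 : (K' * g n) ^ 2 ≤ K' ^ 2 * g n := by
      rw [mul_pow, sq (g n)]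
      exact mul_le_mul_of_nonneg_left (mul_le_of_le_one_left hgn hgn1) (sq_nonneg _)
    have h7 := mul_le_mul_of_nonneg_left hCS (sq_nonneg K)
    rw [← mul_pow] at h7
    rw [← sq_abs]
    refine (pow_le_pow_left₀ (abs_nonneg _) (h3.trans (add_le_add le_rfl h4)) 2).trans ?_
    refine (add_sq_le).trans ?_
    rw [mul_add]
    exact add_le_add (mul_le_mul_of_nonneg_left h7 two_pos.le)
      (mul_le_mul_of_nonneg_left h6 two_pos.le)
  have hto : Tendsto (fun n => lam n - lamZero a α n) cofinite (𝓝 0) := by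
    have h1 := hlams.tendsto_cofinite_zero.sqrt
    rw [Real.sqrt_zero] at h1
    simp only [Real.sqrt_sq_eq_abs] at h1
    exact (tendsto_zero_iff_abs_tendsto_zero _).2 h1
  refine ⟨lam, nrm, κ (-1), 1 / normalizingNumber a α p q h₂ (κ (-1)),
    hκi.comp skipNegOne_injective,
    fun n => (hθ n).normalizingNumber_pos hp' hq' ha.1 hα hh, hlams, hnrms,
    one_div_nonneg.2 ((hκθ (-1)).1.normalizingNumber_pos hp' hq' ha.1 hα hh).le, ?_⟩
  exact eventually_spectralPartialSum_eq ha.1 hα hκi hκe hto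

end Asymptotics

/-! ### Completeness of exponentials with frequencies close to the lattice -/

section Exponentials

variable {b : ℝ} {g : ℝ → ℂ}

/-- The Fourier transform of the restriction of `g` to `[-b, b]`. -/
noncomputable def windowTransform (b : ℝ) (g : ℝ → ℂ) (l : ℝ) : ℂ :=
  ∫ y in (-b)..b, g y * cis (l * y)

theorem intervalIntegrable_of_memLp_window (hb : 0 < b)
    (hg : MemLp g 2 (volume.restrict (Set.Ioc (-b) b))) :
    IntervalIntegrable g volume (-b) b := by
  rw [intervalIntegrable_iff_integrableOn_Ioc_of_le (by linarith)]
  exact hg.integrable one_le_two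

/-- Parseval's identity on `(-b, b)`. -/
theorem hasSum_norm_sq_windowTransform (hb : 0 < b)
    (hg : MemLp g 2 (volume.restrict (Set.Ioc (-b) b))) :
    HasSum (fun n : ℤ => ‖windowTransform b g (n * Real.pi / b)‖ ^ 2)
      (2 * b * ∫ y in (-b)..b, ‖g y‖ ^ 2) := by
  have hlt : -b < b := by linarith
  have h := ((Equiv.neg ℤ).hasSum_iff.2 (hasSum_sq_fourierCoeffOn hlt hg)).mul_left ((2 * b) ^ 2)
  have e1 : (2 * b) ^ 2 * ((b - -b)⁻¹ • ∫ y in (-b)..b, ‖g y‖ ^ 2) =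
      2 * b * ∫ y in (-b)..b, ‖g y‖ ^ 2 := by
    rw [smul_eq_mul]
    field_simp
    ring
  rw [e1] at h
  refine h.congr_fun fun n => ?_
  simp only [Function.comp_apply, Equiv.neg_apply]
  rw [fourierCoeffOn_eq_integral, norm_smul, mul_pow ‖1 / (b - -b)‖, neg_neg]
  have e2 : (2 * b) ^ 2 * ‖1 / (b - -b)‖ ^ 2 = 1 := by
    rw [Real.norm_eq_abs, sq_abs]
    field_simp
    ring
  rw [← mul_assoc, e2, one_mul, windowTransform]
  congr 3
  funext y
  rw [smul_eq_mul, mul_comm, fourier_coe_apply, cis]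
  congr 2
  have : (b : ℂ) ≠ 0 := by exact_mod_cast hb.ne'
  push_cast
  field_simp
  ring

theorem integral_norm_sq_eq_zero_of_windowTransform (hb : 0 < b)
    (hg : MemLp g 2 (volume.restrict (Set.Ioc (-b) b)))
    (h : ∀ n : ℤ, windowTransform b g (n * Real.pi / b) = 0) :
    ∫ y in (-b)..b, ‖g y‖ ^ 2 = 0 := by
  have h1 := hasSum_norm_sq_windowTransform hb hg
  simp only [h, norm_zero, ne_eq, OfNat.ofNat_ne_zero, not_false_eq_true, zero_pow] at h1
  have h2 := h1.unique hasSum_zero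
  exact (mul_eq_zero.1 h2).resolve_left (by positivity)

theorem windowTransform_eq_zero (hb : 0 < b)
    (hg : MemLp g 2 (volume.restrict (Set.Ioc (-b) b)))
    (h : ∫ y in (-b)..b, ‖g y‖ ^ 2 = 0) (l : ℝ) : windowTransform b g l = 0 := by
  have hle : -b ≤ b := by linarith
  rw [intervalIntegral.integral_of_le hle,
    integral_eq_zero_iff_of_nonneg (fun y => by positivity) (integrable_norm_sq hg)] at h
  rw [windowTransform, intervalIntegral.integral_of_le hle]
  refine integral_eq_zero_of_ae ?_
  filter_upwards [h] with y hy
  have : g y = 0 := by simpa using hy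
  simp [this]

theorem sq_integral_norm_le (hb : 0 < b)
    (hg : MemLp g 2 (volume.restrict (Set.Ioc (-b) b))) :
    (∫ y in (-b)..b, ‖g y‖) ^ 2 ≤ 2 * b * ∫ y in (-b)..b, ‖g y‖ ^ 2 := by
  have hle : -b ≤ b := by linarith
  have h1 := (intervalIntegrable_of_memLp_window hb hg).norm
  have h2 : IntervalIntegrable (fun y => ‖g y‖ ^ 2) volume (-b) b := by
    rw [intervalIntegrable_iff_integrableOn_Ioc_of_le hle]
    exact integrable_norm_sq hg
  set m := (∫ y in (-b)..b, ‖g y‖) / (2 * b) with hm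
  have h3 : 0 ≤ ∫ y in (-b)..b, (‖g y‖ - m) ^ 2 :=
    intervalIntegral.integral_nonneg hle fun y _ => sq_nonneg _
  have h4 : ∫ y in (-b)..b, (‖g y‖ - m) ^ 2 =
      (∫ y in (-b)..b, ‖g y‖ ^ 2) - 2 * m * (∫ y in (-b)..b, ‖g y‖) + 2 * b * m ^ 2 := by
    rw [← intervalIntegral.integral_const_mul, ← intervalIntegral.integral_sub h2 (h1.const_mul _),
      show 2 * b * m ^ 2 = ∫ y in (-b)..b, m ^ 2 by
        rw [intervalIntegral.integral_const, smul_eq_mul]; ring,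
      ← intervalIntegral.integral_add (h2.sub (h1.const_mul _)) intervalIntegrable_const]
    refine intervalIntegral.integral_congr fun y _ => ?_
    ring
  have h5 : ∫ y in (-b)..b, ‖g y‖ = 2 * b * m := by
    rw [hm]
    field_simp
  rw [h4, h5] at h3
  rw [h5]
  nlinarith

/-- The transform is Lipschitz continuous with constant `b √(2b) ‖g‖`. -/
theorem norm_windowTransform_sub_sq_le (hb : 0 < b)
    (hg : MemLp g 2 (volume.restrict (Set.Ioc (-b) b))) (l m : ℝ) :
    ‖windowTransform b g l - windowTransform b g m‖ ^ 2 ≤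
      b ^ 2 * (l - m) ^ 2 * (2 * b * ∫ y in (-b)..b, ‖g y‖ ^ 2) := by
  have hle : -b ≤ b := by linarith
  have h1 := intervalIntegrable_of_memLp_window hb hg
  have h2 : ‖windowTransform b g l - windowTransform b g m‖ ≤
      b * |l - m| * ∫ y in (-b)..b, ‖g y‖ := by
    rw [windowTransform, windowTransform, ← intervalIntegral.integral_sub
      (h1.mul_continuousOn (by fun_prop)) (h1.mul_continuousOn (by fun_prop)),
      ← intervalIntegral.integral_const_mul]
    refine intervalIntegral.norm_integral_le_of_norm_le hle (ae_of_all _ fun y hy => ?_)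
      (h1.norm.const_mul _)
    rw [← mul_sub, norm_mul, mul_comm]
    refine mul_le_mul_of_nonneg_right ((norm_cis_sub_cis_le _ _).trans ?_) (norm_nonneg _)
    rw [← sub_mul, abs_mul, mul_comm]
    exact mul_le_mul_of_nonneg_right (abs_le.2 ⟨hy.1.le, hy.2⟩) (abs_nonneg _)
  calc _ ≤ (b * |l - m| * ∫ y in (-b)..b, ‖g y‖) ^ 2 := pow_le_pow_left₀ (norm_nonneg _) h2 2
    _ = b ^ 2 * (l - m) ^ 2 * (∫ y in (-b)..b, ‖g y‖) ^ 2 := by rw [mul_pow, mul_pow, sq_abs]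
    _ ≤ _ := mul_le_mul_of_nonneg_left (sq_integral_norm_le hb hg) (by positivity)

/-- A zero `m` of the transform can be moved to any other real point `ν` within the class of
transforms of square integrable functions: multiplication of the transform by
`(l - ν) / (l - m) = 1 + (m - ν) / (l - m)` amounts to adding a multiple of a primitive. -/
theorem exists_windowTransform_swap (hb : 0 < b)
    (hg : MemLp g 2 (volume.restrict (Set.Ioc (-b) b))) {m : ℝ} (ν : ℝ)
    (hm : windowTransform b g m = 0) :
    ∃ h : ℝ → ℂ, MemLp h 2 (volume.restrict (Set.Ioc (-b) b)) ∧ ∀ l : ℝ,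
      ((l - m : ℝ) : ℂ) * windowTransform b h l = ((l - ν : ℝ) : ℂ) * windowTransform b g l := by
  have hle : -b ≤ b := by linarith
  have hgi := intervalIntegrable_of_memLp_window hb hg
  have hgm : IntervalIntegrable (fun y => g y * cis (m * y)) volume (-b) b :=
    hgi.mul_continuousOn (by fun_prop)
  set G : ℝ → ℂ := fun y => ∫ u in (-b)..y, g u * cis (m * u) with hG
  have hGac : AbsolutelyContinuousOnInterval G (-b) b :=
    absolutelyContinuous_integral hgm Set.left_mem_uIcc
  have hGc : ContinuousOn G (Set.Icc (-b) b) := by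
    simpa only [Set.uIcc_of_le hle] using hGac.continuousOn
  have hGb : G b = 0 := hm
  have hGa : G (-b) = 0 := intervalIntegral.integral_same
  set k : ℝ → ℂ := fun y => cis (-(m * y)) * G y with hk
  have hkc : ContinuousOn k (Set.Icc (-b) b) :=
    (by fun_prop : Continuous fun y => cis (-(m * y))).continuousOn.mul hGc
  have hkL : MemLp k 2 (volume.restrict (Set.Ioc (-b) b)) := by
    obtain ⟨C, hC⟩ := isCompact_Icc.exists_bound_of_continuousOn hkc
    refine MemLp.of_bound (C := C)
      ((hkc.mono Set.Ioc_subset_Icc_self).aestronglyMeasurable measurableSet_Ioc) ?_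
    filter_upwards [ae_restrict_mem measurableSet_Ioc] with y hy
    exact hC y ⟨hy.1.le, hy.2⟩
  have hki : IntervalIntegrable k volume (-b) b := intervalIntegrable_of_memLp_window hb hkL
  -- Integration by parts; both boundary terms vanish since `m` is a zero.
  have hparts : ∀ l : ℝ, ((l - m : ℝ) : ℂ) * windowTransform b k l =
      Complex.I * windowTransform b g l := by
    intro l
    have hcac : AbsolutelyContinuousOnInterval (fun y : ℝ => cis ((l - m) * y)) (-b) b :=
      (contDiff_cis.comp (contDiff_const.mul contDiff_id)).contDiffOn.absolutelyContinuousOnInterval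
    have h1 := eq_add_integral_of_absolutelyContinuous hle (hcac.smul hGac)
      (f' := fun y => Complex.I * ((l - m : ℝ) : ℂ) * (k y * cis (l * y)) + g y * cis (l * y))
      (((hki.mul_continuousOn (by fun_prop)).const_mul _).add
        (hgi.mul_continuousOn (by fun_prop))) ?_ (Set.right_mem_Icc.2 hle)
    · simp only [Pi.smul_apply', hGa, hGb, smul_zero, zero_add] at h1
      rw [intervalIntegral.integral_add ((hki.mul_continuousOn (by fun_prop)).const_mul _)
        (hgi.mul_continuousOn (by fun_prop)), intervalIntegral.integral_const_mul] at h1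
      simp only [windowTransform]
      linear_combination Complex.I * h1 +
        ((l - m : ℝ) : ℂ) * (∫ y in (-b)..b, k y * cis (l * y)) * Complex.I_sq
    · filter_upwards [ae_hasDerivAt_primitive hle hgm] with y hy
      have h2 := ((hasDerivAt_cis ((l - m) * y)).scomp y
        ((hasDerivAt_id y).const_mul (l - m))).mul hy
      refine (h2.congr_deriv ?_)
      have e1 : cis (l * y) = cis ((l - m) * y) * cis (m * y) := by
        rw [← cis_add]; congr 1; ring
      simp only [Function.comp_apply, mul_one, Complex.real_smul, hk]
      rw [e1, show cis (-(m * y)) * G y * (cis ((l - m) * y) * cis (m * y)) =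
        (cis (-(m * y)) * cis (m * y)) * (cis ((l - m) * y) * G y) by ring, ← cis_add,
        neg_add_cancel, cis_zero]
      simp only [hG]
      ring
  refine ⟨fun y => g y + (-(Complex.I * ((m - ν : ℝ) : ℂ))) * k y,
    hg.add (hkL.const_mul _), fun l => ?_⟩
  have h3 : windowTransform b (fun y => g y + (-(Complex.I * ((m - ν : ℝ) : ℂ))) * k y) l =
      windowTransform b g l + (-(Complex.I * ((m - ν : ℝ) : ℂ))) * windowTransform b k l := by
    simp only [windowTransform]
    rw [← intervalIntegral.integral_const_mul, ← intervalIntegral.integral_add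
      (hgi.mul_continuousOn (by fun_prop)) ((hki.mul_continuousOn (by fun_prop)).const_mul _)]
    refine intervalIntegral.integral_congr fun y _ => ?_
    ring
  rw [h3]
  have h4 := hparts l
  push_cast at h4 ⊢
  linear_combination (-(Complex.I * ((m : ℂ) - ν))) * h4 -
    ((m : ℂ) - ν) * windowTransform b g l * Complex.I_sq

/-- Finitely many zeros of the transform can be moved to points off a countable set without
affecting whether the function vanishes. -/
theorem exists_windowTransform_swap_finset (hb : 0 < b)
    (hg : MemLp g 2 (volume.restrict (Set.Ioc (-b) b))) {lam ν : ℤ → ℝ}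
    (hlam : Function.Injective lam) (hν : ∀ n k, ν n ≠ lam k)
    (hν0 : ∀ n (k : ℤ), ν n ≠ k * Real.pi / b)
    (hz : ∀ n, windowTransform b g (lam n) = 0) (s : Finset ℤ) :
    ∃ h : ℝ → ℂ, MemLp h 2 (volume.restrict (Set.Ioc (-b) b)) ∧
      (∀ n ∈ s, windowTransform b h (ν n) = 0) ∧ (∀ n ∉ s, windowTransform b h (lam n) = 0) ∧
      (∫ y in (-b)..b, ‖h y‖ ^ 2 = 0 → ∫ y in (-b)..b, ‖g y‖ ^ 2 = 0) := by
  induction s using Finset.induction_on with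
  | empty => exact ⟨g, hg, by simp, fun n _ => hz n, id⟩
  | insert m s hm ih =>
    obtain ⟨f, hf, hf1, hf2, hf3⟩ := ih
    obtain ⟨h, hh, hsw⟩ := exists_windowTransform_swap hb hf (ν m) (hf2 m hm)
    have key : ∀ x, x ≠ lam m → windowTransform b f x = 0 → windowTransform b h x = 0 := by
      intro x hx h0
      have h1 := hsw x
      rw [h0, mul_zero] at h1
      exact (mul_eq_zero.1 h1).resolve_left (by exact_mod_cast sub_ne_zero.2 hx)
    refine ⟨h, hh, fun n hn => ?_, fun n hn => ?_, fun h0 => hf3 ?_⟩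
    · by_cases hnm : n = m
      · subst hnm
        have h1 := hsw (ν n)
        rw [sub_self, Complex.ofReal_zero, zero_mul] at h1
        exact (mul_eq_zero.1 h1).resolve_left
          (by exact_mod_cast sub_ne_zero.2 (hν n n))
      · exact key _ (hν n m) (hf1 n ((Finset.mem_insert.1 hn).resolve_left hnm))
    · rw [Finset.mem_insert, not_or] at hn
      exact key _ (hlam.ne hn.1) (hf2 n hn.2)
    · refine integral_norm_sq_eq_zero_of_windowTransform hb hf fun k => ?_
      have h1 := hsw (k * Real.pi / b)
      rw [windowTransform_eq_zero hb hh h0, mul_zero] at h1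
      exact (mul_eq_zero.1 h1.symm).resolve_left
        (by exact_mod_cast sub_ne_zero.2 (hν0 m k).symm)

/-- Exponentials whose distinct frequencies are square summably close to the lattice
`(π / b) ℤ` are complete in `L₂(-b, b)`. After finitely many frequencies are moved, the system is
a perturbation of the orthogonal one of relative size less than `1`. -/
theorem integral_norm_sq_eq_zero_of_forall_windowTransform (hb : 0 < b)
    (hg : MemLp g 2 (volume.restrict (Set.Ioc (-b) b))) {lam : ℤ → ℝ}
    (hlam : Function.Injective lam) (hs : Summable fun n : ℤ => (lam n - n * Real.pi / b) ^ 2)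
    (hz : ∀ n, windowTransform b g (lam n) = 0) :
    ∫ y in (-b)..b, ‖g y‖ ^ 2 = 0 := by
  -- Outside `s` the squared deviations sum to at most `1 / (4 b²)`. The frequencies in `s` are
  -- moved to within the same total of the lattice, off the lattice and off all `lam k`.
  have hε : 0 < 1 / (4 * b ^ 2) := by positivity
  obtain ⟨s, hs'⟩ := summable_iff_vanishing_norm.1 hs _ hε
  set η := 1 / (4 * b ^ 2) / (s.card + 1) with hη
  have hη0 : 0 < η := by positivity
  have hcount : (Set.range lam ∪ Set.range fun k : ℤ => (k : ℝ) * Real.pi / b).Countable :=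
    (Set.countable_range _).union (Set.countable_range _)
  have hν : ∀ n : ℤ, ∃ x : ℝ, (x - n * Real.pi / b) ^ 2 ≤ η ∧
      x ∉ Set.range lam ∪ Set.range fun k : ℤ => (k : ℝ) * Real.pi / b := fun n => by
    obtain ⟨x, hx, hx'⟩ := (hcount.dense_compl ℝ).exists_dist_lt (n * Real.pi / b : ℝ)
      (Real.sqrt_pos.2 hη0)
    refine ⟨x, ?_, hx⟩
    rw [dist_comm, Real.dist_eq] at hx'
    rw [← sq_abs]
    exact ((Real.lt_sqrt (abs_nonneg _)).1 hx').le
  choose ν hν1 hν2 using hν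
  obtain ⟨h, hh, h1, h2, h3⟩ := exists_windowTransform_swap_finset hb hg hlam (ν := ν)
    (fun n k hk => hν2 n (Or.inl ⟨k, hk.symm⟩)) (fun n k hk => hν2 n (Or.inr ⟨k, hk.symm⟩)) hz s
  refine h3 ?_
  set κ : ℤ → ℝ := fun n => if n ∈ s then ν n else lam n with hκ
  have hκz : ∀ n, windowTransform b h (κ n) = 0 := fun n => by
    simp only [hκ]
    split_ifs with hn
    · exact h1 n hn
    · exact h2 n hn
  set I := ∫ y in (-b)..b, ‖h y‖ ^ 2 with hI
  have hI0 : 0 ≤ I := intervalIntegral.integral_nonneg (by linarith) fun _ _ => by positivity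
  have hκs : ∀ t : Finset ℤ, ∑ n ∈ t, (κ n - n * Real.pi / b) ^ 2 ≤ 1 / (2 * b ^ 2) := by
    intro t
    have e1 : ∑ n ∈ t ∩ s, (κ n - n * Real.pi / b) ^ 2 ≤ 1 / (4 * b ^ 2) := by
      have : ∑ n ∈ t ∩ s, (κ n - n * Real.pi / b) ^ 2 ≤ ∑ n ∈ s, η := by
        refine (Finset.sum_le_sum fun n hn => ?_).trans
          (Finset.sum_le_sum_of_subset_of_nonneg Finset.inter_subset_right fun _ _ _ => hη0.le)
        simp only [hκ, if_pos (Finset.mem_inter.1 hn).2]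
        exact hν1 n
      refine this.trans ?_
      rw [Finset.sum_const, nsmul_eq_mul, hη, mul_div_assoc', div_le_iff₀ (by positivity)]
      nlinarith
    have e2 : ∑ n ∈ t \ s, (κ n - n * Real.pi / b) ^ 2 ≤ 1 / (4 * b ^ 2) := by
      have h5 := hs' (t \ s) Finset.sdiff_disjoint
      rw [Real.norm_of_nonneg (Finset.sum_nonneg fun _ _ => sq_nonneg _)] at h5
      refine le_trans (le_of_eq (Finset.sum_congr rfl fun n hn => ?_)) h5.le
      simp only [hκ, if_neg (Finset.mem_sdiff.1 hn).2]
    rw [← Finset.sum_inter_add_sum_sdiff t s]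
    refine (add_le_add e1 e2).trans (le_of_eq ?_)
    field_simp
    norm_num
  -- Parseval's identity against the Lipschitz bound, as the transform vanishes at every `κ n`:
  -- total squared deviation `1 / (2 b²)` leaves half of the norm.
  have hP := hasSum_norm_sq_windowTransform hb hh
  have hle : 2 * b * I ≤ b * I := by
    refine hasSum_le_of_sum_le hP fun t => ?_
    calc ∑ n ∈ t, ‖windowTransform b h (n * Real.pi / b)‖ ^ 2
        ≤ ∑ n ∈ t, (κ n - n * Real.pi / b) ^ 2 * (b ^ 2 * (2 * b * I)) := by
          refine Finset.sum_le_sum fun n _ => ?_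
          have h5 := norm_windowTransform_sub_sq_le hb hh (κ n) (n * Real.pi / b)
          rw [hκz, zero_sub, norm_neg] at h5
          exact h5.trans (le_of_eq (by ring))
      _ ≤ 1 / (2 * b ^ 2) * (b ^ 2 * (2 * b * I)) := by
          rw [← Finset.sum_mul]
          exact mul_le_mul_of_nonneg_right (hκs t) (by positivity)
      _ = b * I := by field_simp
  nlinarith

end Exponentials

/-! ### Square summable perturbations of Parseval frames -/

section Frames

open InnerProductSpace

variable {H : Type*} [NormedAddCommGroup H] [InnerProductSpace ℂ H] {e f r : ℤ → H}

/-- A Bessel sequence has a bounded synthesis map. -/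
theorem norm_sum_smul_sq_le {ι : Type*} {e : ι → H} {C : ℝ} (hC : 0 ≤ C)
    (he : ∀ (a : H) (t : Finset ι), ∑ n ∈ t, ‖inner ℂ (e n) a‖ ^ 2 ≤ C * ‖a‖ ^ 2)
    (c : ι → ℂ) (t : Finset ι) :
    ‖∑ n ∈ t, c n • e n‖ ^ 2 ≤ C * ∑ n ∈ t, ‖c n‖ ^ 2 := by
  set v := ∑ n ∈ t, c n • e n with hv
  have h1 : ‖v‖ ^ 2 ≤ ∑ n ∈ t, ‖c n‖ * ‖inner ℂ (e n) v‖ := by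
    have h2 : ((‖v‖ ^ 2 : ℝ) : ℂ) = ∑ n ∈ t, c n * inner ℂ v (e n) := by
      have := inner_self_eq_norm_sq_to_K (𝕜 := ℂ) v
      push_cast
      refine (this.symm.trans ?_)
      conv_lhs => rw [hv, inner_sum, ← hv]
      exact Finset.sum_congr rfl fun n _ => inner_smul_right _ _ _
    have h3 := congrArg norm h2
    rw [Complex.norm_real, Real.norm_of_nonneg (by positivity)] at h3
    rw [h3]
    refine norm_sum_le_of_le _ fun n _ => ?_
    rw [norm_mul, norm_inner_symm]
  have h4 : (∑ n ∈ t, ‖c n‖ * ‖inner ℂ (e n) v‖) ^ 2 ≤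
      (∑ n ∈ t, ‖c n‖ ^ 2) * (C * ‖v‖ ^ 2) :=
    (Finset.sum_mul_sq_le_sq_mul_sq _ _ _).trans
      (mul_le_mul_of_nonneg_left (he v t) (Finset.sum_nonneg fun _ _ => by positivity))
  have h5 : ‖v‖ ^ 2 * ‖v‖ ^ 2 ≤ (C * ∑ n ∈ t, ‖c n‖ ^ 2) * ‖v‖ ^ 2 := by
    rw [← sq]
    exact ((pow_le_pow_left₀ (by positivity) h1 2).trans h4).trans (le_of_eq (by ring))
  by_cases hv0 : ‖v‖ = 0
  · rw [hv0, zero_pow two_ne_zero]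
    exact mul_nonneg hC (Finset.sum_nonneg fun _ _ => by positivity)
  · exact le_of_mul_le_mul_right h5 (by positivity)

variable [CompleteSpace H]

/-- The series `∑ |eₙ⟩⟨rₙ|` converges in operator norm when `e` is a Bessel sequence and `r` is
square summable. -/
theorem summable_rankOne (he : ∀ (a : H) (t : Finset ℤ), ∑ n ∈ t, ‖inner ℂ (e n) a‖ ^ 2 ≤ ‖a‖ ^ 2)
    (hr : Summable fun n => ‖r n‖ ^ 2) : Summable fun n => rankOne ℂ (e n) (r n) := by
  rw [summable_iff_vanishing_norm]
  intro ε hε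
  obtain ⟨s, hs⟩ := summable_iff_vanishing_norm.1 hr ((ε / 2) ^ 2) (by positivity)
  refine ⟨s, fun t ht => lt_of_le_of_lt ?_ (half_lt_self hε)⟩
  refine ContinuousLinearMap.opNorm_le_bound _ (by positivity) fun a => ?_
  have h1 := norm_sum_smul_sq_le zero_le_one (by simpa using he) (fun n => inner ℂ (r n) a) t
  have h2 := hs t ht
  rw [Real.norm_of_nonneg (Finset.sum_nonneg fun _ _ => by positivity)] at h2
  rw [one_mul] at h1
  have h3 : ∑ n ∈ t, ‖inner ℂ (r n) a‖ ^ 2 ≤ (ε / 2 * ‖a‖) ^ 2 := by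
    rw [mul_pow]
    refine le_trans ?_ (mul_le_mul_of_nonneg_right h2.le (sq_nonneg ‖a‖))
    rw [Finset.sum_mul]
    refine Finset.sum_le_sum fun n _ => ?_
    rw [← mul_pow]
    exact pow_le_pow_left₀ (norm_nonneg _) (norm_inner_le_norm _ _) 2
  rw [sum_apply]
  exact le_of_sq_le_sq (h1.trans h3) (by positivity)

omit [CompleteSpace H] in
theorem isCompactOperator_rankOne (x y : H) : IsCompactOperator (rankOne ℂ x y) := by
  rw [rankOne_def']
  exact (isCompactOperator_of_locallyCompactSpace_dom
    (innerSL ℂ y : H →L[ℂ] ℂ)).clm_comp (ContinuousLinearMap.toSpanSingleton ℂ x)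

/-- The difference of the frame operators of two square summably close systems is compact. -/
theorem exists_frame_difference
    (he : ∀ (a : H) (t : Finset ℤ), ∑ n ∈ t, ‖inner ℂ (e n) a‖ ^ 2 ≤ ‖a‖ ^ 2)
    (hfe : Summable fun n => ‖f n - e n‖ ^ 2) :
    ∃ K : H →L[ℂ] H, IsCompactOperator K ∧
      ∀ a, HasSum (fun n => inner ℂ (f n) a • f n - inner ℂ (e n) a • e n) (K a) := by
  have h1 := summable_rankOne he hfe
  have h2 : Summable fun n => rankOne ℂ (f n - e n) (e n) := by
    refine (h1.map (ContinuousLinearMap.adjoint (𝕜 := ℂ) (E := H) (F := H))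
      (ContinuousLinearMap.adjoint (𝕜 := ℂ) (E := H) (F := H)).continuous).congr fun n => ?_
    exact adjoint_rankOne _ _
  have h3 : Summable fun n => rankOne ℂ (f n - e n) (f n - e n) := by
    refine Summable.of_norm (hfe.congr fun n => ?_)
    rw [norm_rankOne, sq]
  have hsum : Summable fun n => rankOne ℂ (f n) (f n) - rankOne ℂ (e n) (e n) := by
    refine ((h1.add h2).add h3).congr fun n => ?_
    ext a
    simp only [_root_.add_apply, _root_.sub_apply, rankOne_apply, inner_sub_left, sub_smul,
      smul_sub]
    abel
  refine ⟨∑' n, (rankOne ℂ (f n) (f n) - rankOne ℂ (e n) (e n)), ?_, fun a => ?_⟩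
  · refine isCompactOperator_of_tendsto hsum.hasSum (Eventually.of_forall fun t => ?_)
    exact (compactOperator (RingHom.id ℂ) H H).sum_mem fun n _ =>
      (compactOperator (RingHom.id ℂ) H H).sub_mem (isCompactOperator_rankOne _ _)
        (isCompactOperator_rankOne _ _)
  · have h4 := (ContinuousLinearMap.apply ℂ H a).hasSum hsum.hasSum
    simpa only [ContinuousLinearMap.apply_apply, _root_.sub_apply, rankOne_apply] using h4

/-- The Fredholm alternative at `-1`. -/
theorem existsUnique_add_apply_eq {K : H →L[ℂ] H} (hK : IsCompactOperator K)
    (hinj : ∀ a, a + K a = 0 → a = 0) (y : H) : ∃! a, a + K a = y := by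
  rcases hK.hasEigenvalue_or_mem_resolventSet (μ := -1) (by norm_num) with h4 | h4
  · obtain ⟨a, ha⟩ := h4.exists_hasEigenvector
    refine absurd (hinj a ?_) ha.2
    have h5 : K a = -a := by simpa using ha.apply_eq_smul
    rw [h5, add_neg_cancel]
  · have h5 : IsUnit (1 + K) := by
      have := (spectrum.mem_resolventSet_iff.1 h4).neg
      simpa [add_comm] using this
    obtain ⟨u, hu⟩ := h5
    have h6 : ∀ a, a + K a = (u : H →L[ℂ] H) a := fun a => by
      rw [hu]
      rfl
    have h7 : ∀ a, (u : H →L[ℂ] H) ((↑u⁻¹ : H →L[ℂ] H) a) = a := fun a =>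
      congrArg (fun T : H →L[ℂ] H => T a) u.mul_inv
    have h8 : ∀ a, (↑u⁻¹ : H →L[ℂ] H) ((u : H →L[ℂ] H) a) = a := fun a =>
      congrArg (fun T : H →L[ℂ] H => T a) u.inv_mul
    refine ⟨(↑u⁻¹ : H →L[ℂ] H) y, (h6 _).trans (h7 y), fun a ha => ?_⟩
    rw [← ha, h6, h8]

/-- Let `e` be a Parseval frame and let `f` be a complete system with `∑ ‖fₙ - eₙ‖² < ∞`. Then
`K = ∑ (|fₙ⟩⟨fₙ| - |eₙ⟩⟨eₙ|) + |z⟩⟨z|` is compact and `1 + K = ∑ |fₙ⟩⟨fₙ| + |z⟩⟨z|` is injective,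
hence bijective. -/
theorem exists_frame_perturbation (he : ∀ a, HasSum (fun n => ‖inner ℂ (e n) a‖ ^ 2) (‖a‖ ^ 2))
    (hfe : Summable fun n => ‖f n - e n‖ ^ 2)
    (hf : ∀ a, (∀ n, inner ℂ (f n) a = 0) → a = 0) (z : H) :
    ∃ K : H →L[ℂ] H,
      (∀ a, HasSum (fun n => inner ℂ (f n) a • f n - inner ℂ (e n) a • e n)
        (K a - inner ℂ z a • z)) ∧
      ∀ y, ∃! a, a + K a = y := by
  obtain ⟨K₀, hK₀, hKa⟩ := exists_frame_difference (e := e) (f := f) (fun a t =>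
    sum_le_hasSum t (fun _ _ => by positivity) (he a)) hfe
  refine ⟨K₀ + rankOne ℂ z z, fun a => ?_, existsUnique_add_apply_eq
    (IsCompactOperator.add hK₀ (isCompactOperator_rankOne z z)) fun a ha => ?_⟩
  · have h1 : (K₀ + rankOne ℂ z z) a - inner ℂ z a • z = K₀ a := by
      rw [_root_.add_apply, rankOne_apply, add_sub_cancel_right]
    rw [h1]
    exact hKa a
  · -- Pairing `a + K a = 0` with `a` and adding Parseval's identity gives
    -- `∑ |⟨fₙ, a⟩|² = -|⟨z, a⟩|²`, so both sides vanish.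
    rw [_root_.add_apply, rankOne_apply] at ha
    have h4 : HasSum (fun n => inner ℂ a (inner ℂ (f n) a • f n - inner ℂ (e n) a • e n))
      (inner ℂ a (K₀ a)) := (innerSL ℂ a).hasSum (hKa a)
    have h5 := (Complex.hasSum_ofReal.2 (he a)).add h4
    have h6 : ((‖a‖ ^ 2 : ℝ) : ℂ) + inner ℂ a (K₀ a) = ((-‖inner ℂ z a‖ ^ 2 : ℝ) : ℂ) := by
      have h7 := congrArg (inner ℂ a) ha
      rw [inner_add_right, inner_add_right, inner_zero_right, inner_smul_right,
        inner_self_eq_norm_sq_to_K] at h7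
      have h8 : inner ℂ z a * inner ℂ a z = ((‖inner ℂ z a‖ ^ 2 : ℝ) : ℂ) := by
        rw [← inner_conj_symm a z, Complex.mul_conj, Complex.normSq_eq_norm_sq]
      rw [h8] at h7
      push_cast at h7 ⊢
      linear_combination h7
    rw [h6] at h5
    have h9 : ∀ n, ((‖inner ℂ (e n) a‖ ^ 2 : ℝ) : ℂ) +
        inner ℂ a (inner ℂ (f n) a • f n - inner ℂ (e n) a • e n) =
        ((‖inner ℂ (f n) a‖ ^ 2 : ℝ) : ℂ) := fun n => by
      rw [inner_sub_right, inner_smul_right, inner_smul_right,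
        ← inner_conj_symm a (f n), ← inner_conj_symm a (e n), Complex.mul_conj, Complex.mul_conj,
        Complex.normSq_eq_norm_sq, Complex.normSq_eq_norm_sq]
      ring
    simp only [h9] at h5
    have h10 := Complex.hasSum_ofReal.1 h5
    have h11 : -‖inner ℂ z a‖ ^ 2 = 0 := le_antisymm (by simp)
      (h10.nonneg fun n => by positivity)
    rw [h11] at h10
    have h12 := (hasSum_zero_iff_of_nonneg fun n => by positivity).1 h10
    exact hf a fun n => by simpa using congrFun h12 n

end Frames

/-! ### Trigonometric rows in the Hilbert space of the main equation -/

section Rows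

variable {X b : ℝ}

/-- The Hilbert space of rows with two entries in `L₂(0, X)`. -/
abbrev RowSpace (X : ℝ) : Type :=
  PiLp 2 fun _ : Fin 2 => Lp ℂ 2 (volume.restrict (Set.Ioo 0 X))

theorem norm_trigVec_le (l y : ℝ) (j : Fin 2) : ‖trigVec l y j‖ ≤ 1 := by
  fin_cases j
  · simp only [trigVec, Fin.zero_eta, Matrix.cons_val_zero]
    rw [← Complex.ofReal_mul, ← Complex.ofReal_sin, Complex.norm_real]
    exact Real.abs_sin_le_one _
  · simp only [trigVec, Fin.mk_one, Matrix.cons_val_one, Matrix.cons_val_fin_one]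
    rw [norm_neg, ← Complex.ofReal_mul, ← Complex.ofReal_cos, Complex.norm_real]
    exact Real.abs_cos_le_one _

theorem conj_trigVec (l y : ℝ) (j : Fin 2) :
    (starRingEnd ℂ) (trigVec l y j) = trigVec l y j := by
  fin_cases j <;> simp [trigVec, ← Complex.sin_conj, ← Complex.cos_conj]

theorem continuous_trigVec (l : ℂ) (j : Fin 2) : Continuous fun y : ℝ => trigVec l y j := by
  fin_cases j <;> simp only [trigVec, Fin.zero_eta, Fin.mk_one, Matrix.cons_val_zero,
    Matrix.cons_val_one] <;> fun_prop

theorem memLp_trigVec (X l : ℝ) (j : Fin 2) :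
    MemLp (fun y : ℝ => trigVec l y j) 2 (volume.restrict (Set.Ioo 0 X)) :=
  MemLp.of_bound (continuous_trigVec l j).aestronglyMeasurable 1
    (Eventually.of_forall fun y => norm_trigVec_le l y j)

/-- The row `(sin l y, -cos l y)` on `(0, X)`. -/
noncomputable def trigRow (X l : ℝ) : RowSpace X :=
  WithLp.toLp 2 fun j => (memLp_trigVec X l j).toLp _

theorem coeFn_trigRow (X l : ℝ) (j : Fin 2) :
    (trigRow X l j : ℝ → ℂ) =ᵐ[volume.restrict (Set.Ioo 0 X)] fun y => trigVec l y j :=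
  (memLp_trigVec X l j).coeFn_toLp

theorem integrable_trigVec_mul (l : ℝ) (a : RowSpace X) (k : Fin 2) :
    Integrable (fun y => trigVec l y k * a k y) (volume.restrict (Set.Ioo 0 X)) :=
  ((Lp.memLp (a k)).integrable one_le_two).bdd_mul (c := 1)
    (continuous_trigVec l k).aestronglyMeasurable
    (Eventually.of_forall fun y => norm_trigVec_le l y k)

/-- The rows are real, so the Hermitian pairing with them is the bilinear one. -/
theorem inner_trigRow (l : ℝ) (a : RowSpace X) :
    inner ℂ (trigRow X l) a =
      ∫ y in Set.Ioo 0 X, ∑ k, trigVec l y k * a k y := by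
  rw [PiLp.inner_apply, integral_finsetSum _ fun k _ => integrable_trigVec_mul l a k]
  refine Finset.sum_congr rfl fun k _ => ?_
  rw [MeasureTheory.L2.inner_def]
  refine integral_congr_ae ?_
  filter_upwards [coeFn_trigRow X l k] with y hy
  rw [hy, RCLike.inner_apply, conj_trigVec, mul_comm]

theorem norm_Lp_sq {ν : Measure ℝ} (u : Lp ℂ 2 ν) : ‖u‖ ^ 2 = ∫ y, ‖u y‖ ^ 2 ∂ν := by
  rw [← norm_toLp_sq (Lp.memLp u), Lp.toLp_coeFn]

theorem norm_row_sq (a : RowSpace X) :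
    ‖a‖ ^ 2 = ∫ y in Set.Ioo 0 X, (‖a 0 y‖ ^ 2 + ‖a 1 y‖ ^ 2) := by
  rw [PiLp.norm_sq_eq_of_L2, Fin.sum_univ_two, norm_Lp_sq, norm_Lp_sq,
    integral_add (integrable_norm_sq (Lp.memLp _)) (integrable_norm_sq (Lp.memLp _))]

/-- Pairings of a row with the trigonometric rows are values of the Fourier transform of a scalar
function on `(-b, b)`, assembled from the combinations of the two entries that multiply
`e^{ily}` and `e^{-ily}`. -/
theorem exists_windowTransform_eq_inner (hX : 0 < X) (hXb : X ≤ b) (a : RowSpace X) :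
    ∃ g : ℝ → ℂ, MemLp g 2 (volume.restrict (Set.Ioc (-b) b)) ∧
      (∀ l, windowTransform b g l = inner ℂ (trigRow X l) a) ∧
      ∫ y in (-b)..b, ‖g y‖ ^ 2 = 1 / 2 * ‖a‖ ^ 2 := by
  have hle : -b ≤ b := by linarith
  set p : ℝ → ℂ := fun y => 1 / 2 * (-Complex.I * a 0 y - a 1 y) with hp
  set q : ℝ → ℂ := fun y => 1 / 2 * (Complex.I * a 0 y - a 1 y) with hq
  have hpL : MemLp p 2 (volume.restrict (Set.Ioo 0 X)) :=
    (((Lp.memLp (a 0)).const_mul (-Complex.I)).sub (Lp.memLp (a 1))).const_mul (1 / 2)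
  have hqL : MemLp q 2 (volume.restrict (Set.Ioo 0 X)) :=
    (((Lp.memLp (a 0)).const_mul Complex.I).sub (Lp.memLp (a 1))).const_mul (1 / 2)
  set P := (Set.Ioo 0 X).indicator p with hP
  set Q := (Set.Ioo 0 X).indicator q with hQ
  have hPL : MemLp P 2 volume := (memLp_indicator_iff_restrict measurableSet_Ioo).2 hpL
  have hQL : MemLp Q 2 volume := (memLp_indicator_iff_restrict measurableSet_Ioo).2 hqL
  have hPi : Integrable P := (integrable_indicator_iff measurableSet_Ioo).2
    (hpL.integrable one_le_two)
  have hQi : Integrable Q := (integrable_indicator_iff measurableSet_Ioo).2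
    (hqL.integrable one_le_two)
  have hQn : MemLp (fun y => Q (-y)) 2 volume :=
    hQL.comp_measurePreserving (Measure.measurePreserving_neg volume)
  have hout : ∀ y ∉ Set.Ioc (-b) b, P y = 0 ∧ Q (-y) = 0 := by
    intro y hy
    have h1 : y ∉ Set.Ioo 0 X := fun h => hy ⟨by linarith [h.1], by linarith [h.2]⟩
    have h2 : -y ∉ Set.Ioo 0 X := fun h => hy ⟨by linarith [h.2], by linarith [h.1]⟩
    exact ⟨Set.indicator_of_notMem h1 _, Set.indicator_of_notMem h2 _⟩
  have hcis : ∀ x : ℝ, cis x = Complex.cos x + Complex.sin x * Complex.I := fun x =>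
    Complex.exp_mul_I _
  refine ⟨fun y => P y + Q (-y), (hPL.add hQn).restrict _, fun l => ?_, ?_⟩
  · rw [windowTransform, intervalIntegral.integral_of_le hle,
      setIntegral_eq_integral_of_forall_compl_eq_zero (fun y hy => by
        rw [(hout y hy).1, (hout y hy).2, add_zero, zero_mul]), inner_trigRow]
    have i1 : Integrable fun y => P y * cis (l * y) :=
      hPi.mul_bdd (c := 1) (by fun_prop : Continuous _).aestronglyMeasurable
        (Eventually.of_forall fun y => (norm_cis _).le)
    have i2 : Integrable fun y => Q y * cis (l * -y) :=
      hQi.mul_bdd (c := 1) (by fun_prop : Continuous _).aestronglyMeasurable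
        (Eventually.of_forall fun y => (norm_cis _).le)
    have i3 : Integrable fun y => Q (-y) * cis (l * y) := by
      simpa using i2.comp_neg
    simp only [add_mul]
    rw [integral_add i1 i3]
    have e1 : ∫ y, Q (-y) * cis (l * y) = ∫ y, Q y * cis (l * -y) := by
      have := integral_neg_eq_self (fun y => Q y * cis (l * -y)) volume
      simpa using this
    rw [e1, ← integral_add i1 i2, ← integral_indicator measurableSet_Ioo]
    refine integral_congr_ae (Eventually.of_forall fun y => ?_)
    simp only [hP, hQ, Set.indicator_apply]
    split_ifs with hy
    · simp only [hp, hq, hcis, Fin.sum_univ_two, trigVec, Matrix.cons_val_zero,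
        Matrix.cons_val_one, Matrix.cons_val_fin_one, mul_neg, Complex.ofReal_neg,
        Complex.ofReal_mul, Complex.cos_neg, Complex.sin_neg]
      linear_combination (-a 0 y * Complex.sin (l * y)) * Complex.I_sq
    · simp
  · have e0 : ∀ y, ‖P y + Q (-y)‖ ^ 2 = ‖P y‖ ^ 2 + ‖Q (-y)‖ ^ 2 := by
      intro y
      by_cases hy : 0 < y
      · have : Q (-y) = 0 := Set.indicator_of_notMem (fun h => by linarith [h.1]) _
        simp [this]
      · have : P y = 0 := Set.indicator_of_notMem (fun h => hy h.1) _
        simp [this]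
    have j1 := integrable_norm_sq hPL
    have j2 := integrable_norm_sq hQL
    have j3 := integrable_norm_sq hQn
    rw [intervalIntegral.integral_of_le hle,
      setIntegral_eq_integral_of_forall_compl_eq_zero (fun y hy => by
        simp only [(hout y hy).1, (hout y hy).2, add_zero, norm_zero, ne_eq, OfNat.ofNat_ne_zero,
          not_false_eq_true, zero_pow])]
    simp only [e0]
    rw [integral_add j1 j3, integral_neg_eq_self (fun y => ‖Q y‖ ^ 2) volume,
      ← integral_add j1 j2, norm_row_sq, ← integral_const_mul,
      ← integral_indicator measurableSet_Ioo]
    refine integral_congr_ae (Eventually.of_forall fun y => ?_)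
    simp only [hP, hQ, Set.indicator_apply]
    split_ifs with hy
    · simp only [hp, hq, ← Complex.normSq_eq_norm_sq, Complex.normSq_apply]
      simp
      ring
    · simp

/-- Parseval's identity for the trigonometric rows. On `(0, b)` they form an orthogonal basis up
to normalization, on a shorter interval only a tight frame. -/
theorem hasSum_norm_sq_inner_trigRow (hX : 0 < X) (hXb : X ≤ b) (a : RowSpace X) :
    HasSum (fun n : ℤ => ‖inner ℂ (trigRow X (n * Real.pi / b)) a‖ ^ 2) (b * ‖a‖ ^ 2) := by
  obtain ⟨g, hg, h1, h2⟩ := exists_windowTransform_eq_inner hX hXb a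
  have h3 := hasSum_norm_sq_windowTransform (hX.trans_le hXb) hg
  rw [h2] at h3
  simp only [h1] at h3
  convert h3 using 1
  ring

theorem eq_zero_of_forall_inner_trigRow (hX : 0 < X) (hXb : X ≤ b) {lam : ℤ → ℝ}
    (hlam : Function.Injective lam) (hs : Summable fun n : ℤ => (lam n - n * Real.pi / b) ^ 2)
    (a : RowSpace X) (h : ∀ n, inner ℂ (trigRow X (lam n)) a = 0) : a = 0 := by
  obtain ⟨g, hg, h1, h2⟩ := exists_windowTransform_eq_inner hX hXb a
  have h3 := integral_norm_sq_eq_zero_of_forall_windowTransform (hX.trans_le hXb) hg hlam hs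
    fun n => by rw [h1, h]
  rw [h2] at h3
  have h4 : ‖a‖ ^ 2 = 0 := by linarith
  simpa using h4

theorem norm_trigRow_sq_le (hX : 0 < X) (l : ℝ) : ‖trigRow X l‖ ^ 2 ≤ 2 * X := by
  have h1 : ∀ᵐ y ∂(volume.restrict (Set.Ioo 0 X)),
      ‖trigRow X l 0 y‖ ^ 2 + ‖trigRow X l 1 y‖ ^ 2 ≤ 2 := by
    filter_upwards [coeFn_trigRow X l 0, coeFn_trigRow X l 1] with y h0 h1
    rw [h0, h1]
    have := pow_le_one₀ (n := 2) (norm_nonneg _) (norm_trigVec_le l y 0)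
    have := pow_le_one₀ (n := 2) (norm_nonneg _) (norm_trigVec_le l y 1)
    linarith
  rw [norm_row_sq]
  refine (integral_mono_ae ((integrable_norm_sq (Lp.memLp _)).add
    (integrable_norm_sq (Lp.memLp _))) (integrable_const 2) h1).trans (le_of_eq ?_)
  simp [hX.le, mul_comm]

theorem norm_trigRow_sub_sq_le (hX : 0 < X) (l m : ℝ) :
    ‖trigRow X l - trigRow X m‖ ^ 2 ≤ X ^ 3 * (l - m) ^ 2 := by
  have h1 : ∀ᵐ y ∂(volume.restrict (Set.Ioo 0 X)),
      ‖(trigRow X l - trigRow X m) 0 y‖ ^ 2 + ‖(trigRow X l - trigRow X m) 1 y‖ ^ 2 ≤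
        X ^ 2 * (l - m) ^ 2 := by
    filter_upwards [coeFn_trigRow X l 0, coeFn_trigRow X l 1, coeFn_trigRow X m 0,
      coeFn_trigRow X m 1, Lp.coeFn_sub (trigRow X l 0) (trigRow X m 0),
      Lp.coeFn_sub (trigRow X l 1) (trigRow X m 1), ae_restrict_mem measurableSet_Ioo]
      with y h0 h1 h2 h3 h4 h5 hy
    rw [PiLp.sub_apply, PiLp.sub_apply, h4, h5, Pi.sub_apply, Pi.sub_apply, h0, h1, h2, h3]
    have e1 : ‖trigVec l y 0 - trigVec m y 0‖ ^ 2 + ‖trigVec l y 1 - trigVec m y 1‖ ^ 2 =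
        ‖cis (l * y) - cis (m * y)‖ ^ 2 := by
      rw [← Complex.normSq_eq_norm_sq (cis _ - _), Complex.normSq_apply, Complex.sub_re,
        Complex.sub_im, cis_re, cis_re, cis_im, cis_im]
      simp only [trigVec, Matrix.cons_val_zero, Matrix.cons_val_one, Matrix.cons_val_fin_one,
        ← Complex.ofReal_mul, ← Complex.ofReal_sin, ← Complex.ofReal_cos, ← Complex.ofReal_neg,
        ← Complex.ofReal_sub, Complex.norm_real, Real.norm_eq_abs, sq_abs]
      ring
    rw [e1, ← mul_pow]
    refine pow_le_pow_left₀ (norm_nonneg _) ?_ 2 |>.trans (le_of_eq (sq_abs (X * (l - m))))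
    refine (norm_cis_sub_cis_le _ _).trans ?_
    rw [← sub_mul, abs_mul, abs_mul, mul_comm, abs_of_pos hX, abs_of_pos hy.1]
    exact mul_le_mul_of_nonneg_right hy.2.le (abs_nonneg _)
  rw [norm_row_sq]
  refine (integral_mono_ae ((integrable_norm_sq (Lp.memLp _)).add
    (integrable_norm_sq (Lp.memLp _))) (integrable_const _) h1).trans (le_of_eq ?_)
  simp [hX.le]
  ring

theorem exists_pos_forall_le {nrm : ℤ → ℝ} (hb : 0 < b) (hpos : ∀ n, 0 < nrm n)
    (hs : Summable fun n => (nrm n - b) ^ 2) : ∃ m, 0 < m ∧ ∀ n, m ≤ nrm n := by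
  have h1 : ∀ᶠ n in cofinite, (nrm n - b) ^ 2 < (b / 2) ^ 2 :=
    hs.tendsto_cofinite_zero.eventually_lt_const (by positivity)
  have hfin : {n | ¬ (nrm n - b) ^ 2 < (b / 2) ^ 2}.Finite := h1
  obtain ⟨m, hm, hm'⟩ : ∃ m, 0 < m ∧ ∀ n ∈ hfin.toFinset, m ≤ nrm n := by
    induction hfin.toFinset using Finset.induction_on with
    | empty => exact ⟨1, one_pos, by simp⟩
    | insert k s _ ih =>
      obtain ⟨m, hm, hm'⟩ := ih
      refine ⟨min m (nrm k), lt_min hm (hpos k), fun n hn => ?_⟩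
      rcases Finset.mem_insert.1 hn with rfl | hn
      · exact min_le_right _ _
      · exact (min_le_left _ _).trans (hm' n hn)
  refine ⟨min m (b / 2), lt_min hm (by positivity), fun n => ?_⟩
  by_cases hn : (nrm n - b) ^ 2 < (b / 2) ^ 2
  · have := abs_lt_of_sq_lt_sq hn (by positivity)
    exact (min_le_right _ _).trans (by linarith [(abs_lt.1 this).1])
  · exact (min_le_left _ _).trans (hm' n (by simpa using hn))

/-- The operator `a ↦ ∫ a(ξ) F₀(ξ, ·) dξ` on rows, as the sum of its series, and the unique
solvability of `a + K a = y`. -/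
theorem exists_row_operator (hX : 0 < X) (hXb : X ≤ b) {lam nrm : ℤ → ℝ}
    (hlam : Function.Injective lam) (hpos : ∀ n, 0 < nrm n)
    (hs : Summable fun n : ℤ => (lam n - n * Real.pi / b) ^ 2)
    (hw : Summable fun n => (nrm n - b) ^ 2) {c : ℝ} (hc : 0 ≤ c) (l : ℝ) :
    ∃ K : RowSpace X →L[ℂ] RowSpace X,
      (∀ a, HasSum (fun n : ℤ =>
        ((1 / nrm n : ℝ) : ℂ) • inner ℂ (trigRow X (lam n)) a • trigRow X (lam n) -
          ((1 / b : ℝ) : ℂ) • inner ℂ (trigRow X (n * Real.pi / b)) a •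
            trigRow X (n * Real.pi / b))
        (K a - (c : ℂ) • inner ℂ (trigRow X l) a • trigRow X l)) ∧
      ∀ y, ∃! a, a + K a = y := by
  have hb : 0 < b := hX.trans_le hXb
  obtain ⟨m, hm, hm'⟩ := exists_pos_forall_le hb hpos hw
  have hscale : ∀ (w : ℝ), 0 ≤ w → ∀ (u a : RowSpace X),
      inner ℂ (((Real.sqrt w : ℝ) : ℂ) • u) a • ((Real.sqrt w : ℝ) : ℂ) • u =
        (w : ℂ) • inner ℂ u a • u := by
    intro w hw u a
    rw [inner_smul_left, Complex.conj_ofReal, smul_smul, smul_smul]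
    congr 1
    rw [mul_right_comm, ← Complex.ofReal_mul, Real.mul_self_sqrt hw]
  have hnorm : ∀ (w : ℝ), 0 ≤ w → ∀ (u a : RowSpace X),
      ‖inner ℂ (((Real.sqrt w : ℝ) : ℂ) • u) a‖ ^ 2 = w * ‖inner ℂ u a‖ ^ 2 := by
    intro w hw u a
    rw [inner_smul_left, norm_mul, mul_pow, Complex.conj_ofReal, Complex.norm_real,
      Real.norm_eq_abs, sq_abs, Real.sq_sqrt hw]
  -- The square roots of the weights are absorbed into the frame vectors.
  let e : ℤ → RowSpace X := fun n =>
    ((Real.sqrt (1 / b) : ℝ) : ℂ) • trigRow X (n * Real.pi / b)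
  let f : ℤ → RowSpace X := fun n => ((Real.sqrt (1 / nrm n) : ℝ) : ℂ) • trigRow X (lam n)
  have he : ∀ a, HasSum (fun n => ‖inner ℂ (e n) a‖ ^ 2) (‖a‖ ^ 2) := by
    intro a
    simp only [e, hnorm _ (one_div_nonneg.2 hb.le)]
    have := (hasSum_norm_sq_inner_trigRow hX hXb a).mul_left (1 / b)
    rwa [← mul_assoc, one_div_mul_cancel hb.ne', one_mul] at this
  have hfe : Summable fun n => ‖f n - e n‖ ^ 2 := by
    have hsum : Summable fun n : ℤ => 2 * (1 / m * (X ^ 3 * (lam n - n * Real.pi / b) ^ 2)) +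
        2 * (1 / (m * b * b) * (nrm n - b) ^ 2 * (2 * X)) :=
      (((hs.mul_left _).mul_left _).mul_left _).add (((hw.mul_left _).mul_right _).mul_left _)
    refine Summable.of_nonneg_of_le (fun n => by positivity) (fun n => ?_) hsum
    have hn := hpos n
    have e1 : ((Real.sqrt (1 / nrm n) : ℝ) : ℂ) • trigRow X (lam n) -
        ((Real.sqrt (1 / b) : ℝ) : ℂ) • trigRow X (n * Real.pi / b) =
        ((Real.sqrt (1 / nrm n) : ℝ) : ℂ) • (trigRow X (lam n) - trigRow X (n * Real.pi / b)) +
        ((Real.sqrt (1 / nrm n) - Real.sqrt (1 / b) : ℝ) : ℂ) • trigRow X (n * Real.pi / b) := by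
      push_cast
      module
    have e2 : (Real.sqrt (1 / nrm n) - Real.sqrt (1 / b)) ^ 2 ≤
        1 / (m * b * b) * (nrm n - b) ^ 2 := by
      have hr := Real.sqrt_pos.2 hn
      have hbs := Real.sqrt_pos.2 hb
      have h3 : (Real.sqrt (1 / nrm n) - Real.sqrt (1 / b)) *
          (Real.sqrt (nrm n) * Real.sqrt b * (Real.sqrt (nrm n) + Real.sqrt b)) = b - nrm n := by
        rw [Real.sqrt_div zero_le_one, Real.sqrt_div zero_le_one, Real.sqrt_one]
        field_simp
        nlinarith [Real.sq_sqrt hn.le, Real.sq_sqrt hb.le]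
      have h4 : m * b * b ≤
          (Real.sqrt (nrm n) * Real.sqrt b * (Real.sqrt (nrm n) + Real.sqrt b)) ^ 2 := by
        rw [mul_pow, mul_pow, Real.sq_sqrt hn.le, Real.sq_sqrt hb.le]
        refine mul_le_mul (mul_le_mul_of_nonneg_right (hm' n) hb.le) ?_ hb.le (by positivity)
        rw [add_sq, Real.sq_sqrt hn.le, Real.sq_sqrt hb.le]
        have : 0 ≤ 2 * Real.sqrt (nrm n) * Real.sqrt b := by positivity
        linarith
      rw [div_mul_eq_mul_div, one_mul, le_div_iff₀ (by positivity)]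
      refine (mul_le_mul_of_nonneg_left h4 (sq_nonneg _)).trans (le_of_eq ?_)
      rw [← mul_pow, h3]
      ring
    have e3 : ‖((Real.sqrt (1 / nrm n) : ℝ) : ℂ) •
        (trigRow X (lam n) - trigRow X (n * Real.pi / b))‖ ^ 2 ≤
        1 / m * (X ^ 3 * (lam n - n * Real.pi / b) ^ 2) := by
      rw [norm_smul, mul_pow, Complex.norm_real, Real.norm_eq_abs, sq_abs,
        Real.sq_sqrt (one_div_nonneg.2 hn.le)]
      exact mul_le_mul (one_div_le_one_div_of_le hm (hm' n)) (norm_trigRow_sub_sq_le hX _ _)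
        (sq_nonneg _) (by positivity)
    have e4 : ‖((Real.sqrt (1 / nrm n) - Real.sqrt (1 / b) : ℝ) : ℂ) •
        trigRow X (n * Real.pi / b)‖ ^ 2 ≤ 1 / (m * b * b) * (nrm n - b) ^ 2 * (2 * X) := by
      rw [norm_smul, mul_pow, Complex.norm_real, Real.norm_eq_abs, sq_abs]
      exact mul_le_mul e2 (norm_trigRow_sq_le hX _) (sq_nonneg _) (by positivity)
    rw [e1]
    refine (pow_le_pow_left₀ (norm_nonneg _) (norm_add_le _ _) 2).trans (add_sq_le.trans ?_)
    rw [mul_add]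
    exact add_le_add (mul_le_mul_of_nonneg_left e3 two_pos.le)
      (mul_le_mul_of_nonneg_left e4 two_pos.le)
  have hf : ∀ a, (∀ n, inner ℂ (f n) a = 0) → a = 0 := by
    intro a ha
    refine eq_zero_of_forall_inner_trigRow hX hXb hlam hs a fun n => ?_
    have h1 := ha n
    rw [inner_smul_left, Complex.conj_ofReal] at h1
    refine (mul_eq_zero.1 h1).resolve_left ?_
    have := Real.sqrt_pos.2 (one_div_pos.2 (hpos n))
    exact_mod_cast this.ne'
  obtain ⟨K, hK, hu⟩ := exists_frame_perturbation he hfe hf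
    (((Real.sqrt c : ℝ) : ℂ) • trigRow X l)
  refine ⟨K, fun a => ?_, hu⟩
  have h1 := hK a
  simp only [e, f, hscale _ hc, hscale _ (one_div_nonneg.2 hb.le)] at h1
  simpa only [fun n => hscale _ (one_div_nonneg.2 (hpos n).le)] using h1

end Rows

/-! ### Convergence of the series for the kernel -/

section KernelSeries

variable {b : ℝ}

/-- Square summable combinations of a Bessel sequence converge. -/
theorem summable_smul_of_bessel {H ι : Type*} [NormedAddCommGroup H] [InnerProductSpace ℂ H]
    [CompleteSpace H] {e : ι → H} {C : ℝ} (hC : 0 ≤ C)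
    (he : ∀ (a : H) (t : Finset ι), ∑ n ∈ t, ‖inner ℂ (e n) a‖ ^ 2 ≤ C * ‖a‖ ^ 2)
    {c : ι → ℂ} (hc : Summable fun n => ‖c n‖ ^ 2) : Summable fun n => c n • e n := by
  rw [summable_iff_vanishing_norm]
  intro ε hε
  obtain ⟨s, hs⟩ := summable_iff_vanishing_norm.1 hc (ε ^ 2 / (C + 1)) (by positivity)
  refine ⟨s, fun t ht => ?_⟩
  have h1 := norm_sum_smul_sq_le hC he c t
  have h2 := hs t ht
  rw [Real.norm_of_nonneg (Finset.sum_nonneg fun _ _ => by positivity),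
    lt_div_iff₀ (by positivity)] at h2
  have h3 : 0 ≤ ∑ n ∈ t, ‖c n‖ ^ 2 := Finset.sum_nonneg fun _ _ => by positivity
  exact lt_of_pow_lt_pow_left₀ 2 hε.le (by nlinarith)

theorem memLp_window_of_continuous {f : ℝ → ℂ} (hf : Continuous f) (c d : ℝ) :
    MemLp f 2 (volume.restrict (Set.Ioc c d)) := by
  obtain ⟨C, hC⟩ := (isCompact_Icc (a := c) (b := d)).exists_bound_of_continuousOn hf.continuousOn
  refine MemLp.of_bound (C := C) hf.aestronglyMeasurable ?_
  filter_upwards [ae_restrict_mem measurableSet_Ioc] with y hy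
  exact hC y ⟨hy.1.le, hy.2⟩

theorem continuous_mul_cis {m : ℝ → ℝ} (hm : Continuous m) (l : ℝ) :
    Continuous fun y => (m y : ℂ) * cis (l * y) := by fun_prop

/-- Exponentials with frequencies in `(π / b) ℤ`, multiplied by a fixed bounded weight, form a
Bessel sequence on `(-2b, 2b)`: these are the frequencies of even index of an orthogonal basis. -/
theorem sum_norm_sq_inner_mul_cis_le (hb : 0 < b) {m : ℝ → ℝ} (hm : Continuous m) {D : ℝ}
    (hD : ∀ y ∈ Set.Ioc (-(2 * b)) (2 * b), |m y| ≤ D)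
    (a : Lp ℂ 2 (volume.restrict (Set.Ioc (-(2 * b)) (2 * b)))) (t : Finset ℤ) :
    ∑ n ∈ t, ‖inner ℂ ((memLp_window_of_continuous (continuous_mul_cis hm (n * Real.pi / b))
      (-(2 * b)) (2 * b)).toLp _) a‖ ^ 2 ≤ 4 * b * D ^ 2 * ‖a‖ ^ 2 := by
  have h2b : 0 < 2 * b := by linarith
  have haL : MemLp a 2 (volume.restrict (Set.Ioc (-(2 * b)) (2 * b))) := Lp.memLp a
  have hhL : MemLp (fun y => (m y : ℂ) * a y) 2 (volume.restrict (Set.Ioc (-(2 * b)) (2 * b))) := by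
    refine haL.of_le_mul (c := D) ((by fun_prop : Continuous fun y =>
      (m y : ℂ)).aestronglyMeasurable.mul haL.1) ?_
    filter_upwards [ae_restrict_mem measurableSet_Ioc] with y hy
    rw [norm_mul, Complex.norm_real]
    exact mul_le_mul_of_nonneg_right (hD y hy) (norm_nonneg _)
  have h1 : ∀ n : ℤ, inner ℂ ((memLp_window_of_continuous (continuous_mul_cis hm
      (n * Real.pi / b)) (-(2 * b)) (2 * b)).toLp _) a =
      windowTransform (2 * b) (fun y => (m y : ℂ) * a y)
        (((-2 * n : ℤ) : ℝ) * Real.pi / (2 * b)) := by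
    intro n
    rw [MeasureTheory.L2.inner_def, windowTransform, intervalIntegral.integral_of_le (by linarith)]
    refine integral_congr_ae ?_
    filter_upwards [(memLp_window_of_continuous (continuous_mul_cis hm
      (n * Real.pi / b)) (-(2 * b)) (2 * b)).coeFn_toLp] with y hy
    rw [hy, RCLike.inner_apply, map_mul, Complex.conj_ofReal, conj_cis]
    have : -(n * Real.pi / b * y) = ((-2 * n : ℤ) : ℝ) * Real.pi / (2 * b) * y := by
      push_cast
      field_simp
    rw [this]
    ring
  refine (Finset.sum_congr rfl fun n _ => congrArg (fun z : ℂ => ‖z‖ ^ 2) (h1 n)).trans_le ?_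
  have h3 := hasSum_norm_sq_windowTransform h2b hhL
  have h4 := sum_le_hasSum (t.map ⟨fun n : ℤ => -2 * n, fun x y h => by simpa using h⟩)
    (fun _ _ => by positivity) h3
  rw [Finset.sum_map] at h4
  refine h4.trans ?_
  have h5 : ∫ y in (-(2 * b))..(2 * b), ‖(m y : ℂ) * a y‖ ^ 2 ≤ D ^ 2 * ‖a‖ ^ 2 := by
    rw [norm_Lp_sq, intervalIntegral.integral_of_le (by linarith), ← integral_const_mul]
    refine integral_mono_ae (integrable_norm_sq hhL) ((integrable_norm_sq haL).const_mul _) ?_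
    filter_upwards [ae_restrict_mem measurableSet_Ioc] with y hy
    rw [norm_mul, Complex.norm_real, mul_pow]
    exact mul_le_mul_of_nonneg_right (pow_le_pow_left₀ (norm_nonneg _) (hD y hy) 2)
      (by positivity)
  calc _ ≤ 2 * (2 * b) * (D ^ 2 * ‖a‖ ^ 2) := mul_le_mul_of_nonneg_left h5 (by positivity)
    _ = _ := by ring

/-- The first-order Taylor estimate, valid for all real `x`. -/
theorem norm_cis_sub_one_sub_le (x : ℝ) : ‖cis x - 1 - x * Complex.I‖ ≤ 3 * x ^ 2 := by
  have hn : ‖(x : ℂ) * Complex.I‖ = |x| := by simp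
  by_cases hx : |x| ≤ 1
  · have := Complex.norm_exp_sub_one_sub_id_le (x := x * Complex.I) (by rwa [hn])
    rw [hn, sq_abs] at this
    exact this.trans (by nlinarith [sq_nonneg x])
  · have h1 : ‖cis x - 1 - x * Complex.I‖ ≤ 1 + 1 + |x| := by
      refine (norm_sub_le _ _).trans (add_le_add ((norm_sub_le _ _).trans ?_) hn.le)
      rw [norm_cis, norm_one]
    rw [← sq_abs]
    nlinarith

/-- The term of the exponential series that generates the kernel. -/
noncomputable def expTerm (b : ℝ) (lam nrm : ℤ → ℝ) (n : ℤ) (y : ℝ) : ℂ :=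
  ((1 / nrm n : ℝ) : ℂ) * cis (lam n * y) - ((1 / b : ℝ) : ℂ) * cis (n * Real.pi / b * y)

theorem continuous_expTerm (lam nrm : ℤ → ℝ) (n : ℤ) : Continuous (expTerm b lam nrm n) := by
  unfold expTerm
  fun_prop

/-- The exponential series converges in `L₂(-2b, 2b)`: to first order in `lam n - n π / b` and
`nrm n - b` its terms are square summable multiples of members of two Bessel sequences, and the
remainder is quadratic. -/
theorem summable_toLp_expTerm (hb : 0 < b) {lam nrm : ℤ → ℝ} (hpos : ∀ n, 0 < nrm n)
    (hs : Summable fun n : ℤ => (lam n - n * Real.pi / b) ^ 2)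
    (hw : Summable fun n => (nrm n - b) ^ 2) :
    Summable fun n => (memLp_window_of_continuous (continuous_expTerm (b := b) lam nrm n)
      (-(2 * b)) (2 * b)).toLp _ := by
  obtain ⟨m, hm, hm'⟩ := exists_pos_forall_le hb hpos hw
  set δ : ℤ → ℝ := fun n => lam n - n * Real.pi / b with hδ
  have hu := summable_smul_of_bessel (by positivity) (sum_norm_sq_inner_mul_cis_le hb
    (m := fun _ => 1) continuous_const (D := 1) fun y _ => by simp)
    (c := fun n => ((1 / nrm n - 1 / b : ℝ) : ℂ)) (by
      refine Summable.of_nonneg_of_le (fun n => by positivity) (fun n => ?_)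
        (hw.mul_left ((1 / (m * b)) ^ 2))
      have hn := hpos n
      rw [Complex.norm_real, Real.norm_eq_abs, sq_abs]
      have : 1 / nrm n - 1 / b = (1 / (nrm n * b)) * (b - nrm n) := by field_simp
      rw [this, mul_pow, ← sq_abs (nrm n - b), abs_sub_comm, sq_abs]
      exact mul_le_mul_of_nonneg_right (pow_le_pow_left₀ (by positivity)
        (one_div_le_one_div_of_le (by positivity)
          (mul_le_mul_of_nonneg_right (hm' n) hb.le)) 2) (sq_nonneg _))
  have hv := summable_smul_of_bessel (by positivity) (sum_norm_sq_inner_mul_cis_le hb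
    (m := fun y => y) continuous_id (D := 2 * b) fun y hy => abs_le.2 ⟨hy.1.le, hy.2⟩)
    (c := fun n => ((1 / nrm n * δ n : ℝ) : ℂ) * Complex.I) (by
      refine Summable.of_nonneg_of_le (fun n => by positivity) (fun n => ?_)
        (hs.mul_left ((1 / m) ^ 2))
      have hn := hpos n
      rw [norm_mul, Complex.norm_I, mul_one, Complex.norm_real, Real.norm_eq_abs, sq_abs, mul_pow]
      exact mul_le_mul_of_nonneg_right (pow_le_pow_left₀ (by positivity)
        (one_div_le_one_div_of_le hm (hm' n)) 2) (sq_nonneg _))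
  -- The quadratic remainder is absolutely summable, with sup norm `O(δ n ^ 2)`.
  set r : ℤ → ℝ → ℂ := fun n y => ((1 / nrm n : ℝ) : ℂ) *
    (cis (n * Real.pi / b * y) * (cis (δ n * y) - 1 - (δ n * y : ℝ) * Complex.I)) with hr
  have hrc : ∀ n, Continuous (r n) := fun n => by
    simp only [hr]
    fun_prop
  have hrs : Summable fun n => (memLp_window_of_continuous (hrc n) (-(2 * b)) (2 * b)).toLp _ := by
    set V := (measureUnivNNReal (volume.restrict (Set.Ioc (-(2 * b)) (2 * b))) : ℝ) ^
      (2 : ENNReal).toReal⁻¹ with hV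
    refine Summable.of_norm_bounded (g := fun n => V * (1 / m * (3 * (2 * b) ^ 2) * δ n ^ 2))
      ((hs.mul_left _).mul_left _) fun n => ?_
    refine Lp.norm_le_of_ae_bound (by positivity) ?_
    filter_upwards [(memLp_window_of_continuous (hrc n) (-(2 * b)) (2 * b)).coeFn_toLp,
      ae_restrict_mem measurableSet_Ioc] with y hy hy'
    have hn := hpos n
    rw [hy, hr, norm_mul, norm_mul, norm_cis, one_mul, Complex.norm_real,
      Real.norm_of_nonneg (one_div_nonneg.2 hn.le), mul_assoc]
    refine mul_le_mul (one_div_le_one_div_of_le hm (hm' n))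
      ((norm_cis_sub_one_sub_le _).trans ?_) (norm_nonneg _) (by positivity)
    rw [mul_assoc, mul_pow, mul_comm (δ n ^ 2)]
    refine mul_le_mul_of_nonneg_left (mul_le_mul_of_nonneg_right ?_ (sq_nonneg _)) (by norm_num)
    exact sq_le_sq' hy'.1.le hy'.2
  refine ((hu.add hv).add hrs).congr fun n => ?_
  rw [← MemLp.toLp_const_smul, ← MemLp.toLp_const_smul, ← MemLp.toLp_add, ← MemLp.toLp_add]
  refine MemLp.toLp_congr _ _ (Eventually.of_forall fun y => ?_)
  have e1 : cis (lam n * y) = cis (n * Real.pi / b * y) * cis (δ n * y) := by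
    rw [← cis_add, hδ]
    congr 1
    ring
  simp only [Pi.add_apply, Pi.smul_apply, smul_eq_mul, hr, expTerm, e1]
  push_cast
  ring

theorem tendsto_Icc_neg_atTop :
    Tendsto (fun N : ℕ => Finset.Icc (-(N : ℤ)) N) atTop atTop := by
  refine tendsto_atTop_finset_of_monotone (fun M N h => ?_) fun n => ⟨n.natAbs, ?_⟩
  · exact Finset.Icc_subset_Icc (by simpa using h) (by simpa using h)
  · rw [Finset.mem_Icc]
    omega

theorem exists_expSeries_limit (hb : 0 < b) {lam nrm : ℤ → ℝ} (hpos : ∀ n, 0 < nrm n)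
    (hs : Summable fun n : ℤ => (lam n - n * Real.pi / b) ^ 2)
    (hw : Summable fun n => (nrm n - b) ^ 2) :
    ∃ Φ : ℝ → ℂ, Measurable Φ ∧ MemLp Φ 2 (volume.restrict (Set.Ioc (-(2 * b)) (2 * b))) ∧
      Tendsto (fun N : ℕ => eLpNorm (fun y => (∑ n ∈ Finset.Icc (-(N : ℤ)) N,
        expTerm b lam nrm n y) - Φ y) 2 (volume.restrict (Set.Ioc (-(2 * b)) (2 * b))))
        atTop (𝓝 0) := by
  obtain ⟨Φ, hΦ⟩ := summable_toLp_expTerm hb hpos hs hw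
  refine ⟨Φ, (Lp.stronglyMeasurable Φ).measurable, Lp.memLp Φ, ?_⟩
  have h1 := (Lp.tendsto_Lp_iff_tendsto_eLpNorm' _ _).1 (hΦ.comp tendsto_Icc_neg_atTop)
  refine h1.congr fun N => eLpNorm_congr_ae ?_
  have h2 : ∀ᵐ y ∂(volume.restrict (Set.Ioc (-(2 * b)) (2 * b))), ∀ n : ℤ,
      (memLp_window_of_continuous (continuous_expTerm (b := b) lam nrm n)
        (-(2 * b)) (2 * b)).toLp _ y = expTerm b lam nrm n y :=
    ae_all_iff.2 fun n => (memLp_window_of_continuous (continuous_expTerm (b := b) lam nrm n)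
      (-(2 * b)) (2 * b)).coeFn_toLp
  filter_upwards [h2, Lp.coeFn_fun_finsetSum (Finset.Icc (-(N : ℤ)) N) fun n =>
    (memLp_window_of_continuous (continuous_expTerm (b := b) lam nrm n)
      (-(2 * b)) (2 * b)).toLp _] with y h3 h4
  simp only [Function.comp_apply, Pi.sub_apply]
  rw [h4]
  simp only [h3]

end KernelSeries

/-! ### The kernel as a function of `x ± τ` -/

section Kernel

variable {a α b : ℝ}

/-- The matrix kernel generated by a function `Ψ` of one variable. It is real linear in `Ψ` and
takes `y ↦ e^{ily}` with real `l` to the kernel `s(x, l) s(τ, l)ᵀ`. -/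
noncomputable def trigKernel (x τ : ℝ) : (ℝ → ℂ) →ₗ[ℝ] Matrix (Fin 2) (Fin 2) ℂ where
  toFun Ψ := (1 / 2 : ℂ) • !![(((Ψ (x - τ)).re - (Ψ (x + τ)).re : ℝ) : ℂ),
      ((-((Ψ (x + τ)).im + (Ψ (x - τ)).im) : ℝ) : ℂ);
      ((-((Ψ (x + τ)).im - (Ψ (x - τ)).im) : ℝ) : ℂ),
      (((Ψ (x - τ)).re + (Ψ (x + τ)).re : ℝ) : ℂ)]
  map_add' Ψ Θ := by
    ext i j
    fin_cases i <;> fin_cases j <;> simp <;> ring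
  map_smul' c Ψ := by
    ext i j
    fin_cases i <;> fin_cases j <;> simp <;> ring

theorem trigKernel_cis (l x τ : ℝ) :
    trigKernel x τ (fun y => cis (l * y)) = Matrix.vecMulVec (trigVec l x) (trigVec l τ) := by
  have hs : ∀ y : ℝ, Complex.sin (l * y) = ((Real.sin (l * y) : ℝ) : ℂ) := fun y => by
    push_cast
    rfl
  have hc : ∀ y : ℝ, Complex.cos (l * y) = ((Real.cos (l * y) : ℝ) : ℂ) := fun y => by
    push_cast
    rfl
  have h1 := Real.cos_add (l * x) (l * τ)
  have h2 := Real.cos_sub (l * x) (l * τ)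
  have h3 := Real.sin_add (l * x) (l * τ)
  have h4 := Real.sin_sub (l * x) (l * τ)
  rw [← mul_add] at h1 h3
  rw [← mul_sub] at h2 h4
  ext i j
  fin_cases i <;> fin_cases j <;>
  · simp only [trigKernel, LinearMap.coe_mk, AddHom.coe_mk, cis_re, cis_im, h1, h2, h3, h4,
      Matrix.vecMulVec_apply, trigVec, hs, hc, Matrix.smul_apply, Fin.zero_eta, Fin.mk_one,
      Matrix.of_apply, Matrix.cons_val_zero, Matrix.cons_val_one, Matrix.cons_val_fin_one,
      smul_eq_mul]
    push_cast
    ring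

theorem norm_trigKernel_apply_le (x τ : ℝ) (Ψ : ℝ → ℂ) (i j : Fin 2) :
    ‖trigKernel x τ Ψ i j‖ ≤ ‖Ψ (x - τ)‖ + ‖Ψ (x + τ)‖ := by
  have h1 := Complex.abs_re_le_norm (Ψ (x - τ))
  have h2 := Complex.abs_re_le_norm (Ψ (x + τ))
  have h3 := Complex.abs_im_le_norm (Ψ (x - τ))
  have h4 := Complex.abs_im_le_norm (Ψ (x + τ))
  have key : ∀ u v : ℝ, |u| ≤ ‖Ψ (x - τ)‖ → |v| ≤ ‖Ψ (x + τ)‖ → ∀ w : ℝ,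
      |w| ≤ |u| + |v| → ‖(1 / 2 : ℂ) * (w : ℂ)‖ ≤ ‖Ψ (x - τ)‖ + ‖Ψ (x + τ)‖ := by
    intro u v hu hv w hw
    rw [norm_mul, Complex.norm_real, Real.norm_eq_abs]
    norm_num
    linarith [abs_nonneg w]
  fin_cases i <;> fin_cases j
  · exact key _ _ h1 h2 _ (abs_sub _ _)
  · refine key _ _ h3 h4 _ ?_
    rw [abs_neg, add_comm |_|]
    exact abs_add_le _ _
  · refine key _ _ h3 h4 _ ?_
    rw [abs_neg, add_comm |_|]
    exact abs_sub _ _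
  · exact key _ _ h1 h2 _ (abs_add_le _ _)

theorem measurable_trigKernel_apply {Ψ : ℝ → ℂ} (hΨ : Measurable Ψ) (i j : Fin 2) :
    Measurable fun z : ℝ × ℝ => trigKernel z.1 z.2 Ψ i j := by
  have h1 : Measurable fun z : ℝ × ℝ => Ψ (z.1 - z.2) := hΨ.comp (measurable_fst.sub measurable_snd)
  have h2 : Measurable fun z : ℝ × ℝ => Ψ (z.1 + z.2) := hΨ.comp (measurable_fst.add measurable_snd)
  have r1 := Complex.measurable_re.comp h1
  have r2 := Complex.measurable_re.comp h2
  have i1 := Complex.measurable_im.comp h1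
  have i2 := Complex.measurable_im.comp h2
  fin_cases i <;> fin_cases j
  · exact (Complex.measurable_ofReal.comp (r1.sub r2)).const_mul _
  · exact (Complex.measurable_ofReal.comp (i2.add i1).neg).const_mul _
  · exact (Complex.measurable_ofReal.comp (i2.sub i1).neg).const_mul _
  · exact (Complex.measurable_ofReal.comp (r1.add r2)).const_mul _

theorem measurable_trigKernel_apply_right {Ψ : ℝ → ℂ} (hΨ : Measurable Ψ) (x : ℝ) (i j : Fin 2) :
    Measurable fun τ => trigKernel x τ Ψ i j := by
  have h := Measurable.comp (g := fun z : ℝ × ℝ => trigKernel z.1 z.2 Ψ i j) (f := Prod.mk x)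
    (measurable_trigKernel_apply hΨ i j) measurable_prodMk_left
  simpa only [Function.comp_def] using h

theorem eLpNorm_trigKernel_le {Ψ : ℝ → ℂ} (hΨ : Measurable Ψ) {x : ℝ} (hx : x ∈ Set.Icc 0 b)
    (i j : Fin 2) :
    eLpNorm (fun τ => trigKernel x τ Ψ i j) 2 (volume.restrict (Set.Ioo 0 b)) ≤
      2 * eLpNorm Ψ 2 (volume.restrict (Set.Ioc (-(2 * b)) (2 * b))) := by
  have key : ∀ φ : ℝ → ℝ, MeasurePreserving φ volume volume →
      (∀ τ ∈ Set.Ioo 0 b, φ τ ∈ Set.Ioc (-(2 * b)) (2 * b)) →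
      eLpNorm (fun τ => ‖Ψ (φ τ)‖) 2 (volume.restrict (Set.Ioo 0 b)) ≤
        eLpNorm Ψ 2 (volume.restrict (Set.Ioc (-(2 * b)) (2 * b))) := by
    intro φ hφ hsub
    rw [eLpNorm_norm]
    refine (eLpNorm_mono_measure _ (Measure.restrict_mono hsub le_rfl)).trans (le_of_eq ?_)
    exact eLpNorm_comp_measurePreserving hΨ.aestronglyMeasurable
      (hφ.restrict_preimage measurableSet_Ioc)
  have hm1 : MeasurePreserving (fun τ => x - τ) volume volume := by
    simpa only [sub_eq_add_neg, Function.comp_def] using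
      (measurePreserving_add_left volume x).comp (Measure.measurePreserving_neg (G := ℝ) volume)
  have hm2 : MeasurePreserving (fun τ => x + τ) volume volume := measurePreserving_add_left volume x
  have h1 := key _ hm1 fun τ hτ => ⟨by linarith [hx.1, hτ.2, hτ.1], by linarith [hx.2, hτ.1, hτ.2]⟩
  have h2 := key _ hm2 fun τ hτ => ⟨by linarith [hx.1, hτ.2, hτ.1], by linarith [hx.2, hτ.1, hτ.2]⟩
  rw [two_mul]
  refine le_trans ?_ ((eLpNorm_add_le ?_ ?_ one_le_two).trans (add_le_add h1 h2))
  · refine eLpNorm_mono fun τ => (norm_trigKernel_apply_le x τ Ψ i j).trans ?_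
    exact le_abs_self _
  · exact (hΨ.comp hm1.measurable).norm.aestronglyMeasurable
  · exact (hΨ.comp hm2.measurable).norm.aestronglyMeasurable

/-- Preimages under `μ` enlarge Lebesgue measure at most by a factor. -/
theorem volume_preimage_mu_le (hα : 0 < α) (s : Set ℝ) :
    volume (mu a α ⁻¹' s) ≤ (1 + ENNReal.ofReal α⁻¹) * volume s := by
  have h1 : mu a α ⁻¹' s ⊆ s ∪ (fun x => α * x) ⁻¹' ((fun x => x + (a - α * a)) ⁻¹' s) := by
    intro x hx
    simp only [Set.mem_preimage, mu] at hx
    split_ifs at hx with h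
    · exact Or.inl hx
    · refine Or.inr ?_
      simp only [Set.mem_preimage]
      convert hx using 1
      ring
  refine (measure_mono h1).trans ((measure_union_le _ _).trans ?_)
  rw [Real.volume_preimage_mul_left hα.ne', measure_preimage_add_right,
    abs_of_pos (inv_pos.2 hα), add_mul, one_mul]

theorem map_mu_restrict_le (ha : 0 < a) (hα : 0 < α) (x : ℝ) :
    (volume.restrict (Set.Ioo 0 x)).map (mu a α) ≤
      (1 + ENNReal.ofReal α⁻¹) • volume.restrict (Set.Ioo 0 (mu a α x)) := by
  refine Measure.le_iff.2 fun s hs => ?_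
  have hm := (continuous_mu (a := a) (α := α)).measurable
  rw [Measure.map_apply hm hs, Measure.restrict_apply (hm hs), Measure.smul_apply,
    Measure.restrict_apply hs, smul_eq_mul]
  refine (measure_mono ?_).trans (volume_preimage_mu_le (a := a) hα _)
  rintro t ⟨h1, h2⟩
  have hmono := strictMono_mu (a := a) hα
  refine ⟨h1, ?_, hmono h2.2⟩
  rw [← mu_zero (α := α) ha]
  exact hmono h2.1

/-- The substitution `τ = μ(t)` is bounded in `L₂`. -/
theorem eLpNorm_comp_mu_le (ha : 0 < a) (hα : 0 < α) {f : ℝ → ℂ} (hf : Measurable f) (x : ℝ) :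
    eLpNorm (fun t => f (mu a α t)) 2 (volume.restrict (Set.Ioo 0 x)) ≤
      (1 + ENNReal.ofReal α⁻¹) ^ (1 / 2 : ENNReal).toReal *
        eLpNorm f 2 (volume.restrict (Set.Ioo 0 (mu a α x))) := by
  have hm := (continuous_mu (a := a) (α := α)).measurable
  have h1 := eLpNorm_map_measure (p := 2) (μ := volume.restrict (Set.Ioo 0 x))
    hf.aestronglyMeasurable hm.aemeasurable
  refine (le_of_eq h1.symm).trans ((eLpNorm_mono_measure f (map_mu_restrict_le ha hα x)).trans ?_)
  rw [eLpNorm_smul_measure_of_ne_top (by norm_num), smul_eq_mul]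

/-- The matrix series is the image of the scalar exponential series under the linear map
`trigKernel x (μ t)`. -/
theorem dataPartialSum_eq_trigKernel (lam nrm : ℤ → ℝ) (N : ℕ) (x t : ℝ) :
    dataPartialSum a α lam nrm N x t = trigKernel x (mu a α t)
      (∑ n ∈ Finset.Icc (-(N : ℤ)) N, expTerm (mu a α Real.pi) lam nrm n) := by
  have h1 : ∀ n, expTerm (mu a α Real.pi) lam nrm n =
      (1 / nrm n : ℝ) • (fun y => cis (lam n * y)) -
        (1 / mu a α Real.pi : ℝ) • fun y => cis (lamZero a α n * y) := by
    intro n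
    funext y
    simp only [expTerm, lamZero, Pi.sub_apply, Pi.smul_apply, Complex.real_smul]
  rw [dataPartialSum, map_sum]
  refine Finset.sum_congr rfl fun n _ => ?_
  rw [h1, map_sub, map_smul, map_smul, trigKernel_cis, trigKernel_cis]
  rfl

/-- The partial sums of the series for the kernel, with an additional term at the frequency `l`
with weight `c`. -/
noncomputable def extendedPartialSum (a α : ℝ) (lam nrm : ℤ → ℝ) (c l : ℝ) (N : ℕ) (x t : ℝ) :
    Matrix (Fin 2) (Fin 2) ℂ :=
  (c : ℂ) • Matrix.vecMulVec (trigVec l x) (phiZero a α l t) + dataPartialSum a α lam nrm N x t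

/-- The kernel has the form `R(x, μ(t))`, and the partial sums converge to it in `L₂(0, π)`
uniformly in `x`. -/
theorem exists_kernel (ha : 0 < a) (hα : 0 < α) {lam nrm : ℤ → ℝ}
    (hpos : ∀ n, 0 < nrm n) (hs : Summable fun n : ℤ => (lam n - lamZero a α n) ^ 2)
    (hw : Summable fun n => (nrm n - mu a α Real.pi) ^ 2) (c l : ℝ) :
    ∃ R : ℝ → ℝ → Matrix (Fin 2) (Fin 2) ℂ,
      (∀ i j, Measurable fun z : ℝ × ℝ => R z.1 z.2 i j) ∧
      (∀ x ∈ Set.Icc 0 (mu a α Real.pi), ∀ i j,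
        MemLp (fun τ => R x τ i j) 2 (volume.restrict (Set.Ioo 0 (mu a α Real.pi)))) ∧
      ∃ ε : ℕ → ENNReal, Tendsto ε atTop (𝓝 0) ∧ ∀ N,
        ∀ x ∈ Set.Icc 0 (mu a α Real.pi), ∀ i j,
          eLpNorm (fun t => extendedPartialSum a α lam nrm c l N x t i j - R x (mu a α t) i j) 2
            (volume.restrict (Set.Ioo 0 Real.pi)) ≤ ε N := by
  have hb := mu_pi_pos (α := α) ha hα
  obtain ⟨Φ, hΦm, hΦL, hΦ⟩ := exists_expSeries_limit hb hpos hs hw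
  set b := mu a α Real.pi with hbdef
  have htv : ∀ k, Measurable fun y : ℝ => trigVec l y k := fun k =>
    (continuous_trigVec l k).measurable
  have hRm : ∀ i j, Measurable fun z : ℝ × ℝ => ((c : ℂ) • Matrix.vecMulVec (trigVec l z.1)
      (trigVec l z.2) + trigKernel z.1 z.2 Φ) i j := fun i j =>
    ((((htv i).comp measurable_fst).mul ((htv j).comp measurable_snd)).const_mul (c : ℂ)).add
      (measurable_trigKernel_apply hΦm i j)
  refine ⟨fun x τ => (c : ℂ) • Matrix.vecMulVec (trigVec l x) (trigVec l τ) + trigKernel x τ Φ,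
    hRm, fun x hx i j => ?_, fun N => (1 + ENNReal.ofReal α⁻¹) ^ (1 / 2 : ENNReal).toReal *
      (2 * eLpNorm (fun y => (∑ n ∈ Finset.Icc (-(N : ℤ)) N, expTerm b lam nrm n y) - Φ y) 2
        (volume.restrict (Set.Ioc (-(2 * b)) (2 * b)))), ?_, ?_⟩
  · have h1 : MemLp (fun τ => trigKernel x τ Φ i j) 2 (volume.restrict (Set.Ioo 0 b)) := by
      refine ⟨(measurable_trigKernel_apply_right hΦm x i j).aestronglyMeasurable, ?_⟩
      exact (eLpNorm_trigKernel_le hΦm hx i j).trans_lt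
        (ENNReal.mul_lt_top (by norm_num) hΦL.2)
    exact (((memLp_trigVec b l j).const_mul (trigVec l x i)).const_mul (c : ℂ)).add h1
  · have h1 := ENNReal.Tendsto.const_mul (a := 2) hΦ (Or.inr (by norm_num))
    have h2 := ENNReal.Tendsto.const_mul (a := (1 + ENNReal.ofReal α⁻¹) ^ (1 / 2 : ENNReal).toReal)
      h1 (Or.inr (by
        refine ENNReal.rpow_ne_top_of_nonneg ENNReal.toReal_nonneg ?_
        exact ENNReal.add_ne_top.2 ⟨ENNReal.one_ne_top, ENNReal.ofReal_ne_top⟩))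
    simpa using h2
  · intro N x hx i j
    set Ψ : ℝ → ℂ := fun y => (∑ n ∈ Finset.Icc (-(N : ℤ)) N, expTerm b lam nrm n y) - Φ y with hΨ
    have hΨm : Measurable Ψ := (Finset.measurable_fun_sum _ fun n _ =>
      (continuous_expTerm lam nrm n).measurable).sub hΦm
    have h1 : ∀ t, extendedPartialSum a α lam nrm c l N x t i j -
        ((c : ℂ) • Matrix.vecMulVec (trigVec l x) (trigVec l (mu a α t)) +
          trigKernel x (mu a α t) Φ) i j =
        trigKernel x (mu a α t) Ψ i j := by
      intro t
      have h2 : Ψ = (∑ n ∈ Finset.Icc (-(N : ℤ)) N, expTerm b lam nrm n) - Φ := by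
        funext y
        simp [hΨ]
      rw [extendedPartialSum, dataPartialSum_eq_trigKernel, h2, map_sub, phiZero, Matrix.sub_apply,
        Matrix.add_apply, Matrix.add_apply]
      ring
    simp only [h1]
    have h2 := eLpNorm_comp_mu_le (a := a) (α := α) ha hα
      (measurable_trigKernel_apply_right hΨm x i j) Real.pi
    refine h2.trans ?_
    exact mul_le_mul_right (eLpNorm_trigKernel_le hΨm hx i j) _

end Kernel

/-! ### The main equation as an equation for rows -/

section Equation

variable {a α X : ℝ}

/-- A bound on a kernel in `L₂` of the second variable, uniform in the first, bounds the `L₁` norm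
of its integral against an integrable function. -/
theorem lintegral_lintegral_mul_le {μ ν : Measure ℝ} [SFinite μ] [SFinite ν]
    {u : ℝ → ℂ} (hu : Measurable u) {D : ℝ → ℝ → ℂ} (hD : Measurable fun z : ℝ × ℝ => D z.1 z.2)
    {e : ENNReal} (he : ∀ᵐ ξ ∂μ, eLpNorm (D ξ) 2 ν ≤ e) :
    ∫⁻ t, ∫⁻ ξ, ‖u ξ * D ξ t‖ₑ ∂μ ∂ν ≤
      (∫⁻ ξ, ‖u ξ‖ₑ ∂μ) * (e * ν Set.univ ^ (1 / 2 : ℝ)) := by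
  have hm : Measurable fun z : ℝ × ℝ => ‖u z.2 * D z.2 z.1‖ₑ :=
    ((hu.comp measurable_snd).mul (hD.comp measurable_swap)).enorm
  rw [lintegral_lintegral_swap hm.aemeasurable, ← lintegral_mul_const _ hu.enorm]
  refine lintegral_mono_ae ?_
  filter_upwards [he] with ξ hξ
  have hDξ : Measurable (D ξ) := by
    have := Measurable.comp (g := fun z : ℝ × ℝ => D z.1 z.2) (f := Prod.mk ξ) hD
      measurable_prodMk_left
    simpa only [Function.comp_def] using this
  simp only [enorm_mul]
  rw [lintegral_const_mul _ hDξ.enorm, ← eLpNorm_one_eq_lintegral_enorm]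
  have h1 := eLpNorm_le_eLpNorm_mul_rpow_measure_univ (μ := ν) (p := 1) (q := 2) one_le_two
    hDξ.aestronglyMeasurable
  have h2 : (1 / (1 : ENNReal).toReal - 1 / (2 : ENNReal).toReal : ℝ) = 1 / 2 := by norm_num
  rw [h2] at h1
  exact mul_le_mul_right (h1.trans (mul_le_mul_left hξ _)) _

/-- Integration against square integrable kernels that converge in `L₂` in the second variable,
uniformly in the first. -/
theorem tendstoInMeasure_integral_mul {μ ν : Measure ℝ} [SFinite μ] [IsFiniteMeasure ν]
    {u : Fin 2 → ℝ → ℂ} (hu : ∀ k, Measurable (u k)) (hui : ∀ k, Integrable (u k) μ)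
    {P : ℕ → ℝ → ℝ → Fin 2 → ℂ} {F : ℝ → ℝ → Fin 2 → ℂ}
    (hP : ∀ N k, Measurable fun z : ℝ × ℝ => P N z.1 z.2 k)
    (hF : ∀ k, Measurable fun z : ℝ × ℝ => F z.1 z.2 k)
    (hPi : ∀ N t, Integrable (fun ξ => ∑ k, u k ξ * P N ξ t k) μ)
    {ε : ℕ → ENNReal} (hε : Tendsto ε atTop (𝓝 0))
    (h : ∀ N k, ∀ᵐ ξ ∂μ, eLpNorm (fun t => P N ξ t k - F ξ t k) 2 ν ≤ ε N) :
    TendstoInMeasure ν (fun N t => ∫ ξ, ∑ k, u k ξ * P N ξ t k ∂μ) atTop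
      (fun t => ∫ ξ, ∑ k, u k ξ * F ξ t k ∂μ) := by
  set V := ν Set.univ ^ (1 / 2 : ℝ) with hV
  set A := ∑ k, ∫⁻ ξ, ‖u k ξ‖ₑ ∂μ with hA
  have hA' : A ≠ ⊤ := ENNReal.sum_ne_top.2 fun k _ => (hui k).2.ne
  have hV' : V ≠ ⊤ := ENNReal.rpow_ne_top_of_nonneg (by norm_num) (measure_ne_top _ _)
  have hB : Tendsto (fun N => A * (ε N * V)) atTop (𝓝 0) := by
    have := ENNReal.Tendsto.const_mul (a := A) (ENNReal.Tendsto.mul_const (b := V) hε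
      (Or.inr hV')) (Or.inr hA')
    simpa using this
  have hmeas : ∀ G : ℝ → ℝ → Fin 2 → ℂ, (∀ k, Measurable fun z : ℝ × ℝ => G z.1 z.2 k) →
      StronglyMeasurable fun t => ∫ ξ, ∑ k, u k ξ * G ξ t k ∂μ := by
    intro G hG
    refine StronglyMeasurable.integral_prod_left (f := fun ξ t => ∑ k, u k ξ * G ξ t k) ?_
    exact (Finset.measurable_fun_sum _ fun k _ =>
      ((hu k).comp measurable_fst).mul (hG k)).stronglyMeasurable
  refine tendstoInMeasure_of_tendsto_eLpNorm one_ne_zero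
    (fun N => (hmeas _ (hP N)).aestronglyMeasurable) (hmeas _ hF).aestronglyMeasurable ?_
  refine tendsto_of_tendsto_of_tendsto_of_le_of_le tendsto_const_nhds hB
    (fun _ => zero_le) fun N => ?_
  by_cases htop : A * (ε N * V) = ⊤
  · simp only [htop, le_top]
  have hDm : ∀ k, Measurable fun z : ℝ × ℝ => P N z.1 z.2 k - F z.1 z.2 k := fun k =>
    (hP N k).sub (hF k)
  have hIk : ∀ k, Measurable fun t => ∫⁻ ξ, ‖u k ξ * (P N ξ t k - F ξ t k)‖ₑ ∂μ := fun k =>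
    Measurable.lintegral_prod_right' (f := fun z : ℝ × ℝ =>
      ‖u k z.2 * (P N z.2 z.1 k - F z.2 z.1 k)‖ₑ)
      (((hu k).comp measurable_snd).mul ((hDm k).comp measurable_swap)).enorm
  have hle : ∫⁻ t, ∑ k, ∫⁻ ξ, ‖u k ξ * (P N ξ t k - F ξ t k)‖ₑ ∂μ ∂ν ≤ A * (ε N * V) := by
    rw [lintegral_finsetSum _ fun k _ => hIk k, hA, Finset.sum_mul]
    exact Finset.sum_le_sum fun k _ => lintegral_lintegral_mul_le (hu k) (hDm k) (h N k)
  have hfin := ae_lt_top (Finset.measurable_fun_sum _ fun k _ => hIk k)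
    (ne_top_of_le_ne_top htop hle)
  rw [eLpNorm_one_eq_lintegral_enorm]
  refine (lintegral_mono_ae ?_).trans hle
  filter_upwards [hfin] with t ht
  have hDi : ∀ k, Integrable (fun ξ => u k ξ * (P N ξ t k - F ξ t k)) μ := by
    intro k
    refine ⟨?_, (ENNReal.sum_lt_top.1 ht) k (Finset.mem_univ k)⟩
    have := Measurable.comp (g := fun z : ℝ × ℝ => P N z.1 z.2 k - F z.1 z.2 k)
      (f := fun ξ => (ξ, t)) (hDm k) measurable_prodMk_right
    exact ((hu k).mul this).aestronglyMeasurable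
  have e1 : ∀ ξ, ∑ k, u k ξ * F ξ t k =
      (∑ k, u k ξ * P N ξ t k) - ∑ k, u k ξ * (P N ξ t k - F ξ t k) := by
    intro ξ
    rw [← Finset.sum_sub_distrib]
    exact Finset.sum_congr rfl fun k _ => by ring
  have hDs : Integrable (fun ξ => ∑ k, u k ξ * (P N ξ t k - F ξ t k)) μ :=
    integrable_finsetSum _ fun k _ => hDi k
  rw [Pi.sub_apply]
  simp only [e1]
  rw [integral_sub (hPi N t) hDs, sub_sub_cancel, integral_finsetSum _ fun k _ => hDi k]
  refine (enorm_sum_le _ _).trans (Finset.sum_le_sum fun k _ => ?_)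
  exact enorm_integral_le_lintegral_enorm _

/-- Every term of the partial sums is of rank one, so a row times a partial sum is a combination of
scalar products of that row with `s(ξ, λ)`. -/
theorem sum_mul_extendedPartialSum (lam nrm : ℤ → ℝ) (c l : ℝ) (N : ℕ) (v : Fin 2 → ℂ)
    (ξ t : ℝ) (j : Fin 2) :
    ∑ k, v k * extendedPartialSum a α lam nrm c l N ξ t k j =
      c * trigVec l (mu a α t) j * (∑ k, trigVec l ξ k * v k) +
      ∑ n ∈ Finset.Icc (-(N : ℤ)) N,
        (((1 / nrm n : ℝ) : ℂ) * trigVec (lam n) (mu a α t) j * (∑ k, trigVec (lam n) ξ k * v k) -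
        ((1 / mu a α Real.pi : ℝ) : ℂ) * trigVec (lamZero a α n) (mu a α t) j *
          (∑ k, trigVec (lamZero a α n) ξ k * v k)) := by
  have h1 : ∀ k, v k * extendedPartialSum a α lam nrm c l N ξ t k j =
      c * trigVec l (mu a α t) j * (trigVec l ξ k * v k) +
      ∑ n ∈ Finset.Icc (-(N : ℤ)) N,
        (((1 / nrm n : ℝ) : ℂ) * trigVec (lam n) (mu a α t) j * (trigVec (lam n) ξ k * v k) -
        ((1 / mu a α Real.pi : ℝ) : ℂ) * trigVec (lamZero a α n) (mu a α t) j *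
          (trigVec (lamZero a α n) ξ k * v k)) := by
    intro k
    rw [extendedPartialSum, dataPartialSum, Matrix.add_apply, Matrix.sum_apply, mul_add,
      Finset.mul_sum]
    congr 1
    · simp only [Matrix.smul_apply, Matrix.vecMulVec_apply, phiZero, smul_eq_mul]
      ring
    · refine Finset.sum_congr rfl fun n _ => ?_
      simp only [kernelTerm, Matrix.sub_apply, Matrix.smul_apply, Matrix.vecMulVec_apply, phiZero,
        smul_eq_mul]
      ring
  rw [Finset.sum_congr rfl fun k _ => h1 k, Finset.sum_add_distrib, ← Finset.mul_sum,
    Finset.sum_comm]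
  congr 1
  refine Finset.sum_congr rfl fun n _ => ?_
  rw [Finset.sum_sub_distrib, ← Finset.mul_sum, ← Finset.mul_sum]

/-- The `j`-th entry at `τ` of the partial sums of the series that represents the integral operator
on a row. -/
noncomputable def rowPartialSum (a α : ℝ) (lam nrm : ℤ → ℝ) (c l : ℝ) (v : RowSpace X) (j : Fin 2)
    (N : ℕ) (τ : ℝ) : ℂ :=
  c * trigVec l τ j * inner ℂ (trigRow X l) v +
    ∑ n ∈ Finset.Icc (-(N : ℤ)) N,
      (((1 / nrm n : ℝ) : ℂ) * trigVec (lam n) τ j * inner ℂ (trigRow X (lam n)) v -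
      ((1 / mu a α Real.pi : ℝ) : ℂ) * trigVec (lamZero a α n) τ j *
        inner ℂ (trigRow X (lamZero a α n)) v)

theorem continuous_rowPartialSum (lam nrm : ℤ → ℝ) (c l : ℝ) (v : RowSpace X) (j : Fin 2)
    (N : ℕ) : Continuous (rowPartialSum a α lam nrm c l v j N) := by
  unfold rowPartialSum
  have h := fun l : ℝ => continuous_trigVec l j
  fun_prop

theorem integrable_sum_trigVec_mul (l : ℝ) (v : RowSpace X) :
    Integrable (fun ξ => ∑ k, trigVec l ξ k * v k ξ) (volume.restrict (Set.Ioo 0 X)) :=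
  integrable_finsetSum _ fun k _ => integrable_trigVec_mul l v k

theorem integrable_sum_mul_extendedPartialSum (lam nrm : ℤ → ℝ) (c l : ℝ) (N : ℕ)
    (v : RowSpace X) (t : ℝ) (j : Fin 2) :
    Integrable (fun ξ => ∑ k, v k ξ * extendedPartialSum a α lam nrm c l N ξ t k j)
      (volume.restrict (Set.Ioo 0 X)) := by
  simp only [sum_mul_extendedPartialSum]
  exact ((integrable_sum_trigVec_mul l v).const_mul _).add (integrable_finsetSum _ fun n _ =>
    ((integrable_sum_trigVec_mul _ v).const_mul _).sub
      ((integrable_sum_trigVec_mul _ v).const_mul _))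

theorem integral_sum_mul_extendedPartialSum (lam nrm : ℤ → ℝ) (c l : ℝ) (N : ℕ)
    (v : RowSpace X) (t : ℝ) (j : Fin 2) :
    ∫ ξ in Set.Ioo 0 X, ∑ k, v k ξ * extendedPartialSum a α lam nrm c l N ξ t k j =
      rowPartialSum a α lam nrm c l v j N (mu a α t) := by
  have hi : ∀ n : ℤ, Integrable (fun ξ =>
      ((1 / nrm n : ℝ) : ℂ) * trigVec (lam n) (mu a α t) j *
        (∑ k, trigVec (lam n) ξ k * v k ξ) -
      ((1 / mu a α Real.pi : ℝ) : ℂ) * trigVec (lamZero a α n) (mu a α t) j *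
        (∑ k, trigVec (lamZero a α n) ξ k * v k ξ)) (volume.restrict (Set.Ioo 0 X)) := fun n =>
    ((integrable_sum_trigVec_mul _ v).const_mul _).sub
      ((integrable_sum_trigVec_mul _ v).const_mul _)
  simp only [sum_mul_extendedPartialSum]
  rw [integral_add ((integrable_sum_trigVec_mul l v).const_mul _)
    (integrable_finsetSum _ fun n _ => hi n), integral_finsetSum _ fun n _ => hi n,
    integral_const_mul, ← inner_trigRow, rowPartialSum]
  congr 1
  refine Finset.sum_congr rfl fun n _ => ?_
  rw [integral_sub ((integrable_sum_trigVec_mul _ v).const_mul _)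
    ((integrable_sum_trigVec_mul _ v).const_mul _), integral_const_mul, integral_const_mul,
    ← inner_trigRow, ← inner_trigRow]

theorem coeFn_smul_trigRow (w z : ℂ) (l : ℝ) (j : Fin 2) :
    ((w • z • trigRow X l : RowSpace X) j : ℝ → ℂ) =ᵐ[volume.restrict (Set.Ioo 0 X)]
      fun τ => w * trigVec l τ j * z := by
  rw [smul_smul, PiLp.smul_apply]
  filter_upwards [Lp.coeFn_smul (w * z) (trigRow X l j), coeFn_trigRow X l j] with τ h1 h2
  rw [h1, Pi.smul_apply, h2, smul_eq_mul]
  ring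

/-- The entries of a convergent series in the space of rows converge in `L₂`. -/
theorem tendsto_rowPartialSum {lam nrm : ℤ → ℝ} {c l : ℝ} {v w : RowSpace X}
    (h : HasSum (fun n : ℤ =>
      ((1 / nrm n : ℝ) : ℂ) • inner ℂ (trigRow X (lam n)) v • trigRow X (lam n) -
        ((1 / mu a α Real.pi : ℝ) : ℂ) • inner ℂ (trigRow X (lamZero a α n)) v •
          trigRow X (lamZero a α n))
      (w - (c : ℂ) • inner ℂ (trigRow X l) v • trigRow X l)) (j : Fin 2) :
    Tendsto (fun N => eLpNorm (fun τ => rowPartialSum a α lam nrm c l v j N τ - w j τ) 2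
      (volume.restrict (Set.Ioo 0 X))) atTop (𝓝 0) := by
  set T : ℤ → RowSpace X := fun n =>
    ((1 / nrm n : ℝ) : ℂ) • inner ℂ (trigRow X (lam n)) v • trigRow X (lam n) -
      ((1 / mu a α Real.pi : ℝ) : ℂ) • inner ℂ (trigRow X (lamZero a α n)) v •
        trigRow X (lamZero a α n) with hT
  have h1 : HasSum (fun n => T n j)
      ((w - (c : ℂ) • inner ℂ (trigRow X l) v • trigRow X l) j) :=
    (PiLp.proj (𝕜 := ℂ) 2 (fun _ : Fin 2 => Lp ℂ 2 (volume.restrict (Set.Ioo 0 X))) j).hasSum h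
  have h2 := (Lp.tendsto_Lp_iff_tendsto_eLpNorm' _ _).1 (h1.comp tendsto_Icc_neg_atTop)
  refine h2.congr fun N => eLpNorm_congr_ae ?_
  have hterm : ∀ᵐ τ ∂(volume.restrict (Set.Ioo 0 X)), ∀ n : ℤ, T n j τ =
      ((1 / nrm n : ℝ) : ℂ) * trigVec (lam n) τ j * inner ℂ (trigRow X (lam n)) v -
      ((1 / mu a α Real.pi : ℝ) : ℂ) * trigVec (lamZero a α n) τ j *
        inner ℂ (trigRow X (lamZero a α n)) v := by
    refine ae_all_iff.2 fun n => ?_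
    rw [hT]
    filter_upwards [Lp.coeFn_sub (((((1 / nrm n : ℝ) : ℂ) • inner ℂ (trigRow X (lam n)) v •
        trigRow X (lam n) : RowSpace X)) j) ((((1 / mu a α Real.pi : ℝ) : ℂ) •
        inner ℂ (trigRow X (lamZero a α n)) v • trigRow X (lamZero a α n) : RowSpace X) j),
      coeFn_smul_trigRow ((1 / nrm n : ℝ) : ℂ) (inner ℂ (trigRow X (lam n)) v) (lam n) j,
      coeFn_smul_trigRow ((1 / mu a α Real.pi : ℝ) : ℂ)
        (inner ℂ (trigRow X (lamZero a α n)) v) (lamZero a α n) j] with τ h3 h4 h5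
    rw [PiLp.sub_apply, h3, Pi.sub_apply, h4, h5]
  filter_upwards [hterm, Lp.coeFn_fun_finsetSum (Finset.Icc (-(N : ℤ)) N) fun n => T n j,
    Lp.coeFn_sub (w j) (((c : ℂ) • inner ℂ (trigRow X l) v • trigRow X l : RowSpace X) j),
    coeFn_smul_trigRow (c : ℂ) (inner ℂ (trigRow X l) v) l j] with τ h3 h4 h5 h6
  simp only [Function.comp_apply, Pi.sub_apply]
  rw [h4, PiLp.sub_apply, h5, Pi.sub_apply, h6, Finset.sum_congr rfl fun n _ => h3 n,
    rowPartialSum]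
  ring

theorem mu_mu_inv (hα : 0 < α) (τ : ℝ) : mu a α (mu a α⁻¹ τ) = τ := by
  by_cases h : τ ≤ a
  · simp only [mu, if_pos h]
  · have h1 : 0 < α⁻¹ * (τ - a) := mul_pos (inv_pos.2 hα) (sub_pos.2 (not_le.1 h))
    have h2 : ¬ (α⁻¹ * τ - α⁻¹ * a + a ≤ a) := by
      rw [not_le]
      linarith [mul_sub α⁻¹ τ a]
    simp only [mu, if_neg h, if_neg h2]
    field_simp
    ring

/-- `μ` and its inverse preserve null sets. -/
theorem ae_comp_mu_iff (ha : 0 < a) (hα : 0 < α) (x : ℝ) {p : ℝ → Prop} :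
    (∀ᵐ t ∂(volume.restrict (Set.Ioo 0 x)), p (mu a α t)) ↔
      ∀ᵐ τ ∂(volume.restrict (Set.Ioo 0 (mu a α x))), p τ := by
  have hmono := strictMono_mu (a := a) hα
  have h0 := mu_zero (α := α) ha
  have hnull : ∀ β : ℝ, 0 < β → ∀ s : Set ℝ, volume s = 0 → volume (mu a β ⁻¹' s) = 0 :=
    fun β hβ s hs => le_antisymm ((volume_preimage_mu_le hβ s).trans (by rw [hs, mul_zero]))
      zero_le
  rw [ae_restrict_iff' measurableSet_Ioo, ae_restrict_iff' measurableSet_Ioo, ae_iff, ae_iff]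
  constructor <;> intro h
  · refine measure_mono_null ?_ (hnull α⁻¹ (inv_pos.2 hα) _ h)
    intro τ hτ
    simp only [Set.mem_ofPred_eq, Set.mem_preimage, Classical.not_imp, mu_mu_inv hα] at hτ ⊢
    refine ⟨⟨hmono.lt_iff_lt.1 ?_, hmono.lt_iff_lt.1 ?_⟩, hτ.2⟩
    · rw [h0, mu_mu_inv hα]
      exact hτ.1.1
    · rw [mu_mu_inv hα]
      exact hτ.1.2
  · refine measure_mono_null ?_ (hnull α hα _ h)
    intro t ht
    simp only [Set.mem_ofPred_eq, Set.mem_preimage, Classical.not_imp] at ht ⊢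
    exact ⟨⟨h0 ▸ hmono ht.1.1, hmono ht.1.2⟩, ht.2⟩

end Equation

/-! ### Unique solvability of the main equation -/

section Solvability

variable {a α X c l : ℝ} {lam nrm : ℤ → ℝ} {F₀ R : ℝ → ℝ → Matrix (Fin 2) (Fin 2) ℂ}
  {ε : ℕ → ENNReal}

theorem continuous_extendedPartialSum (N : ℕ) (i j : Fin 2) :
    Continuous fun z : ℝ × ℝ => extendedPartialSum a α lam nrm c l N z.1 z.2 i j := by
  have h1 : ∀ l : ℂ, ∀ k, Continuous fun z : ℝ × ℝ => trigVec l z.1 k := fun l k =>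
    (continuous_trigVec l k).comp continuous_fst
  have h2 : ∀ l : ℂ, ∀ k, Continuous fun z : ℝ × ℝ => trigVec l (mu a α z.2) k := fun l k =>
    (continuous_trigVec l k).comp (continuous_mu.comp continuous_snd)
  have h3 : ∀ l : ℂ, Continuous fun z : ℝ × ℝ =>
      Matrix.vecMulVec (trigVec l z.1) (phiZero a α l z.2) i j := fun l =>
    (h1 l i).mul (h2 l j)
  have h4 : ∀ l : ℂ, ∀ w : ℝ, Continuous fun z : ℝ × ℝ => kernelTerm a α l w z.1 z.2 i j :=
    fun l w => continuous_const.mul (h3 l)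
  simp only [extendedPartialSum, dataPartialSum, Matrix.add_apply, Matrix.sum_apply,
    Matrix.sub_apply]
  exact (continuous_const.mul (h3 l)).add (continuous_finsetSum _ fun n _ => (h4 _ _).sub (h4 _ _))

/-- Any two kernels agree, so every kernel has the form `R(x, μ(t))`. -/
theorem IsKernel.ae_eq (hF : IsKernel a α (extendedPartialSum a α lam nrm c l) F₀)
    (hRm : ∀ i j, Measurable fun z : ℝ × ℝ => R z.1 z.2 i j) (hε : Tendsto ε atTop (𝓝 0))
    (hR : ∀ N, ∀ x ∈ Set.Icc 0 (mu a α Real.pi), ∀ i j,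
      eLpNorm (fun t => extendedPartialSum a α lam nrm c l N x t i j - R x (mu a α t) i j) 2
        (volume.restrict (Set.Ioo 0 Real.pi)) ≤ ε N)
    {x : ℝ} (hx : x ∈ Set.Icc 0 (mu a α Real.pi)) (i j : Fin 2) :
    ∀ᵐ t ∂(volume.restrict (Set.Ioo 0 Real.pi)), F₀ x t i j = R x (mu a α t) i j := by
  have hSm : ∀ N, Measurable fun t => extendedPartialSum a α lam nrm c l N x t i j := fun N =>
    ((continuous_extendedPartialSum N i j).comp (Continuous.prodMk_right x)).measurable
  have hFm : Measurable fun t => F₀ x t i j := by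
    have := Measurable.comp (g := fun z : ℝ × ℝ => F₀ z.1 z.2 i j) (f := Prod.mk x) (hF.1 i j)
      measurable_prodMk_left
    simpa only [Function.comp_def] using this
  have hRm' : Measurable fun t => R x (mu a α t) i j := by
    have := Measurable.comp (g := fun z : ℝ × ℝ => R z.1 z.2 i j) (f := fun t => (x, mu a α t))
      (hRm i j) (measurable_const.prodMk continuous_mu.measurable)
    simpa only [Function.comp_def] using this
  exact tendstoInMeasure_ae_unique
    (tendstoInMeasure_of_tendsto_eLpNorm two_ne_zero (fun N => (hSm N).aestronglyMeasurable)
      hFm.aestronglyMeasurable (hF.2 x hx i j))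
    (tendstoInMeasure_of_tendsto_eLpNorm two_ne_zero (fun N => (hSm N).aestronglyMeasurable)
      hRm'.aestronglyMeasurable (tendsto_of_tendsto_of_tendsto_of_le_of_le tendsto_const_nhds hε
        (fun _ => zero_le) fun N => hR N x hx i j))

/-- The integral in the main equation is the operator given by the series for the kernel. -/
theorem ae_integral_sum_mul_eq (ha : 0 < a) (hα : 0 < α)
    (hF : IsKernel a α (extendedPartialSum a α lam nrm c l) F₀)
    (hRm : ∀ i j, Measurable fun z : ℝ × ℝ => R z.1 z.2 i j) (hε : Tendsto ε atTop (𝓝 0))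
    (hR : ∀ N, ∀ x ∈ Set.Icc 0 (mu a α Real.pi), ∀ i j,
      eLpNorm (fun t => extendedPartialSum a α lam nrm c l N x t i j - R x (mu a α t) i j) 2
        (volume.restrict (Set.Ioo 0 Real.pi)) ≤ ε N)
    {x : ℝ} (hx : x ∈ Set.Ioc 0 Real.pi) {v w : RowSpace (mu a α x)}
    (h : HasSum (fun n : ℤ =>
      ((1 / nrm n : ℝ) : ℂ) • inner ℂ (trigRow (mu a α x) (lam n)) v • trigRow _ (lam n) -
        ((1 / mu a α Real.pi : ℝ) : ℂ) • inner ℂ (trigRow (mu a α x) (lamZero a α n)) v •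
          trigRow _ (lamZero a α n))
      (w - (c : ℂ) • inner ℂ (trigRow (mu a α x) l) v • trigRow _ l)) (j : Fin 2) :
    ∀ᵐ t ∂(volume.restrict (Set.Ioo 0 x)),
      ∫ ξ in (0 : ℝ)..(mu a α x), ∑ k, v k ξ * F₀ ξ t k j = w j (mu a α t) := by
  have hmono := (strictMono_mu (a := a) hα).monotone
  have hX : 0 < mu a α x := by
    rw [← mu_zero (α := α) ha]
    exact strictMono_mu hα hx.1
  have hsub : Set.Ioo 0 x ⊆ Set.Ioo 0 Real.pi := Set.Ioo_subset_Ioo_right hx.2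
  -- The integrals of the partial sums converge in measure both to the integral against `F₀` and
  -- to the value of the operator.
  have h1 : TendstoInMeasure (volume.restrict (Set.Ioo 0 x))
      (fun N t => ∫ ξ in Set.Ioo 0 (mu a α x), ∑ k, v k ξ *
        extendedPartialSum a α lam nrm c l N ξ t k j) atTop
      (fun t => ∫ ξ in Set.Ioo 0 (mu a α x), ∑ k, v k ξ * F₀ ξ t k j) := by
    refine tendstoInMeasure_integral_mul (u := fun k => v k)
      (P := fun N ξ t k => extendedPartialSum a α lam nrm c l N ξ t k j)
      (F := fun ξ t k => F₀ ξ t k j)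
      (fun k => (Lp.stronglyMeasurable (v k)).measurable)
      (fun k => (Lp.memLp (v k)).integrable one_le_two)
      (fun N k => (continuous_extendedPartialSum N k j).measurable)
      (fun k => hF.1 k j) (fun N t => integrable_sum_mul_extendedPartialSum _ _ _ _ _ v t j)
      hε fun N k => ?_
    filter_upwards [ae_restrict_mem measurableSet_Ioo] with ξ hξ
    have hξ' : ξ ∈ Set.Icc 0 (mu a α Real.pi) := ⟨hξ.1.le, hξ.2.le.trans (hmono hx.2)⟩
    refine le_trans (eLpNorm_mono_measure _ (Measure.restrict_mono hsub le_rfl)) ?_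
    refine le_trans (le_of_eq (eLpNorm_congr_ae ?_)) (hR N ξ hξ' k j)
    filter_upwards [hF.ae_eq hRm hε hR hξ' k j] with t ht
    rw [ht]
  simp only [integral_sum_mul_extendedPartialSum] at h1
  have hwm : Measurable (w j) := (Lp.stronglyMeasurable (w j)).measurable
  have hqm : ∀ N, Measurable (rowPartialSum a α lam nrm c l v j N) := fun N =>
    (continuous_rowPartialSum lam nrm c l v j N).measurable
  have hmu := (continuous_mu (a := a) (α := α)).measurable
  have h2 : TendstoInMeasure (volume.restrict (Set.Ioo 0 x))
      (fun N t => rowPartialSum a α lam nrm c l v j N (mu a α t)) atTop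
      (fun t => w j (mu a α t)) := by
    refine tendstoInMeasure_of_tendsto_eLpNorm two_ne_zero
      (fun N => ((hqm N).comp hmu).aestronglyMeasurable) (hwm.comp hmu).aestronglyMeasurable ?_
    have h3 := ENNReal.Tendsto.const_mul
      (a := (1 + ENNReal.ofReal α⁻¹) ^ (1 / 2 : ENNReal).toReal) (tendsto_rowPartialSum h j)
      (Or.inr (ENNReal.rpow_ne_top_of_nonneg ENNReal.toReal_nonneg
        (ENNReal.add_ne_top.2 ⟨ENNReal.one_ne_top, ENNReal.ofReal_ne_top⟩)))
    rw [mul_zero] at h3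
    exact tendsto_of_tendsto_of_tendsto_of_le_of_le tendsto_const_nhds h3 (fun _ => zero_le)
      fun N => eLpNorm_comp_mu_le ha hα ((hqm N).sub hwm) x
  filter_upwards [tendstoInMeasure_ae_unique h1 h2] with t ht
  rw [intervalIntegral.integral_of_le hX.le, integral_Ioc_eq_integral_Ioo]
  exact ht

/-- The main equation at `x` is solved row by row, with the operator of `exists_row_operator`. -/
theorem existsUnique_mainEquation (ha : 0 < a) (hα : 0 < α)
    (hlam : Function.Injective lam) (hpos : ∀ n, 0 < nrm n)
    (hs : Summable fun n : ℤ => (lam n - lamZero a α n) ^ 2)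
    (hw : Summable fun n => (nrm n - mu a α Real.pi) ^ 2) (hc : 0 ≤ c)
    (hF : IsKernel a α (extendedPartialSum a α lam nrm c l) F₀)
    {x : ℝ} (hx : x ∈ Set.Ioc 0 Real.pi) : ∃! A, MainEquation a α F₀ x A := by
  obtain ⟨R, hRm, hRL, ε, hε, hR⟩ := exists_kernel ha hα hpos hs hw c l
  have hmono := (strictMono_mu (a := a) hα).monotone
  have hX : 0 < mu a α x := by
    rw [← mu_zero (α := α) ha]
    exact strictMono_mu hα hx.1
  have hXb : mu a α x ≤ mu a α Real.pi := hmono hx.2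
  obtain ⟨K, hK, hKu⟩ := exists_row_operator hX hXb hlam hpos hs hw hc l
  have hRx : ∀ i j, MemLp (fun τ => R (mu a α x) τ i j) 2
      (volume.restrict (Set.Ioo 0 (mu a α x))) := fun i j =>
    (hRL _ ⟨hX.le, hXb⟩ i j).mono_measure
      (Measure.restrict_mono (Set.Ioo_subset_Ioo_right hXb) le_rfl)
  set g : Fin 2 → RowSpace (mu a α x) := fun i =>
    WithLp.toLp 2 fun j => (hRx i j).toLp _ with hg
  -- The equation splits into one equation `v + K v = -g i` for each row `v` of `A`.
  have key : ∀ A : Matrix (Fin 2) (Fin 2) (Lp ℂ 2 (volume.restrict (Set.Ioo 0 (mu a α x)))),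
      MainEquation a α F₀ x A ↔
        ∀ i, (WithLp.toLp 2 (A i) : RowSpace (mu a α x)) + K (WithLp.toLp 2 (A i)) = -g i := by
    intro A
    have h1 : ∀ i j, (∀ᵐ t ∂(volume.restrict (Set.Ioo 0 x)),
        A i j (mu a α t) + F₀ (mu a α x) t i j +
          ∫ ξ in (0 : ℝ)..(mu a α x), ∑ k, A i k ξ * F₀ ξ t k j = 0) ↔
        A i j + K (WithLp.toLp 2 (A i)) j = -g i j := by
      intro i j
      have h2 := ae_integral_sum_mul_eq ha hα hF hRm hε hR hx (hK (WithLp.toLp 2 (A i))) j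
      have h3 := ae_restrict_of_ae_restrict_of_subset (Set.Ioo_subset_Ioo_right hx.2)
        (hF.ae_eq hRm hε hR ⟨hX.le, hXb⟩ i j)
      have h4 : (∀ᵐ t ∂(volume.restrict (Set.Ioo 0 x)),
          A i j (mu a α t) + F₀ (mu a α x) t i j +
            ∫ ξ in (0 : ℝ)..(mu a α x), ∑ k, A i k ξ * F₀ ξ t k j = 0) ↔
          ∀ᵐ t ∂(volume.restrict (Set.Ioo 0 x)), A i j (mu a α t) +
            R (mu a α x) (mu a α t) i j + K (WithLp.toLp 2 (A i)) j (mu a α t) = 0 := by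
        refine eventually_congr ?_
        filter_upwards [h2, h3] with t h5 h6
        rw [← h5, h6]
      rw [h4, ae_comp_mu_iff ha hα x (p := fun τ => A i j τ + R (mu a α x) τ i j +
        K (WithLp.toLp 2 (A i)) j τ = 0), ← sub_eq_zero, sub_neg_eq_add, Lp.ext_iff]
      refine eventually_congr ?_
      filter_upwards [Lp.coeFn_add (A i j + K (WithLp.toLp 2 (A i)) j) (g i j),
        Lp.coeFn_add (A i j) (K (WithLp.toLp 2 (A i)) j), (hRx i j).coeFn_toLp,
        Lp.coeFn_zero ℂ 2 (volume.restrict (Set.Ioo 0 (mu a α x)))] with τ h5 h6 h7 h8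
      rw [h5, Pi.add_apply, h6, Pi.add_apply, h8, Pi.zero_apply,
        show g i j τ = R (mu a α x) τ i j from h7, add_right_comm]
    unfold MainEquation
    simp only [ae_all_iff, h1]
    refine forall_congr' fun i => ⟨fun h => PiLp.ext fun j => h j, fun h j => ?_⟩
    exact congrArg (fun v : RowSpace (mu a α x) => v j) h
  choose v hv hvu using fun i => hKu (-g i)
  refine ⟨fun i => WithLp.ofLp (v i), (key _).2 fun i => hv i, fun A hA => ?_⟩
  funext i
  exact congrArg WithLp.ofLp (hvu i _ ((key A).1 hA i))

/-- Both kinds of spectral data lead to partial sums that eventually coincide with partial sums of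
the extended form, for which the kernel exists and the main equation is uniquely solvable. -/
theorem exists_isKernel_and_existsUnique (ha : 0 < a) (hα : 0 < α)
    (hlam : Function.Injective lam) (hpos : ∀ n, 0 < nrm n)
    (hs : Summable fun n : ℤ => (lam n - lamZero a α n) ^ 2)
    (hw : Summable fun n => (nrm n - mu a α Real.pi) ^ 2) (hc : 0 ≤ c)
    {S : ℕ → ℝ → ℝ → Matrix (Fin 2) (Fin 2) ℂ}
    (hS : ∀ᶠ N : ℕ in atTop, ∀ x t, S N x t = extendedPartialSum a α lam nrm c l N x t) :
    (∃ F₀, IsKernel a α S F₀) ∧ ∀ F₀, IsKernel a α S F₀ →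
      ∀ x ∈ Set.Ioc 0 Real.pi, ∃! A, MainEquation a α F₀ x A := by
  have hiff : ∀ F₀, IsKernel a α S F₀ ↔
      IsKernel a α (extendedPartialSum a α lam nrm c l) F₀ := by
    intro F₀
    refine and_congr_right fun _ => forall₂_congr fun x _ => forall₂_congr fun i j => ?_
    refine tendsto_congr' ?_
    filter_upwards [hS] with N hN
    simp only [hN]
  refine ⟨?_, fun F₀ hF x hx =>
    existsUnique_mainEquation ha hα hlam hpos hs hw hc ((hiff F₀).1 hF) hx⟩
  obtain ⟨R, hRm, -, ε, hε, hR⟩ := exists_kernel ha hα hpos hs hw c l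
  refine ⟨fun x t => R x (mu a α t), (hiff _).2 ⟨fun i j => ?_, fun x hx i j => ?_⟩⟩
  · exact (hRm i j).comp (measurable_fst.prodMk (continuous_mu.measurable.comp measurable_snd))
  · exact tendsto_of_tendsto_of_tendsto_of_le_of_le tendsto_const_nhds hε (fun _ => zero_le)
      fun N => hR N x hx i j

end Solvability

end DiracInverse

theorem mainTheorem6 (a α : ℝ) (ha : a ∈ Set.Ioo 0 Real.pi) (hα : 0 < α) (hα1 : α ≠ 1) :
    (∀ (p q : ℝ → ℝ) (h₁ h₂ : ℝ),
      MemLp p 2 (volume.restrict (Set.Ioo 0 Real.pi)) →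
      MemLp q 2 (volume.restrict (Set.Ioo 0 Real.pi)) →
      0 < h₂ →
      (∃ F₀, DiracInverse.IsKernel a α
        (DiracInverse.spectralPartialSum a α p q h₁ h₂) F₀) ∧
      ∀ F₀, DiracInverse.IsKernel a α
          (DiracInverse.spectralPartialSum a α p q h₁ h₂) F₀ →
        ∀ x ∈ Set.Ioc 0 Real.pi, ∃! A, DiracInverse.MainEquation a α F₀ x A) ∧
    (∀ lam nrm : ℤ → ℝ,
      Function.Injective lam → (∀ n, 0 < nrm n) →
      Summable (fun n => (lam n - DiracInverse.lamZero a α n) ^ 2) →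
      Summable (fun n => (nrm n - DiracInverse.mu a α Real.pi) ^ 2) →
      (∃ F₀, DiracInverse.IsKernel a α (DiracInverse.dataPartialSum a α lam nrm) F₀) ∧
      ∀ F₀, DiracInverse.IsKernel a α (DiracInverse.dataPartialSum a α lam nrm) F₀ →
        ∀ x ∈ Set.Ioc 0 Real.pi, ∃! A, DiracInverse.MainEquation a α F₀ x A) := by
  refine ⟨fun p q h₁ h₂ hp hq hh => ?_, fun lam nrm hlam hpos hs hw => ?_⟩
  · obtain ⟨lam, nrm, l, c, hlam, hpos, hs, hw, hc, hS⟩ :=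
      DiracInverse.exists_spectral_data ha hα hp hq h₁ hh
    exact DiracInverse.exists_isKernel_and_existsUnique ha.1 hα hlam hpos hs hw hc hS
  · refine DiracInverse.exists_isKernel_and_existsUnique (c := 0) (l := 0) ha.1 hα hlam hpos hs hw
      le_rfl (Filter.Eventually.of_forall fun N x t => ?_)
    rw [DiracInverse.extendedPartialSum, Complex.ofReal_zero, zero_smul, zero_add]
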